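/- **Setting.** First-order formulas without identity are built from atoms by $\neg,\vee,\wedge,\exists,\forall$ over a signature $\Sigma$. Besides the ordinary variables $x$ (free or bound) there is a free $\gamma$-variable $x^\gamma$ for every ordinary variable $x$; $\gamma$-variables are never bound. A formula of $\Sigma$ contains no $\gamma$-variables. A formula is *rectified* if it has no vacuous quantifier, no variable occurs both free and bound in it, and no two of its quantifiers bind the same variable. A position is positive (negative) if it is in the scope of an even (odd) number of negations. A quantifier is a *$\gamma$-quantifier* if it is an $\exists$ at a positive or a $\forall$ at a negative position, and a *$\delta$-quantifier* otherwise; it is *accessible* if it is in the scope of no quantifier. The height of a term is $|f(t_1,\dots,t_m)|=1+\max\{0,|t_1|,\dots,|t_m|\}$, variables counting as constants. $H\{x\mapsto t\}$ replaces the free occurrences of $x$ without renaming. A *sentential tautology* is a quantifier-free formula that is truth-functionally valid when its atoms are read as sentential variables. Let $\delta$ be a function that maps each formula $B$ with variables $x_1,\dots,x_m$ to a function symbol $(B,x_1,\dots,x_m)^\delta$ of arity $m$ that is not in $\Sigma$, such that $(B,x_1,\dots,x_m)^\delta=(C,x'_1,\dots,x'_{m'})^\delta$ (for distinct variables occurring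 free in $B$, resp. $C$) only if the two tuples are equal or $C$ results from $B$ by renaming bound variables and by the bijective renaming $\{x_1\mapsto x'_1,\dots,x_m\mapsto x'_{m'}\}$. *Property C\*.* The *$\delta^{++}$-Skolemized form* of a rectified formula results by repeatedly replacing an outermost $\delta$-quantified subformula $Qy.H$ by $H\{y\mapsto (Qy.H,x_1,\dots,x_m)^\delta(x_1,\dots,x_m)\}$, where $x_1,\dots,x_m$ (from outside in) are the variables of those $\gamma$-quantifiers having $Qy.H$ in their scope that actually occur in $H$, until no $\delta$-quantifier is left. Let $F$ be the $\delta^{++}$-Skolemized form of $A$ and let $T_n(F)$ be the finite set of all terms of height $<n$ built from the function symbols and free variables occurring in $F$, and also from a fresh constant $\bullet$ if neither constants nor free variables occur in $F$. The expansion $F^{T}$ for a finite set $T$ of terms results by replacing, recursively, $\exists x.G$ by $\bigvee_{t\in T}G^{T}\{x\mapsto t\}$ and $\forall x.G$ by $\bigwedge_{t\in T}G^{T}\{x\mapsto t\}$ (undefined if $T=\emptyset$ and $F$ contains a quantifier). $A$ *has Property C\* of order $n$* if $F^{T_n(F)}$ is defined and is a sentential tautology. *Rules* (premise $\Rightarrow$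 conclusion, $A[\dots]$ a context): - generalized simplification: $A[H\circ H']\Rightarrow A[H]$, where $H'$ is $H$ or results from $H$ by renaming bound variables, and $\circ$ is $\vee$ if the position is positive and $\wedge$ if it is negative; - generalized restricted $\gamma$-quantification: $A[H\{x\mapsto x^\gamma\}]\Rightarrow A[Qx.H]$, where $Qx.$ is an accessible $\gamma$-quantifier of $A[Qx.H]$; - generalized $\delta^{++}$-quantification: $A[H\{y\mapsto (Qy.H,x_1^\gamma,\dots,x_m^\gamma)^\delta(x_1^\gamma,\dots,x_m^\gamma)\}]\Rightarrow A[Qy.H]$, where $Qy.$ is an accessible $\delta$-quantifier of $A[Qy.H]$ and $x_1^\gamma,\dots,x_m^\gamma$ are exactly the $\gamma$-variables occurring in $Qy.H$, without repetition. **Theorem (Herbrand's Fundamental Theorem à la Wirth).** Let $A$ be a rectified first-order formula of $\Sigma$ and let $n$ be a positive natural number. The following two statements are equivalent. 1. $A$ has Property C\* of order $n$. 2. There are a quantifier-free formula $B$ (possibly with free $\gamma$-variables), a substitution $\sigma$ of terms $t$ with $|t|<n$ for the $\gamma$-variables of $B$ such that $B\sigma$ is a sentential tautology, and a derivation of $A$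 from $B$ that consists in applications of the generalized rules of simplification, $\delta^{++}$-quantification and restricted $\gamma$-quantification. Moreover, witnesses for (2) can always be constructed if (1) holds: if the symbols of $\Sigma$ and the new function symbols are effectively coded with computable arities, and $\delta$ is computable, then there is a partial computable function that, given any such $A$ and $n$ for which (1) holds, returns such a $B$, a finite list representing such a $\sigma$, and such a derivation. -/

import Mathlib

universe u v w

namespace HerbrandWirth

/-! ## Syntax -/

/-- Variables: `Sum.inl x` is the ordinary variable `x` (bindable by quantifiers, or free),
`Sum.inr x` is the free γ-variable `x^γ` belonging to `x` (never bound). -/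
abbrev Variable := ℕ ⊕ ℕ

/-- Function symbols: those of the original signature `L`, the new symbols `Sk m` of arity `m`
from which the Skolem functions are taken, and the fresh constant `•`. -/
inductive FunSym (L : FirstOrder.Language.{u, v}) (Sk : ℕ → Type w) : ℕ → Type (max u w)
  | orig {m : ℕ} (f : L.Functions m) : FunSym L Sk m
  | skolem {m : ℕ} (s : Sk m) : FunSym L Sk m
  | bullet : FunSym L Sk 0

/-- The extended signature. -/
def extLang (L : FirstOrder.Language.{u, v}) (Sk : ℕ → Type w) :
    FirstOrder.Language.{max u w, v} where
  Functions := FunSym L Sk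
  Relations := L.Relations

/-- Terms over the extended signature. -/
abbrev Tm (L : FirstOrder.Language.{u, v}) (Sk : ℕ → Type w) :=
  (extLang L Sk).Term Variable

/-- The two quantifiers. -/
inductive Quantifier
  | ex
  | all

/-- First-order formulas (without identity) with named bound variables. -/
inductive Fml (L : FirstOrder.Language.{u, v}) (Sk : ℕ → Type w) : Type (max u v w)
  | rel {k : ℕ} (R : L.Relations k) (ts : Fin k → Tm L Sk) : Fml L Sk
  | neg (A : Fml L Sk) : Fml L Sk
  | or (A B : Fml L Sk) : Fml L Sk
  | and (A B : Fml L Sk) : Fml L Sk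
  | quant (q : Quantifier) (x : ℕ) (A : Fml L Sk) : Fml L Sk

variable {L : FirstOrder.Language.{u, v}} {Sk : ℕ → Type w}

/-- The kind of a γ-quantifier at a position of the given polarity (`true` is positive, that is,
in the scope of an even number of negations). -/
def gammaQ : Bool → Quantifier
  | true => .ex
  | false => .all

/-- The kind of a δ-quantifier at a position of the given polarity. -/
def deltaQ (p : Bool) : Quantifier := gammaQ (!p)

/-- The height of a term; variables count as constants. -/
def height : Tm L Sk → ℕ
  | .var _ => 1
  | .func _ ts => 1 + Finset.univ.sup fun i => height (ts i)

/-- A term of the original signature: no Skolem symbol, no `•`, no γ-variable. -/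
def TmOriginal : Tm L Sk → Prop
  | .var v => v.isLeft = true
  | .func f ts => (∃ g, f = FunSym.orig g) ∧ ∀ i, TmOriginal (ts i)

/-- The function symbols that occur in a term. -/
def tmSyms : Tm L Sk → Set (Σ m, FunSym L Sk m)
  | .var _ => ∅
  | .func (l := m) f ts => insert ⟨m, f⟩ (⋃ i, tmSyms (ts i))

namespace Fml

/-- The variables (ordinary ones and γ-variables) that occur free in a formula. -/
def freeVars : Fml L Sk → Finset Variable
  | rel _ ts => Finset.univ.biUnion fun i => (ts i).varFinset
  | neg A => A.freeVars
  | or A B => A.freeVars ∪ B.freeVars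
  | and A B => A.freeVars ∪ B.freeVars
  | quant _ x A => A.freeVars.erase (Sum.inl x)

/-- The function symbols that occur in a formula. -/
def syms : Fml L Sk → Set (Σ m, FunSym L Sk m)
  | rel _ ts => ⋃ i, tmSyms (ts i)
  | neg A => A.syms
  | or A B => A.syms ∪ B.syms
  | and A B => A.syms ∪ B.syms
  | quant _ _ A => A.syms

/-- A formula of the original signature. -/
def Original : Fml L Sk → Prop
  | rel _ ts => ∀ i, TmOriginal (ts i)
  | neg A => A.Original
  | or A B => A.Original ∧ B.Original
  | and A B => A.Original ∧ B.Original
  | quant _ _ A => A.Original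

/-- The variables of the quantifiers of a formula, one entry for every quantifier. -/
def binders : Fml L Sk → List ℕ
  | rel _ _ => []
  | neg A => A.binders
  | or A B => A.binders ++ B.binders
  | and A B => A.binders ++ B.binders
  | quant _ x A => x :: A.binders

/-- No quantifier is vacuous. -/
def NoVacuous : Fml L Sk → Prop
  | rel _ _ => True
  | neg A => A.NoVacuous
  | or A B => A.NoVacuous ∧ B.NoVacuous
  | and A B => A.NoVacuous ∧ B.NoVacuous
  | quant _ x A => Sum.inl x ∈ A.freeVars ∧ A.NoVacuous

/-- Rectified formulas: no vacuous quantifier, no variable with both free and bound occurrences,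
no two quantifiers for the same variable. -/
def Rectified (A : Fml L Sk) : Prop :=
  A.NoVacuous ∧ A.binders.Nodup ∧ ∀ x ∈ A.binders, Sum.inl x ∉ A.freeVars

/-- Quantifier-free formulas. -/
def QF : Fml L Sk → Prop
  | rel _ _ => True
  | neg A => A.QF
  | or A B => A.QF ∧ B.QF
  | and A B => A.QF ∧ B.QF
  | quant _ _ _ => False

/-- Simultaneous replacement of the free occurrences of variables by terms, without any renaming
of bound variables. -/
def subst : Fml L Sk → (Variable → Tm L Sk) → Fml L Sk
  | rel R ts, s => rel R fun i => (ts i).subst s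
  | neg A, s => neg (A.subst s)
  | or A B, s => or (A.subst s) (B.subst s)
  | and A B, s => and (A.subst s) (B.subst s)
  | quant q x A, s => quant q x (A.subst (Function.update s (Sum.inl x) (.var (Sum.inl x))))

/-- `H{x ↦ t}` for an ordinary variable `x`. -/
def replace (H : Fml L Sk) (x : ℕ) (t : Tm L Sk) : Fml L Sk :=
  H.subst (Function.update FirstOrder.Language.Term.var (Sum.inl x) t)

/-- `Bσ` for a substitution `σ` of the γ-variables. -/
def instGamma (B : Fml L Sk) (σ : ℕ → Tm L Sk) : Fml L Sk :=
  B.subst (Sum.elim (fun x => .var (Sum.inl x)) σ)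

/-- The number of connectives and quantifiers. -/
def size : Fml L Sk → ℕ
  | rel _ _ => 0
  | neg A => A.size + 1
  | or A B => A.size + B.size + 1
  | and A B => A.size + B.size + 1
  | quant _ _ A => A.size + 1

theorem size_subst (A : Fml L Sk) : ∀ s : Variable → Tm L Sk, (A.subst s).size = A.size := by
  induction A with
  | rel R ts => intro s; rfl
  | neg A ih => intro s; simp [subst, size, ih]
  | or A B ihA ihB => intro s; simp [subst, size, ihA, ihB]
  | and A B ihA ihB => intro s; simp [subst, size, ihA, ihB]
  | quant q x A ih => intro s; simp [subst, size, ih]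

theorem size_replace (A : Fml L Sk) (x : ℕ) (t : Tm L Sk) : (A.replace x t).size = A.size :=
  size_subst A _

/-- Truth value of a quantifier-free formula when its atomic subformulas are read as sentential
variables (the value at a quantifier is irrelevant). -/
def eval (val : ∀ k : ℕ, L.Relations k → (Fin k → Tm L Sk) → Prop) : Fml L Sk → Prop
  | rel R ts => val _ R ts
  | neg A => ¬ A.eval val
  | or A B => A.eval val ∨ B.eval val
  | and A B => A.eval val ∧ B.eval val
  | quant _ _ _ => False

/-- Sentential tautologies. -/
def Tautology (A : Fml L Sk) : Prop :=
  A.QF ∧ ∀ val : ∀ k : ℕ, L.Relations k → (Fin k → Tm L Sk) → Prop, A.eval val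

end Fml

/-! ## Variants -/

/-- Terms that agree up to replacing variables by variables related by `r`. -/
inductive TmRen (r : Variable → Variable → Prop) : Tm L Sk → Tm L Sk → Prop
  | var {a b : Variable} (h : r a b) : TmRen r (.var a) (.var b)
  | func {m : ℕ} (f : (extLang L Sk).Functions m) {ts us : Fin m → Tm L Sk}
      (h : ∀ i, TmRen r (ts i) (us i)) : TmRen r (.func f ts) (.func f us)

/-- The correspondence of variables below a pair of corresponding quantifiers for `x` and `y`. -/
def bindRel (r : Variable → Variable → Prop) (x y : ℕ) (a b : Variable) : Prop :=
  (a = Sum.inl x ∧ b = Sum.inl y) ∨ (a ≠ Sum.inl x ∧ b ≠ Sum.inl y ∧ r a b)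

/-- Formulas that agree up to renaming of bound variables and replacing free variables by free
variables related by `r`. -/
inductive Ren : (Variable → Variable → Prop) → Fml L Sk → Fml L Sk → Prop
  | rel {r : Variable → Variable → Prop} {k : ℕ} (R : L.Relations k) {ts us : Fin k → Tm L Sk}
      (h : ∀ i, TmRen r (ts i) (us i)) : Ren r (.rel R ts) (.rel R us)
  | neg {r : Variable → Variable → Prop} {A A' : Fml L Sk} (h : Ren r A A') :
      Ren r (.neg A) (.neg A')
  | or {r : Variable → Variable → Prop} {A A' B B' : Fml L Sk} (hA : Ren r A A')
      (hB : Ren r B B') : Ren r (.or A B) (.or A' B')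
  | and {r : Variable → Variable → Prop} {A A' B B' : Fml L Sk} (hA : Ren r A A')
      (hB : Ren r B B') : Ren r (.and A B) (.and A' B')
  | quant {r : Variable → Variable → Prop} (q : Quantifier) (x y : ℕ) {A A' : Fml L Sk}
      (h : Ren (bindRel r x y) A A') : Ren r (.quant q x A) (.quant q y A')

/-- `H'` is a variant of `H`: it results from `H` by renaming of bound variables. -/
def Variant (H H' : Fml L Sk) : Prop := Ren Eq H H'

/-- The renaming `{xs₁ ↦ ys₁, …, xsₘ ↦ ysₘ}`, with all other variables fixed. -/
def listRel (xs ys : List Variable) (a b : Variable) : Prop :=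
  (∃ i : ℕ, xs[i]? = some a ∧ ys[i]? = some b) ∨ (a ∉ xs ∧ b ∉ ys ∧ a = b)

/-! ## The function δ -/

/-- A function that takes a formula `B` and variables `x₁, …, xₘ` to a function symbol of arity
`m` that is not part of the original signature. -/
abbrev DeltaFn (L : FirstOrder.Language.{u, v}) (Sk : ℕ → Type w) :=
  Fml L Sk → (xs : List Variable) → Sk xs.length

/-- If two arguments (formulas, each with distinct variables that occur free in it) are mapped to
the same symbol, then they are equal, or the second formula results from the first by renaming of
bound variables and the bijective renaming of `x₁, …, xₘ` to `x'₁, …, x'ₘ'`. -/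
def DeltaFn.Admissible (δ : DeltaFn L Sk) : Prop :=
  ∀ (B C : Fml L Sk) (xs ys : List Variable),
    xs.Nodup → (∀ x ∈ xs, x ∈ B.freeVars) → ys.Nodup → (∀ y ∈ ys, y ∈ C.freeVars) →
    (⟨xs.length, δ B xs⟩ : Σ m, Sk m) = ⟨ys.length, δ C ys⟩ →
      (C = B ∧ ys = xs) ∨ Ren (listRel xs ys) B C

/-- The term `(B, x₁, …, xₘ)^δ(x₁, …, xₘ)`. -/
def deltaTerm (δ : DeltaFn L Sk) (B : Fml L Sk) (xs : List Variable) : Tm L Sk :=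
  FirstOrder.Language.Term.func (L := extLang L Sk) (FunSym.skolem (δ B xs))
    fun i => .var (xs.get i)

/-! ## Skolemized form, expansion, Property C* -/

/-- δ⁺⁺-Skolemization, from the outermost δ-quantifiers inwards, of a subformula at a position of
polarity `p` in the scope of γ-quantifiers for the variables `xs` (listed from outside in). The
Skolem term has as arguments those variables among `xs` that occur in the scope `H`. -/
def skolemize (δ : DeltaFn L Sk) : Bool → List ℕ → Fml L Sk → Fml L Sk
  | _, _, .rel R ts => .rel R ts
  | p, xs, .neg A => .neg (skolemize δ (!p) xs A)
  | p, xs, .or A B => .or (skolemize δ p xs A) (skolemize δ p xs B)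
  | p, xs, .and A B => .and (skolemize δ p xs A) (skolemize δ p xs B)
  | true, xs, .quant .ex x H => .quant .ex x (skolemize δ true (xs ++ [x]) H)
  | false, xs, .quant .all x H => .quant .all x (skolemize δ false (xs ++ [x]) H)
  | true, xs, .quant .all y H =>
      skolemize δ true xs (H.replace y (deltaTerm δ (.quant .all y H)
        ((xs.map Sum.inl).filter (· ∈ H.freeVars))))
  | false, xs, .quant .ex y H =>
      skolemize δ false xs (H.replace y (deltaTerm δ (.quant .ex y H)
        ((xs.map Sum.inl).filter (· ∈ H.freeVars))))
termination_by _ _ A => A.size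
decreasing_by all_goals simp only [Fml.size, Fml.size_replace]; omega

/-- The δ⁺⁺-Skolemized form of a formula. -/
def skolemForm (δ : DeltaFn L Sk) (A : Fml L Sk) : Fml L Sk := skolemize δ true [] A

/-- No constant symbol and no free variable occurs in the formula. -/
def NoConstant (F : Fml L Sk) : Prop :=
  (∀ c : FunSym L Sk 0, (⟨0, c⟩ : Σ m, FunSym L Sk m) ∉ F.syms) ∧ F.freeVars = ∅

/-- Terms over the symbols that occur free in `F`, and over `•` if neither constants nor free
variables occur in `F`. -/
def TermOver (F : Fml L Sk) : Tm L Sk → Prop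
  | .var v => v ∈ F.freeVars
  | .func (l := m) f ts =>
      ((⟨m, f⟩ : Σ m, FunSym L Sk m) ∈ F.syms ∨
        (NoConstant F ∧ (⟨m, f⟩ : Σ m, FunSym L Sk m) = ⟨0, FunSym.bullet⟩)) ∧
      ∀ i, TermOver F (ts i)

/-- The champ fini of order `n` for `F`: terms of height below `n` over the free symbols. -/
def champFini (n : ℕ) (F : Fml L Sk) : Set (Tm L Sk) := {t | TermOver F t ∧ height t < n}

/-- Finite non-empty disjunction. -/
def bigOr : Fml L Sk → List (Fml L Sk) → Fml L Sk
  | A, [] => A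
  | A, B :: l => .or A (bigOr B l)

/-- Finite non-empty conjunction. -/
def bigAnd : Fml L Sk → List (Fml L Sk) → Fml L Sk
  | A, [] => A
  | A, B :: l => .and A (bigAnd B l)

/-- `IsExpansion T A B`: `B` is the expansion of `A` with respect to the finite set `T` of terms,
the disjunctions and conjunctions being written down in the order of some enumeration of `T`
without repetitions. There is none if `T` is empty and `A` contains a quantifier. -/
inductive IsExpansion (T : Set (Tm L Sk)) : Fml L Sk → Fml L Sk → Prop
  | rel {k : ℕ} (R : L.Relations k) (ts : Fin k → Tm L Sk) :
      IsExpansion T (.rel R ts) (.rel R ts)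
  | neg {A B : Fml L Sk} (h : IsExpansion T A B) : IsExpansion T (.neg A) (.neg B)
  | or {A₁ A₂ B₁ B₂ : Fml L Sk} (h₁ : IsExpansion T A₁ B₁) (h₂ : IsExpansion T A₂ B₂) :
      IsExpansion T (.or A₁ A₂) (.or B₁ B₂)
  | and {A₁ A₂ B₁ B₂ : Fml L Sk} (h₁ : IsExpansion T A₁ B₁) (h₂ : IsExpansion T A₂ B₂) :
      IsExpansion T (.and A₁ A₂) (.and B₁ B₂)
  | ex (x : ℕ) {A B : Fml L Sk} (h : IsExpansion T A B) (t : Tm L Sk) (l : List (Tm L Sk))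
      (hnd : (t :: l).Nodup) (hT : ∀ s, s ∈ t :: l ↔ s ∈ T) :
      IsExpansion T (.quant .ex x A) (bigOr (B.replace x t) (l.map (B.replace x)))
  | all (x : ℕ) {A B : Fml L Sk} (h : IsExpansion T A B) (t : Tm L Sk) (l : List (Tm L Sk))
      (hnd : (t :: l).Nodup) (hT : ∀ s, s ∈ t :: l ↔ s ∈ T) :
      IsExpansion T (.quant .all x A) (bigAnd (B.replace x t) (l.map (B.replace x)))

/-- Property C* of order `n`: the expansion of the δ⁺⁺-Skolemized form `F` with respect to its
champ fini of order `n` (exists and) is a sentential tautology. -/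
def PropertyCstar (δ : DeltaFn L Sk) (n : ℕ) (A : Fml L Sk) : Prop :=
  ∃ E, IsExpansion (champFini n (skolemForm δ A)) (skolemForm δ A) E ∧ E.Tautology

/-! ## The calculus -/

/-- Formula contexts `A[…]` with one hole. -/
inductive Ctx (L : FirstOrder.Language.{u, v}) (Sk : ℕ → Type w) : Type (max u v w)
  | hole : Ctx L Sk
  | neg (C : Ctx L Sk) : Ctx L Sk
  | orL (C : Ctx L Sk) (B : Fml L Sk) : Ctx L Sk
  | orR (B : Fml L Sk) (C : Ctx L Sk) : Ctx L Sk
  | andL (C : Ctx L Sk) (B : Fml L Sk) : Ctx L Sk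
  | andR (B : Fml L Sk) (C : Ctx L Sk) : Ctx L Sk
  | quant (q : Quantifier) (x : ℕ) (C : Ctx L Sk) : Ctx L Sk

namespace Ctx

/-- `A[H]`. -/
def fill : Ctx L Sk → Fml L Sk → Fml L Sk
  | hole, H => H
  | neg C, H => .neg (C.fill H)
  | orL C B, H => .or (C.fill H) B
  | orR B C, H => .or B (C.fill H)
  | andL C B, H => .and (C.fill H) B
  | andR B C, H => .and B (C.fill H)
  | quant q x C, H => .quant q x (C.fill H)

/-- The polarity of the hole: `true` if it is in the scope of an even number of negations. -/
def positive : Ctx L Sk → Bool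
  | hole => true
  | neg C => !C.positive
  | orL C _ => C.positive
  | orR _ C => C.positive
  | andL C _ => C.positive
  | andR _ C => C.positive
  | quant _ _ C => C.positive

/-- The hole is in the scope of no quantifier. -/
def Accessible : Ctx L Sk → Prop
  | hole => True
  | neg C => C.Accessible
  | orL C _ => C.Accessible
  | orR _ C => C.Accessible
  | andL C _ => C.Accessible
  | andR _ C => C.Accessible
  | quant _ _ _ => False

end Ctx

/-- `H ∨ H'` for positive, `H ∧ H'` for negative polarity. -/
def alphaOp : Bool → Fml L Sk → Fml L Sk → Fml L Sk
  | true, H, H' => .or H H'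
  | false, H, H' => .and H H'

/-- `Step δ G G'`: one inference with premise `G` and conclusion `G'`. -/
inductive Step (δ : DeltaFn L Sk) : Fml L Sk → Fml L Sk → Prop
  /-- generalized rule of simplification -/
  | simplification (C : Ctx L Sk) (H H' : Fml L Sk) (h : Variant H H') :
      Step δ (C.fill (alphaOp C.positive H H')) (C.fill H)
  /-- generalized rule of restricted γ-quantification -/
  | gamma (C : Ctx L Sk) (hC : C.Accessible) (x : ℕ) (H : Fml L Sk) :
      Step δ (C.fill (H.replace x (.var (Sum.inr x)))) (C.fill (.quant (gammaQ C.positive) x H))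
  /-- generalized rule of δ⁺⁺-quantification; `xs` enumerates the free γ-variables -/
  | delta (C : Ctx L Sk) (hC : C.Accessible) (y : ℕ) (H : Fml L Sk) (xs : List ℕ)
      (hnd : xs.Nodup)
      (hxs : ∀ x, x ∈ xs ↔ Sum.inr x ∈ (Fml.quant (deltaQ C.positive) y H).freeVars) :
      Step δ
        (C.fill (H.replace y
          (deltaTerm δ (.quant (deltaQ C.positive) y H) (xs.map Sum.inr))))
        (C.fill (.quant (deltaQ C.positive) y H))

/-- The list `D` of formulas is a derivation of `A` from `B`. -/
def IsDerivation (δ : DeltaFn L Sk) (B A : Fml L Sk) (D : List (Fml L Sk)) : Prop :=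
  D.IsChain (Step δ) ∧ D.head? = some B ∧ D.getLast? = some A

/-- `B`, `σ`, `D` are witnesses for the second statement of the theorem. -/
structure IsWitness (δ : DeltaFn L Sk) (n : ℕ) (A B : Fml L Sk) (σ : ℕ → Tm L Sk)
    (D : List (Fml L Sk)) : Prop where
  qf : B.QF
  height_lt : ∀ x, Sum.inr x ∈ B.freeVars → height (σ x) < n
  tautology : (B.instGamma σ).Tautology
  derivation : IsDerivation δ B A D

/-! ## Gödel numbers -/

section Coding

variable [Encodable (Σ m, L.Functions m)] [Encodable (Σ k, L.Relations k)]
  [Encodable (Σ m, Sk m)]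

/-- Gödel number of a function symbol. -/
def symCode : {m : ℕ} → FunSym L Sk m → ℕ
  | m, .orig f => Nat.pair 0 (Encodable.encode (⟨m, f⟩ : Σ m, L.Functions m))
  | m, .skolem s => Nat.pair 1 (Encodable.encode (⟨m, s⟩ : Σ m, Sk m))
  | _, .bullet => Nat.pair 2 0

/-- Gödel number of a term. -/
def tmCode : Tm L Sk → ℕ
  | .var v => Nat.pair 0 (Encodable.encode v)
  | .func f ts =>
      Nat.pair 1 (Nat.pair (symCode f) (Encodable.encode (List.ofFn fun i => tmCode (ts i))))

/-- Number of a quantifier. -/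
def quantCode : Quantifier → ℕ
  | .ex => 0
  | .all => 1

/-- Gödel number of a formula. -/
def fmlCode : Fml L Sk → ℕ
  | .rel (k := k) R ts =>
      Nat.pair 0 (Nat.pair (Encodable.encode (⟨k, R⟩ : Σ k, L.Relations k))
        (Encodable.encode (List.ofFn fun i => tmCode (ts i))))
  | .neg A => Nat.pair 1 (fmlCode A)
  | .or A B => Nat.pair 2 (Nat.pair (fmlCode A) (fmlCode B))
  | .and A B => Nat.pair 3 (Nat.pair (fmlCode A) (fmlCode B))
  | .quant q x A => Nat.pair 4 (Nat.pair (quantCode q) (Nat.pair x (fmlCode A)))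

/-- A finite list of pairs `(x, t)`, read as the substitution of γ-variables with `x^γ ↦ t`. -/
def listSubst (l : List (ℕ × Tm L Sk)) (x : ℕ) : Tm L Sk :=
  (l.lookup x).getD (.var (Sum.inr x))

/-- Gödel number of a triple of a formula, a finite substitution and a list of formulas. -/
def witnessCode (B : Fml L Sk) (l : List (ℕ × Tm L Sk)) (D : List (Fml L Sk)) : ℕ :=
  Nat.pair (fmlCode B) (Nat.pair
    (Encodable.encode (l.map fun p => (p.1, tmCode p.2)))
    (Encodable.encode (D.map fmlCode)))

/-- The function δ is computable (on Gödel numbers). -/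
def DeltaFn.Effective (δ : DeltaFn L Sk) : Prop :=
  ∃ d : ℕ → ℕ, Computable d ∧ ∀ (B : Fml L Sk) (xs : List Variable),
    d (Nat.pair (fmlCode B) (Encodable.encode xs)) =
      Encodable.encode (⟨xs.length, δ B xs⟩ : Σ m, Sk m)

end Coding

end HerbrandWirth

/-! Both directions of the equivalence pull a valuation of atoms back along a translation of terms.
Let F be the Skolemized form of A, T its champ fini of order n, and E the expansion.

From a derivation to Property C*. Fix a valuation of the atoms of E. Formulas are read in a
structure where γ-quantifiers range over T and δ-quantifiers over Skolem terms of F. A Skolem symbol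
that the calculus attaches to Qy.H is interpreted by the worst choice (`worst`): applied to values
of the γ-variables, it returns a Skolem term of F that refutes H at a positive position, or verifies
it at a negative one, whenever some candidate does. With these values each inference leads from
truth to truth (`exists_layered_of_steps`). The premise B is true because Bσ is a tautology and the
valuation can be pulled back (`holds_key_iff_eval`). Truth of A entails truth of E, since the Skolem
terms that F inserts are among the candidates (`eval_of_holds`).

Three difficulties determine the form of this argument. First, `δ` may give one symbol to formulas
that differ by a renaming, and a simplification in the scope of a quantifier alters the formula to
which `δ` is applied. The worst choice must not notice this; hence it depends only on a `Key`, a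
value in which bound variables are functions and H ∘ H collapses to H. Second, the formula behind a
Skolem symbol may contain further Skolem symbols. Read from A backwards, the formula of a
δ-inference contains only symbols of inferences nearer to A, so the interpretation is a recursion
along a `Layered` list (`exists_interp`). Third, values must stay below height n. The arguments of a
candidate occur in the value K to which it belongs, so its height is at most `K.ht + 1`
(`height_worst`), and `K.ht` is at most the largest height of the arguments of the calculus' own
Skolem term (`ht_le`). Hence evaluation never increases heights (`flatten_tmVal_spec`).

From Property C* to a derivation. To every t in T belongs a fresh number z_t. For a γ-quantifier,
simplification supplies one copy per element t, with the bound variable renamed to z_t, and the copy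
is derived from its instance with the γ-variable z_t. A Skolem term of F whose arguments have the
values t₁, …, tₘ is translated into the Skolem term that the δ-rule attaches to the translated
formula. This is again a recursion solved by `exists_interp`. Since one symbol may stand for several
formulas up to renaming, the δ-rule is applied to a canonical variant, reached by one more copy
(`Simulates.delta`). Copies left over are reduced to arbitrary quantifier-free formulas
(`exists_red`), which can only help: copies are joined by ∨ at positive and by ∧ at negative
positions. The substitution sends the γ-variable of z_t to the translation of t (`trClosed`), which
is not higher than t, and an atom of E corresponds to an atom of Bσ (`trClosed_subst`). So every
valuation of Bσ induces one of E, under which E is true.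

If n = 1, then T is empty. In this case `NoGamma` records that there are no γ-quantifiers, hence no
γ-variables.

Construction of witnesses. Being a witness is semidecidable: finitely many computable rules on lists
of numbers derive only true facts (`Derivable.meaning`) and a fact for some witness whenever
Property C* holds (`Derivable.witness`). An unbounded search for such a fact therefore terminates.
-/

namespace HerbrandWirth

open FirstOrder.Language (Term)

variable {L : FirstOrder.Language.{u, v}} {Sk : ℕ → Type w}

/-! ## Terms -/

/-- The Skolem symbol behind a function symbol, if there is one. -/
def FunSym.sk? : {m : ℕ} → FunSym L Sk m → Option (Σ m, Sk m)
  | _, .skolem s => some ⟨_, s⟩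
  | _, _ => none

/-- A Skolem symbol as a symbol of the extended signature. -/
def skSym (L : FirstOrder.Language.{u, v}) (s : Σ m, Sk m) : Σ m, FunSym L Sk m :=
  ⟨s.1, .skolem s.2⟩

theorem sk?_eq_some {m : ℕ} {f : FunSym L Sk m} {s : Σ m, Sk m} :
    f.sk? = some s ↔ (⟨m, f⟩ : Σ m, FunSym L Sk m) = skSym L s := by
  obtain ⟨k, s⟩ := s
  cases f with
  | orig f => simp [FunSym.sk?, skSym]; rintro rfl; simp
  | skolem f =>
    simp only [FunSym.sk?, skSym, Option.some.injEq]
    constructor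
    · intro h; cases h; rfl
    · intro h; cases h; rfl
  | bullet => simp [FunSym.sk?, skSym]; rintro rfl; simp

/-- Every subterm headed by a Skolem symbol has only variables with the property `P` as
arguments. -/
def TmFlat (P : Variable → Prop) : Tm L Sk → Prop
  | .var _ => True
  | .func f ts => (∀ i, TmFlat P (ts i)) ∧
      ((FunSym.sk? f).isSome → ∀ i, ∃ v, ts i = .var v ∧ P v)

theorem TmOriginal.flat (P : Variable → Prop) {t : Tm L Sk} (h : TmOriginal t) : TmFlat P t := by
  induction t with
  | var v => trivial
  | func f ts ih =>
    obtain ⟨⟨g, rfl⟩, h⟩ := h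
    exact ⟨fun i => ih i (h i), fun h => by simp [FunSym.sk?] at h⟩

theorem TmFlat.mono {P Q : Variable → Prop} {t : Tm L Sk} (h : TmFlat P t)
    (hPQ : ∀ v ∈ t.varFinset, P v → Q v) : TmFlat Q t := by
  induction t with
  | var v => trivial
  | func f ts ih =>
    have hv : ∀ i, ∀ v ∈ (ts i).varFinset, v ∈ (Term.func f ts).varFinset := fun i v hv => by
      simp only [Term.varFinset, Finset.mem_biUnion, Finset.mem_univ, true_and]
      exact ⟨i, hv⟩
    refine ⟨fun i => ih i (h.1 i) fun v hv' => hPQ v (hv i v hv'), fun hs i => ?_⟩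
    obtain ⟨v, hv', hP⟩ := h.2 hs i
    exact ⟨v, hv', hPQ v (hv i v (by simp [hv', Term.varFinset])) hP⟩

theorem mem_varFinset_func {m : ℕ} {f : (extLang L Sk).Functions m} {ts : Fin m → Tm L Sk}
    {v : Variable} : v ∈ (Term.func f ts).varFinset ↔ ∃ i, v ∈ (ts i).varFinset := by
  simp [Term.varFinset]

theorem mem_varFinset_var {v w : Variable} :
    v ∈ (Term.var w : Tm L Sk).varFinset ↔ v = w := by
  simp [Term.varFinset]

theorem TmOriginal.inr_notMem {t : Tm L Sk} (h : TmOriginal t) (x : ℕ) :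
    Sum.inr x ∉ t.varFinset := by
  induction t with
  | var v =>
    rw [mem_varFinset_var]; rintro rfl; simp [TmOriginal] at h
  | func f ts ih =>
    rw [mem_varFinset_func]; rintro ⟨i, hi⟩; exact ih i (h.2 i) hi

theorem TmOriginal.skSym_notMem {t : Tm L Sk} (h : TmOriginal t) (s : Σ m, Sk m) :
    skSym L s ∉ tmSyms t := by
  induction t with
  | var v => simp [tmSyms]
  | func f ts ih =>
    obtain ⟨⟨g, rfl⟩, h⟩ := h
    simp only [tmSyms, Set.mem_insert_iff, Set.mem_iUnion, not_or, not_exists]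
    refine ⟨fun hh => ?_, fun i => ih i (h i)⟩
    have := sk?_eq_some.2 hh.symm
    simp [FunSym.sk?] at this

theorem mem_varFinset_subst {t : Tm L Sk} {s : Variable → Tm L Sk} {v : Variable} :
    v ∈ (t.subst s).varFinset ↔ ∃ w ∈ t.varFinset, v ∈ (s w).varFinset := by
  induction t with
  | var w => simp [Term.subst, Term.varFinset]
  | func f ts ih =>
    simp only [Term.subst, mem_varFinset_func, ih]
    constructor
    · rintro ⟨i, w, h⟩; exact ⟨w, ⟨i, h.1⟩, h.2⟩
    · rintro ⟨w, ⟨i, h1⟩, h2⟩; exact ⟨i, w, h1, h2⟩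

theorem mem_tmSyms_subst {t : Tm L Sk} {s : Variable → Tm L Sk} {c : Σ m, FunSym L Sk m} :
    c ∈ tmSyms (t.subst s) ↔ c ∈ tmSyms t ∨ ∃ w ∈ t.varFinset, c ∈ tmSyms (s w) := by
  induction t with
  | var w => simp [Term.subst, Term.varFinset, tmSyms]
  | func f ts ih =>
    simp only [Term.subst, tmSyms, mem_varFinset_func, Set.mem_insert_iff, Set.mem_iUnion, ih]
    constructor
    · rintro (h | ⟨i, h | ⟨w, h⟩⟩)
      · exact .inl (.inl h)
      · exact .inl (.inr ⟨i, h⟩)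
      · exact .inr ⟨w, ⟨i, h.1⟩, h.2⟩
    · rintro ((h | ⟨i, h⟩) | ⟨w, ⟨i, h1⟩, h2⟩)
      · exact .inl h
      · exact .inr ⟨i, .inl h⟩
      · exact .inr ⟨i, .inr ⟨w, h1, h2⟩⟩

theorem tmSubst_congr {t : Tm L Sk} {s s' : Variable → Tm L Sk}
    (h : ∀ v ∈ t.varFinset, s v = s' v) : t.subst s = t.subst s' := by
  induction t with
  | var w => exact h w (mem_varFinset_var.2 rfl)
  | func f ts ih =>
    simp only [Term.subst]
    congr 1
    funext i
    exact ih i fun v hv => h v (mem_varFinset_func.2 ⟨i, hv⟩)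

theorem tmSubst_var (t : Tm L Sk) : t.subst Term.var = t := by
  induction t with
  | var w => rfl
  | func f ts ih => simp only [Term.subst, ih]

theorem tmSubst_eq_self {t : Tm L Sk} {s : Variable → Tm L Sk}
    (h : ∀ v ∈ t.varFinset, s v = .var v) : t.subst s = t := by
  rw [tmSubst_congr h, tmSubst_var]

theorem tmSubst_subst (t : Tm L Sk) (s s' : Variable → Tm L Sk) :
    (t.subst s).subst s' = t.subst fun v => (s v).subst s' := by
  induction t with
  | var w => rfl
  | func f ts ih => simp only [Term.subst, ih]

theorem one_le_height (t : Tm L Sk) : 1 ≤ height t := by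
  cases t with
  | var v => simp [height]
  | func f ts => simp [height]

/-- Variables with the property `P` must be fixed: they may be arguments of Skolem symbols, where a
compound term would destroy flatness. -/
theorem TmFlat.subst {P : Variable → Prop} {t : Tm L Sk} {s : Variable → Tm L Sk}
    (h : TmFlat P t) (hs : ∀ v, TmFlat P (s v)) (hP : ∀ v, P v → s v = .var v) :
    TmFlat P (t.subst s) := by
  induction t with
  | var v => exact hs v
  | func f ts ih =>
    refine ⟨fun i => ih i (h.1 i), fun hf i => ?_⟩
    obtain ⟨v, hv, hPv⟩ := h.2 hf i
    exact ⟨v, by simp [hv, Term.subst, hP v hPv], hPv⟩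

/-! ## Formulas -/

namespace Fml

/-- `TmFlat` for formulas; moreover, no bound variable has the property `P`. -/
def Flat (P : Variable → Prop) : Fml L Sk → Prop
  | rel _ ts => ∀ i, TmFlat P (ts i)
  | neg A => A.Flat P
  | or A B => A.Flat P ∧ B.Flat P
  | and A B => A.Flat P ∧ B.Flat P
  | quant _ x A => A.Flat P ∧ ¬ P (Sum.inl x)

theorem mem_freeVars_rel {k : ℕ} {R : L.Relations k} {ts : Fin k → Tm L Sk} {v : Variable} :
    v ∈ (rel R ts).freeVars ↔ ∃ i, v ∈ (ts i).varFinset := by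
  simp [freeVars]

theorem Original.flat (P : Variable → Prop) {A : Fml L Sk} (h : A.Original)
    (hP : ∀ x ∈ A.binders, ¬ P (Sum.inl x)) : A.Flat P := by
  induction A with
  | rel R ts => exact fun i => (h i).flat P
  | neg A ih => exact ih h hP
  | or A B ihA ihB =>
    exact ⟨ihA h.1 fun x hx => hP x (by simp [binders, hx]),
      ihB h.2 fun x hx => hP x (by simp [binders, hx])⟩
  | and A B ihA ihB =>
    exact ⟨ihA h.1 fun x hx => hP x (by simp [binders, hx]),
      ihB h.2 fun x hx => hP x (by simp [binders, hx])⟩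
  | quant q x A ih =>
    exact ⟨ih h fun y hy => hP y (by simp [binders, hy]), hP x (by simp [binders])⟩

theorem Original.inr_notMem {A : Fml L Sk} (h : A.Original) (x : ℕ) :
    Sum.inr x ∉ A.freeVars := by
  induction A with
  | rel R ts => rw [mem_freeVars_rel]; rintro ⟨i, hi⟩; exact (h i).inr_notMem x hi
  | neg A ih => exact ih h
  | or A B ihA ihB => simp [freeVars, ihA h.1, ihB h.2]
  | and A B ihA ihB => simp [freeVars, ihA h.1, ihB h.2]
  | quant q y A ih => simp [freeVars, ih h]

theorem Original.skSym_notMem {A : Fml L Sk} (h : A.Original) (s : Σ m, Sk m) :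
    skSym L s ∉ A.syms := by
  induction A with
  | rel R ts =>
    simp only [syms, Set.mem_iUnion, not_exists]; exact fun i => (h i).skSym_notMem s
  | neg A ih => exact ih h
  | or A B ihA ihB => simp [syms, ihA h.1, ihB h.2]
  | and A B ihA ihB => simp [syms, ihA h.1, ihB h.2]
  | quant q y A ih => exact ih h

theorem binders_subst (A : Fml L Sk) : ∀ s, (A.subst s).binders = A.binders := by
  induction A with
  | rel R ts => exact fun s => rfl
  | neg A ih => exact fun s => ih s
  | or A B ihA ihB => exact fun s => by simp [subst, binders, ihA, ihB]
  | and A B ihA ihB => exact fun s => by simp [subst, binders, ihA, ihB]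
  | quant q y A ih => exact fun s => by simp [subst, binders, ih]

theorem binders_replace (A : Fml L Sk) (x : ℕ) (t : Tm L Sk) :
    (A.replace x t).binders = A.binders := binders_subst A _

theorem exists_of_mem_freeVars_subst (A : Fml L Sk) : ∀ {s : Variable → Tm L Sk} {v : Variable},
    v ∈ (A.subst s).freeVars → ∃ w ∈ A.freeVars, v ∈ (s w).varFinset := by
  induction A with
  | rel R ts =>
    intro s v h
    obtain ⟨i, hi⟩ := mem_freeVars_rel.1 h
    obtain ⟨w, hw, hv⟩ := mem_varFinset_subst.1 hi
    exact ⟨w, mem_freeVars_rel.2 ⟨i, hw⟩, hv⟩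
  | neg A ih => exact fun h => ih h
  | or A B ihA ihB =>
    intro s v h
    simp only [subst, freeVars, Finset.mem_union] at h ⊢
    rcases h with h | h
    · obtain ⟨w, hw, hv⟩ := ihA h; exact ⟨w, .inl hw, hv⟩
    · obtain ⟨w, hw, hv⟩ := ihB h; exact ⟨w, .inr hw, hv⟩
  | and A B ihA ihB =>
    intro s v h
    simp only [subst, freeVars, Finset.mem_union] at h ⊢
    rcases h with h | h
    · obtain ⟨w, hw, hv⟩ := ihA h; exact ⟨w, .inl hw, hv⟩
    · obtain ⟨w, hw, hv⟩ := ihB h; exact ⟨w, .inr hw, hv⟩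
  | quant q x A ih =>
    intro s v h
    simp only [subst, freeVars, Finset.mem_erase] at h ⊢
    obtain ⟨w, hw, hv⟩ := ih h.2
    by_cases hwx : w = Sum.inl x
    · subst hwx
      simp only [Function.update_self, mem_varFinset_var] at hv
      exact absurd hv h.1
    · rw [Function.update_of_ne hwx] at hv
      exact ⟨w, ⟨hwx, hw⟩, hv⟩

/-- An occurrence can disappear only by capture. There is none if the variable is replaced by
itself, or if the inserted variable is bound nowhere in the formula. -/
theorem mem_freeVars_subst_of_mem (A : Fml L Sk) : ∀ {s : Variable → Tm L Sk} {v w : Variable},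
    w ∈ A.freeVars → v ∈ (s w).varFinset → (s w = .var w ∨ ∀ x ∈ A.binders, v ≠ Sum.inl x) →
      v ∈ (A.subst s).freeVars := by
  induction A with
  | rel R ts =>
    intro s v w hw hv _
    obtain ⟨i, hi⟩ := mem_freeVars_rel.1 hw
    exact mem_freeVars_rel.2 ⟨i, mem_varFinset_subst.2 ⟨w, hi, hv⟩⟩
  | neg A ih => exact fun h => ih h
  | or A B ihA ihB =>
    intro s v w hw hv hb
    simp only [subst, freeVars, Finset.mem_union, binders, List.mem_append] at hw hb ⊢
    rcases hw with hw | hw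
    · exact .inl (ihA hw hv (hb.imp_right fun h x hx => h x (.inl hx)))
    · exact .inr (ihB hw hv (hb.imp_right fun h x hx => h x (.inr hx)))
  | and A B ihA ihB =>
    intro s v w hw hv hb
    simp only [subst, freeVars, Finset.mem_union, binders, List.mem_append] at hw hb ⊢
    rcases hw with hw | hw
    · exact .inl (ihA hw hv (hb.imp_right fun h x hx => h x (.inl hx)))
    · exact .inr (ihB hw hv (hb.imp_right fun h x hx => h x (.inr hx)))
  | quant q x A ih =>
    intro s v w hw hv hb
    simp only [subst, freeVars, Finset.mem_erase, binders, List.mem_cons] at hw hb ⊢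
    refine ⟨?_, ih hw.2 (by rwa [Function.update_of_ne hw.1]) ?_⟩
    · rcases hb with hb | hb
      · rw [hb, mem_varFinset_var] at hv
        exact hv ▸ hw.1
      · exact hb x (.inl rfl)
    · rw [Function.update_of_ne hw.1]
      exact hb.imp_right fun h y hy => h y (.inr hy)

theorem mem_syms_of_mem_subst (A : Fml L Sk) : ∀ {s : Variable → Tm L Sk} {c : Σ m, FunSym L Sk m},
    c ∈ (A.subst s).syms → c ∈ A.syms ∨ ∃ w ∈ A.freeVars, c ∈ tmSyms (s w) := by
  induction A with
  | rel R ts =>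
    intro s c h
    simp only [subst, syms, Set.mem_iUnion, mem_tmSyms_subst] at h ⊢
    obtain ⟨i, hi | ⟨w, hw, hc⟩⟩ := h
    · exact .inl ⟨i, hi⟩
    · exact .inr ⟨w, mem_freeVars_rel.2 ⟨i, hw⟩, hc⟩
  | neg A ih => exact fun h => ih h
  | or A B ihA ihB =>
    intro s c h
    simp only [subst, syms, freeVars, Finset.mem_union, Set.mem_union] at h ⊢
    rcases h with h | h
    · rcases ihA h with h | ⟨w, hw, hc⟩
      · exact .inl (.inl h)
      · exact .inr ⟨w, .inl hw, hc⟩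
    · rcases ihB h with h | ⟨w, hw, hc⟩
      · exact .inl (.inr h)
      · exact .inr ⟨w, .inr hw, hc⟩
  | and A B ihA ihB =>
    intro s c h
    simp only [subst, syms, freeVars, Finset.mem_union, Set.mem_union] at h ⊢
    rcases h with h | h
    · rcases ihA h with h | ⟨w, hw, hc⟩
      · exact .inl (.inl h)
      · exact .inr ⟨w, .inl hw, hc⟩
    · rcases ihB h with h | ⟨w, hw, hc⟩
      · exact .inl (.inr h)
      · exact .inr ⟨w, .inr hw, hc⟩
  | quant q x A ih =>
    intro s c h
    simp only [subst, syms, freeVars, Finset.mem_erase] at h ⊢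
    rcases ih h with h | ⟨w, hw, hc⟩
    · exact .inl h
    · by_cases hwx : w = Sum.inl x
      · subst hwx; simp [tmSyms] at hc
      · rw [Function.update_of_ne hwx] at hc
        exact .inr ⟨w, ⟨hwx, hw⟩, hc⟩

theorem syms_subset_subst (A : Fml L Sk) : ∀ s : Variable → Tm L Sk,
    A.syms ⊆ (A.subst s).syms := by
  induction A with
  | rel R ts =>
    intro s c h
    simp only [subst, syms, Set.mem_iUnion, mem_tmSyms_subst] at h ⊢
    exact h.imp fun i hi => .inl hi
  | neg A ih => exact ih
  | or A B ihA ihB => exact fun s => Set.union_subset_union (ihA s) (ihB s)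
  | and A B ihA ihB => exact fun s => Set.union_subset_union (ihA s) (ihB s)
  | quant q x A ih => exact fun s => ih _

theorem tmSyms_subset_syms_subst (A : Fml L Sk) : ∀ {s : Variable → Tm L Sk} {w : Variable},
    w ∈ A.freeVars → tmSyms (s w) ⊆ (A.subst s).syms := by
  induction A with
  | rel R ts =>
    intro s w hw c h
    obtain ⟨i, hi⟩ := mem_freeVars_rel.1 hw
    simp only [subst, syms, Set.mem_iUnion, mem_tmSyms_subst]
    exact ⟨i, .inr ⟨w, hi, h⟩⟩
  | neg A ih => exact fun h => ih h
  | or A B ihA ihB =>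
    intro s w hw
    simp only [subst, syms, freeVars, Finset.mem_union] at hw ⊢
    rcases hw with hw | hw
    · exact (ihA hw).trans Set.subset_union_left
    · exact (ihB hw).trans Set.subset_union_right
  | and A B ihA ihB =>
    intro s w hw
    simp only [subst, syms, freeVars, Finset.mem_union] at hw ⊢
    rcases hw with hw | hw
    · exact (ihA hw).trans Set.subset_union_left
    · exact (ihB hw).trans Set.subset_union_right
  | quant q x A ih =>
    intro s w hw
    simp only [subst, syms, freeVars, Finset.mem_erase] at hw ⊢
    have := ih (s := Function.update s (Sum.inl x) (.var (Sum.inl x))) hw.2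
    rwa [Function.update_of_ne hw.1] at this

theorem NoVacuous.subst {A : Fml L Sk} (h : A.NoVacuous) : ∀ s : Variable → Tm L Sk,
    (A.subst s).NoVacuous := by
  induction A with
  | rel R ts => exact fun s => trivial
  | neg A ih => exact fun s => ih h s
  | or A B ihA ihB => exact fun s => ⟨ihA h.1 s, ihB h.2 s⟩
  | and A B ihA ihB => exact fun s => ⟨ihA h.1 s, ihB h.2 s⟩
  | quant q x A ih =>
    exact fun s => ⟨mem_freeVars_subst_of_mem A h.1 (by simp)
      (.inl (by simp)), ih h.2 _⟩

theorem qf_subst {A : Fml L Sk} : ∀ {s : Variable → Tm L Sk}, (A.subst s).QF ↔ A.QF := by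
  induction A with
  | rel R ts => exact Iff.rfl
  | neg A ih => exact ih
  | or A B ihA ihB => exact and_congr ihA ihB
  | and A B ihA ihB => exact and_congr ihA ihB
  | quant q x A ih => exact Iff.rfl

theorem subst_congr {A : Fml L Sk} : ∀ {s s' : Variable → Tm L Sk},
    (∀ v ∈ A.freeVars, s v = s' v) → A.subst s = A.subst s' := by
  induction A with
  | rel R ts =>
    intro s s' h
    simp only [subst, rel.injEq, heq_eq_eq, true_and]
    funext i
    exact tmSubst_congr fun v hv => h v (mem_freeVars_rel.2 ⟨i, hv⟩)
  | neg A ih => intro s s' h; simp only [subst, ih h]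
  | or A B ihA ihB =>
    intro s s' h
    simp only [subst, freeVars, Finset.mem_union] at h ⊢
    rw [ihA fun v hv => h v (.inl hv), ihB fun v hv => h v (.inr hv)]
  | and A B ihA ihB =>
    intro s s' h
    simp only [subst, freeVars, Finset.mem_union] at h ⊢
    rw [ihA fun v hv => h v (.inl hv), ihB fun v hv => h v (.inr hv)]
  | quant q x A ih =>
    intro s s' h
    simp only [subst, freeVars, Finset.mem_erase] at h ⊢
    rw [ih fun v hv => ?_]
    by_cases hvx : v = Sum.inl x
    · simp [hvx]
    · simp [Function.update_of_ne hvx, h v ⟨hvx, hv⟩]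

theorem QF.subst_subst {A : Fml L Sk} (hA : A.QF) (s s' : Variable → Tm L Sk) :
    (A.subst s).subst s' = A.subst fun v => (s v).subst s' := by
  induction A with
  | rel R ts => simp only [subst, tmSubst_subst]
  | neg A ih => simp only [subst, ih hA]
  | or A B ihA ihB => simp only [subst, ihA hA.1, ihB hA.2]
  | and A B ihA ihB => simp only [subst, ihA hA.1, ihB hA.2]
  | quant q x A ih => exact hA.elim

theorem Flat.subst {P : Variable → Prop} {A : Fml L Sk} (h : A.Flat P) :
    ∀ {s : Variable → Tm L Sk}, (∀ v, TmFlat P (s v)) → (∀ v, P v → s v = .var v) →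
    (A.subst s).Flat P := by
  induction A with
  | rel R ts => exact fun hs hP i => (h i).subst hs hP
  | neg A ih => exact fun hs hP => ih h hs hP
  | or A B ihA ihB => exact fun hs hP => ⟨ihA h.1 hs hP, ihB h.2 hs hP⟩
  | and A B ihA ihB => exact fun hs hP => ⟨ihA h.1 hs hP, ihB h.2 hs hP⟩
  | quant q x A ih =>
    intro s hs hP
    refine ⟨ih h.1 (fun v => ?_) fun v hv => ?_, h.2⟩
    · by_cases hvx : v = Sum.inl x
      · subst hvx; simp [TmFlat]
      · rw [Function.update_of_ne hvx]; exact hs v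
    · by_cases hvx : v = Sum.inl x
      · subst hvx; exact absurd hv h.2
      · rw [Function.update_of_ne hvx]; exact hP v hv

theorem Flat.mono {P Q : Variable → Prop} {A : Fml L Sk} (h : A.Flat P)
    (hPQ : ∀ v ∈ A.freeVars, P v → Q v) (hb : ∀ x ∈ A.binders, ¬ Q (Sum.inl x)) : A.Flat Q := by
  induction A with
  | rel R ts => exact fun i => (h i).mono fun v hv => hPQ v (mem_freeVars_rel.2 ⟨i, hv⟩)
  | neg A ih => exact ih h hPQ hb
  | or A B ihA ihB =>
    exact ⟨ihA h.1 (fun v hv => hPQ v (by simp [freeVars, hv]))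
        fun x hx => hb x (by simp [binders, hx]),
      ihB h.2 (fun v hv => hPQ v (by simp [freeVars, hv]))
        fun x hx => hb x (by simp [binders, hx])⟩
  | and A B ihA ihB =>
    exact ⟨ihA h.1 (fun v hv => hPQ v (by simp [freeVars, hv]))
        fun x hx => hb x (by simp [binders, hx]),
      ihB h.2 (fun v hv => hPQ v (by simp [freeVars, hv]))
        fun x hx => hb x (by simp [binders, hx])⟩
  | quant q x A ih =>
    refine ⟨ih h.1 (fun v hv hP => hPQ v ?_ hP) fun y hy => hb y (by simp [binders, hy]),
      hb x (by simp [binders])⟩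
    simp only [freeVars, Finset.mem_erase]
    exact ⟨fun hx => h.2 (hx ▸ hP), hv⟩

theorem eval_bigOr (val : ∀ k : ℕ, L.Relations k → (Fin k → Tm L Sk) → Prop) (l : List (Fml L Sk)) :
    ∀ A, (bigOr A l).eval val ↔ ∃ B ∈ A :: l, B.eval val := by
  induction l with
  | nil => simp [bigOr]
  | cons B l ih => intro A; rw [bigOr, eval, ih]; simp

theorem eval_bigAnd (val : ∀ k : ℕ, L.Relations k → (Fin k → Tm L Sk) → Prop) (l : List (Fml L Sk)) :
    ∀ A, (bigAnd A l).eval val ↔ ∀ B ∈ A :: l, B.eval val := by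
  induction l with
  | nil => simp [bigAnd]
  | cons B l ih => intro A; rw [bigAnd, eval, ih]; simp

theorem bigOr_subst (s : Variable → Tm L Sk) (l : List (Fml L Sk)) :
    ∀ A, (bigOr A l).subst s = bigOr (A.subst s) (l.map (subst · s)) := by
  induction l with
  | nil => simp [bigOr]
  | cons B l ih => intro A; simp [bigOr, subst, ih]

theorem bigAnd_subst (s : Variable → Tm L Sk) (l : List (Fml L Sk)) :
    ∀ A, (bigAnd A l).subst s = bigAnd (A.subst s) (l.map (subst · s)) := by
  induction l with
  | nil => simp [bigAnd]
  | cons B l ih => intro A; simp [bigAnd, subst, ih]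

theorem qf_bigOr (l : List (Fml L Sk)) : ∀ A, (bigOr A l).QF ↔ ∀ B ∈ A :: l, B.QF := by
  induction l with
  | nil => simp [bigOr]
  | cons B l ih => intro A; rw [bigOr, QF, ih]; simp

theorem qf_bigAnd (l : List (Fml L Sk)) : ∀ A, (bigAnd A l).QF ↔ ∀ B ∈ A :: l, B.QF := by
  induction l with
  | nil => simp [bigAnd]
  | cons B l ih => intro A; rw [bigAnd, QF, ih]; simp

theorem subst_var (A : Fml L Sk) : A.subst Term.var = A := by
  induction A with
  | rel R ts => simp [subst, tmSubst_var]
  | neg A ih => simp [subst, ih]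
  | or A B ihA ihB => simp [subst, ihA, ihB]
  | and A B ihA ihB => simp [subst, ihA, ihB]
  | quant q x A ih => simp [subst, ih]

/-- Composition of substitutions, provided that the first one does not cause captures. -/
theorem subst_subst (A : Fml L Sk) : ∀ (s s' : Variable → Tm L Sk),
    (∀ v ∈ A.freeVars, s v = .var v ∨ ∀ x ∈ A.binders, Sum.inl x ∉ (s v).varFinset) →
    (A.subst s).subst s' = A.subst fun v => (s v).subst s' := by
  induction A with
  | rel R ts => intro s s' _; simp only [subst, tmSubst_subst]
  | neg A ih => intro s s' h; simp only [subst, ih s s' h]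
  | or A B ihA ihB =>
    intro s s' h
    simp only [freeVars, Finset.mem_union, binders, List.mem_append] at h
    simp only [subst,
      ihA s s' fun v hv => (h v (.inl hv)).imp_right fun h x hx => h x (.inl hx),
      ihB s s' fun v hv => (h v (.inr hv)).imp_right fun h x hx => h x (.inr hx)]
  | and A B ihA ihB =>
    intro s s' h
    simp only [freeVars, Finset.mem_union, binders, List.mem_append] at h
    simp only [subst,
      ihA s s' fun v hv => (h v (.inl hv)).imp_right fun h x hx => h x (.inl hx),
      ihB s s' fun v hv => (h v (.inr hv)).imp_right fun h x hx => h x (.inr hx)]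
  | quant q x A ih =>
    intro s s' h
    simp only [freeVars, Finset.mem_erase, binders, List.mem_cons] at h
    simp only [subst]
    rw [ih _ _ fun v hv => ?_]
    · congr 1
      refine subst_congr fun v hv => ?_
      by_cases hvx : v = Sum.inl x
      · subst hvx; simp [Term.subst]
      · rw [Function.update_of_ne hvx, Function.update_of_ne hvx]
        refine tmSubst_congr fun w hw => Function.update_of_ne ?_ _ _
        rintro rfl
        rcases h v ⟨hvx, hv⟩ with h | h
        · rw [h, mem_varFinset_var] at hw; exact hvx hw.symm
        · exact h x (.inl rfl) hw
    · by_cases hvx : v = Sum.inl x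
      · subst hvx; simp
      · rw [Function.update_of_ne hvx]
        exact (h v ⟨hvx, hv⟩).imp_right fun h y hy => h y (.inr hy)

end Fml

/-- The expansion is quantifier-free. -/
theorem IsExpansion.qf {T : Set (Tm L Sk)} {A B : Fml L Sk} (h : IsExpansion T A B) : B.QF := by
  induction h with
  | rel R ts => trivial
  | neg h ih => exact ih
  | or h₁ h₂ ih₁ ih₂ => exact ⟨ih₁, ih₂⟩
  | and h₁ h₂ ih₁ ih₂ => exact ⟨ih₁, ih₂⟩
  | ex x h t l hnd hT ih =>
    rw [Fml.qf_bigOr]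
    simp only [List.mem_cons, List.mem_map]
    rintro C (rfl | ⟨t, -, rfl⟩) <;> exact Fml.qf_subst.2 ih
  | all x h t l hnd hT ih =>
    rw [Fml.qf_bigAnd]
    simp only [List.mem_cons, List.mem_map]
    rintro C (rfl | ⟨t, -, rfl⟩) <;> exact Fml.qf_subst.2 ih


/-! ## Renaming -/

theorem TmRen.mono {r r' : Variable → Variable → Prop} {t u : Tm L Sk} (h : TmRen r t u)
    (hr : ∀ a b, r a b → r' a b) : TmRen r' t u := by
  induction h with
  | var h => exact .var (hr _ _ h)
  | func f h ih => exact .func f ih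

theorem bindRel_mono {r r' : Variable → Variable → Prop} (hr : ∀ a b, r a b → r' a b) (x y : ℕ)
    (a b : Variable) (h : bindRel r x y a b) : bindRel r' x y a b :=
  h.imp_right fun h => ⟨h.1, h.2.1, hr _ _ h.2.2⟩

theorem Ren.mono {r : Variable → Variable → Prop} {A B : Fml L Sk} (h : Ren r A B) :
    ∀ {r' : Variable → Variable → Prop}, (∀ a b, r a b → r' a b) → Ren r' A B := by
  induction h with
  | rel R h => exact fun hr => .rel R fun i => (h i).mono hr
  | neg h ih => exact fun hr => .neg (ih hr)
  | or hA hB ihA ihB => exact fun hr => .or (ihA hr) (ihB hr)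
  | and hA hB ihA ihB => exact fun hr => .and (ihA hr) (ihB hr)
  | quant q x y h ih => exact fun hr => .quant q x y (ih (bindRel_mono hr x y))

theorem TmRen.symm {r : Variable → Variable → Prop} {t u : Tm L Sk} (h : TmRen r t u) :
    TmRen (fun a b => r b a) u t := by
  induction h with
  | var h => exact .var h
  | func f h ih => exact .func f ih

theorem Ren.symm {r : Variable → Variable → Prop} {A B : Fml L Sk} (h : Ren r A B) :
    Ren (fun a b => r b a) B A := by
  induction h with
  | rel R h => exact .rel R fun i => (h i).symm
  | neg h ih => exact .neg ih
  | or hA hB ihA ihB => exact .or ihA ihB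
  | and hA hB ihA ihB => exact .and ihA ihB
  | quant q x y h ih =>
    refine .quant q y x (ih.mono ?_)
    rintro a b (h | h)
    · exact .inl h.symm
    · exact .inr ⟨h.2.1, h.1, h.2.2⟩

theorem TmRen.trans {r s : Variable → Variable → Prop} {t u : Tm L Sk} (h : TmRen r t u) :
    ∀ {v : Tm L Sk}, TmRen s u v → TmRen (fun a c => ∃ b, r a b ∧ s b c) t v := by
  induction h with
  | var h => intro v hv; cases hv with | var h' => exact .var ⟨_, h, h'⟩
  | func f h ih => intro v hv; cases hv with | func _ h' => exact .func f fun i => ih i (h' i)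

theorem Ren.trans {r : Variable → Variable → Prop} {A B : Fml L Sk} (h : Ren r A B) :
    ∀ {s : Variable → Variable → Prop} {C : Fml L Sk}, Ren s B C →
      Ren (fun a c => ∃ b, r a b ∧ s b c) A C := by
  induction h with
  | rel R h =>
    intro s C hC; cases hC with | rel _ h' => exact .rel R fun i => (h i).trans (h' i)
  | neg h ih => intro s C hC; cases hC with | neg h' => exact .neg (ih h')
  | or hA hB ihA ihB => intro s C hC; cases hC with | or h' h'' => exact .or (ihA h') (ihB h'')
  | and hA hB ihA ihB => intro s C hC; cases hC with | and h' h'' => exact .and (ihA h') (ihB h'')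
  | quant q x y h ih =>
    intro s C hC
    cases hC with
    | quant _ _ z h' =>
      refine .quant q x z ((ih h').mono ?_)
      rintro a c ⟨b, hab, hbc⟩
      rcases hab with ⟨rfl, rfl⟩ | ⟨ha, hb, hab⟩
      · rcases hbc with ⟨-, rfl⟩ | ⟨hb, -⟩
        · exact .inl ⟨rfl, rfl⟩
        · exact absurd rfl hb
      · rcases hbc with ⟨rfl, rfl⟩ | ⟨-, hc, hbc⟩
        · exact absurd rfl hb
        · exact .inr ⟨ha, hc, b, hab, hbc⟩

theorem Variant.symm {A B : Fml L Sk} (h : Variant A B) : Variant B A :=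
  Ren.mono (Ren.symm h) fun _ _ => Eq.symm

theorem Variant.trans {A B C : Fml L Sk} (h : Variant A B) (h' : Variant B C) : Variant A C :=
  Ren.mono (Ren.trans h h') fun _ _ ⟨_, h, h'⟩ => h.trans h'

theorem TmRen.tmSyms_eq {r : Variable → Variable → Prop} {t u : Tm L Sk} (h : TmRen r t u) :
    tmSyms t = tmSyms u := by
  induction h with
  | var h => rfl
  | func f h ih => simp only [tmSyms, ih]

theorem Ren.syms_eq {r : Variable → Variable → Prop} {A B : Fml L Sk} (h : Ren r A B) :
    A.syms = B.syms := by
  induction h with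
  | rel R h => simp only [Fml.syms, fun i => (h i).tmSyms_eq]
  | neg h ih => exact ih
  | or hA hB ihA ihB => simp only [Fml.syms, ihA, ihB]
  | and hA hB ihA ihB => simp only [Fml.syms, ihA, ihB]
  | quant q x y h ih => exact ih

theorem TmRen.exists_of_mem {r : Variable → Variable → Prop} {t u : Tm L Sk} (h : TmRen r t u) :
    ∀ a ∈ t.varFinset, ∃ b ∈ u.varFinset, r a b := by
  induction h with
  | @var a b h =>
    intro c hc
    rw [mem_varFinset_var] at hc
    exact ⟨b, mem_varFinset_var.2 rfl, hc ▸ h⟩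
  | func f h ih =>
    intro a ha
    obtain ⟨i, hi⟩ := mem_varFinset_func.1 ha
    obtain ⟨b, hb, hr⟩ := ih i a hi
    exact ⟨b, mem_varFinset_func.2 ⟨i, hb⟩, hr⟩

theorem Ren.exists_of_mem {r : Variable → Variable → Prop} {A B : Fml L Sk} (h : Ren r A B) :
    ∀ a ∈ A.freeVars, ∃ b ∈ B.freeVars, r a b := by
  induction h with
  | rel R h =>
    intro a ha
    obtain ⟨i, hi⟩ := Fml.mem_freeVars_rel.1 ha
    obtain ⟨b, hb, hr⟩ := (h i).exists_of_mem a hi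
    exact ⟨b, Fml.mem_freeVars_rel.2 ⟨i, hb⟩, hr⟩
  | neg h ih => exact ih
  | or hA hB ihA ihB =>
    intro a ha
    simp only [Fml.freeVars, Finset.mem_union] at ha ⊢
    rcases ha with ha | ha
    · obtain ⟨b, hb, hr⟩ := ihA a ha; exact ⟨b, .inl hb, hr⟩
    · obtain ⟨b, hb, hr⟩ := ihB a ha; exact ⟨b, .inr hb, hr⟩
  | and hA hB ihA ihB =>
    intro a ha
    simp only [Fml.freeVars, Finset.mem_union] at ha ⊢
    rcases ha with ha | ha
    · obtain ⟨b, hb, hr⟩ := ihA a ha; exact ⟨b, .inl hb, hr⟩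
    · obtain ⟨b, hb, hr⟩ := ihB a ha; exact ⟨b, .inr hb, hr⟩
  | quant q x y h ih =>
    intro a ha
    simp only [Fml.freeVars, Finset.mem_erase] at ha ⊢
    obtain ⟨b, hb, hr⟩ := ih a ha.2
    rcases hr with hr | hr
    · exact absurd hr.1 ha.1
    · exact ⟨b, ⟨hr.2.1, hb⟩, hr.2.2⟩

theorem Variant.mem_freeVars {A B : Fml L Sk} (h : Variant A B) {v : Variable} :
    v ∈ A.freeVars ↔ v ∈ B.freeVars := by
  constructor
  · intro hv; obtain ⟨_, hb, rfl⟩ := Ren.exists_of_mem h v hv; exact hb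
  · intro hv; obtain ⟨_, hb, rfl⟩ := Ren.exists_of_mem h.symm v hv; exact hb

theorem Ren.noVacuous {r : Variable → Variable → Prop} {A B : Fml L Sk} (h : Ren r A B) :
    A.NoVacuous → B.NoVacuous := by
  induction h with
  | rel R h => exact id
  | neg h ih => exact ih
  | or hA hB ihA ihB => exact And.imp ihA ihB
  | and hA hB ihA ihB => exact And.imp ihA ihB
  | quant q x y h ih =>
    refine And.imp (fun hx => ?_) ih
    obtain ⟨b, hb, hr⟩ := Ren.exists_of_mem h _ hx
    rcases hr with hr | hr
    · exact hr.2 ▸ hb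
    · exact absurd rfl hr.1

theorem TmRen.eq_var {r : Variable → Variable → Prop} {v : Variable} {u : Tm L Sk}
    (h : TmRen r (.var v) u) : ∃ b, u = .var b ∧ r v b := by
  cases h with | var h => exact ⟨_, rfl, h⟩

theorem TmRen.flat {r : Variable → Variable → Prop} {t u : Tm L Sk} (h : TmRen r t u)
    {P Q : Variable → Prop} (hPQ : ∀ a b, r a b → P a → Q b) (ht : TmFlat P t) : TmFlat Q u := by
  induction h with
  | var h => trivial
  | func f h ih =>
    refine ⟨fun i => ih i (ht.1 i), fun hf i => ?_⟩
    obtain ⟨v, hv, hP⟩ := ht.2 hf i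
    obtain ⟨b, hb, hr⟩ := TmRen.eq_var (hv ▸ h i)
    exact ⟨b, hb, hPQ _ _ hr hP⟩

theorem Ren.flat {r : Variable → Variable → Prop} {A B : Fml L Sk} (h : Ren r A B) :
    ∀ {P Q : Variable → Prop}, (∀ a b, r a b → P a → Q b) → (∀ y ∈ B.binders, ¬ Q (Sum.inl y)) →
      A.Flat P → B.Flat Q := by
  induction h with
  | rel R h => exact fun hPQ _ hA i => (h i).flat hPQ (hA i)
  | neg h ih => exact fun hPQ hQ hA => ih hPQ hQ hA
  | or _ _ ihA ihB =>
    exact fun hPQ hQ hA => ⟨ihA hPQ (fun y hy => hQ y (by simp [Fml.binders, hy])) hA.1,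
      ihB hPQ (fun y hy => hQ y (by simp [Fml.binders, hy])) hA.2⟩
  | and _ _ ihA ihB =>
    exact fun hPQ hQ hA => ⟨ihA hPQ (fun y hy => hQ y (by simp [Fml.binders, hy])) hA.1,
      ihB hPQ (fun y hy => hQ y (by simp [Fml.binders, hy])) hA.2⟩
  | quant q x y h ih =>
    refine fun hPQ hQ hA => ⟨ih (fun a b hr hP => ?_)
      (fun y hy => hQ y (by simp [Fml.binders, hy])) hA.1, hQ y (by simp [Fml.binders])⟩
    rcases hr with ⟨rfl, -⟩ | hr
    · exact absurd hP hA.2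
    · exact hPQ _ _ hr.2.2 hP

/-! ## Polarities -/

/-- There is no γ-quantifier in a subformula at a position of polarity `p`. -/
def NoGamma : Bool → Fml L Sk → Prop
  | _, .rel _ _ => True
  | p, .neg A => NoGamma (!p) A
  | p, .or A B => NoGamma p A ∧ NoGamma p B
  | p, .and A B => NoGamma p A ∧ NoGamma p B
  | p, .quant q _ A => q ≠ gammaQ p ∧ NoGamma p A

theorem gammaQ_ne_deltaQ (p : Bool) : gammaQ p ≠ deltaQ p := by
  cases p <;> simp [gammaQ, deltaQ]

theorem eq_gammaQ_or_deltaQ (p : Bool) (q : Quantifier) : q = gammaQ p ∨ q = deltaQ p := by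
  cases p <;> cases q <;> simp [gammaQ, deltaQ]

theorem noGamma_subst (A : Fml L Sk) : ∀ (p : Bool) (s : Variable → Tm L Sk),
    NoGamma p (A.subst s) ↔ NoGamma p A := by
  induction A with
  | rel R ts => exact fun _ _ => Iff.rfl
  | neg A ih => exact fun p s => ih _ s
  | or A B ihA ihB => exact fun p s => and_congr (ihA p s) (ihB p s)
  | and A B ihA ihB => exact fun p s => and_congr (ihA p s) (ihB p s)
  | quant q x A ih => exact fun p s => and_congr Iff.rfl (ih p _)

theorem Ren.noGamma {r : Variable → Variable → Prop} {A B : Fml L Sk} (h : Ren r A B) :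
    ∀ p, NoGamma p A ↔ NoGamma p B := by
  induction h with
  | rel R h => exact fun _ => Iff.rfl
  | neg h ih => exact fun p => ih _
  | or hA hB ihA ihB => exact fun p => and_congr (ihA p) (ihB p)
  | and hA hB ihA ihB => exact fun p => and_congr (ihA p) (ihB p)
  | quant q x y h ih => exact fun p => and_congr Iff.rfl (ih p)

theorem Fml.QF.noGamma {A : Fml L Sk} : ∀ p, A.QF → NoGamma p A := by
  induction A with
  | rel R ts => exact fun _ _ => trivial
  | neg A ih => exact fun p => ih _
  | or A B ihA ihB => exact fun p => And.imp (ihA p) (ihB p)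
  | and A B ihA ihB => exact fun p => And.imp (ihA p) (ihB p)
  | quant q x A ih => exact fun p h => h.elim

/-! ## Skolem terms -/

/-- The symbol that `δ` assigns, together with its arity. -/
def DeltaFn.sym (δ : DeltaFn L Sk) (C : Fml L Sk) (ys : List Variable) : Σ m, Sk m :=
  ⟨ys.length, δ C ys⟩

theorem mem_varFinset_deltaTerm {δ : DeltaFn L Sk} {B : Fml L Sk} {xs : List Variable}
    {v : Variable} : v ∈ (deltaTerm δ B xs).varFinset ↔ v ∈ xs := by
  refine mem_varFinset_func.trans ?_
  simp only [mem_varFinset_var, List.mem_iff_get]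
  exact exists_congr fun i => eq_comm

theorem tmSyms_deltaTerm (δ : DeltaFn L Sk) (B : Fml L Sk) (xs : List Variable) :
    tmSyms (deltaTerm δ B xs) = {skSym L (δ.sym B xs)} := by
  simp [deltaTerm, tmSyms, skSym, DeltaFn.sym]

theorem tmFlat_deltaTerm {δ : DeltaFn L Sk} {B : Fml L Sk} {xs : List Variable}
    {P : Variable → Prop} (h : ∀ x ∈ xs, P x) : TmFlat P (deltaTerm δ B xs) :=
  ⟨fun _ => trivial, fun _ i => ⟨xs.get i, rfl, h _ (List.get_mem xs i)⟩⟩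

/-- The arguments of the Skolem term in a Skolemized form. -/
def skArgs (xs : List ℕ) (H : Fml L Sk) : List Variable :=
  (xs.map Sum.inl).filter (· ∈ H.freeVars)

theorem mem_skArgs {xs : List ℕ} {H : Fml L Sk} {v : Variable} :
    v ∈ skArgs xs H ↔ (∃ x ∈ xs, v = Sum.inl x) ∧ v ∈ H.freeVars := by
  simp [skArgs, eq_comm]

theorem skolemize_gamma (δ : DeltaFn L Sk) (p : Bool) (xs : List ℕ) (x : ℕ) (H : Fml L Sk) :
    skolemize δ p xs (.quant (gammaQ p) x H) =
      .quant (gammaQ p) x (skolemize δ p (xs ++ [x]) H) := by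
  cases p <;> simp [gammaQ, skolemize]

theorem skolemize_delta (δ : DeltaFn L Sk) (p : Bool) (xs : List ℕ) (y : ℕ) (H : Fml L Sk) :
    skolemize δ p xs (.quant (deltaQ p) y H) =
      skolemize δ p xs
        (H.replace y (deltaTerm δ (.quant (deltaQ p) y H) (skArgs xs H))) := by
  cases p <;> simp only [gammaQ, deltaQ, Bool.not_true, Bool.not_false] <;>
    rw [skolemize] <;> rfl

/-- Induction along the recursion of `skolemize`. -/
theorem skolemize_induction (δ : DeltaFn L Sk) {motive : Bool → List ℕ → Fml L Sk → Prop}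
    (rel : ∀ p xs k (R : L.Relations k) ts, motive p xs (.rel R ts))
    (neg : ∀ p xs A, motive (!p) xs A → motive p xs (.neg A))
    (or : ∀ p xs A B, motive p xs A → motive p xs B → motive p xs (.or A B))
    (and : ∀ p xs A B, motive p xs A → motive p xs B → motive p xs (.and A B))
    (gamma : ∀ p xs x H, motive p (xs ++ [x]) H → motive p xs (.quant (gammaQ p) x H))
    (delta : ∀ p xs y H,
      motive p xs (H.replace y (deltaTerm δ (.quant (deltaQ p) y H) (skArgs xs H))) →
        motive p xs (.quant (deltaQ p) y H)) (p : Bool) (xs : List ℕ) (G : Fml L Sk) :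
    motive p xs G := by
  induction hn : G.size using Nat.strong_induction_on generalizing p xs G with
  | _ n ih =>
    subst hn
    cases G with
    | rel R ts => exact rel _ _ _ _ _
    | neg A => exact neg _ _ _ (ih _ (by simp [Fml.size]) _ _ A rfl)
    | or A B =>
      exact or _ _ _ _ (ih _ (by rw [Fml.size]; omega) _ _ A rfl)
        (ih _ (by rw [Fml.size]; omega) _ _ B rfl)
    | and A B =>
      exact and _ _ _ _ (ih _ (by rw [Fml.size]; omega) _ _ A rfl)
        (ih _ (by rw [Fml.size]; omega) _ _ B rfl)
    | quant q x A =>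
      rcases eq_gammaQ_or_deltaQ p q with rfl | rfl
      · exact gamma _ _ _ _ (ih _ (by simp [Fml.size]) _ _ A rfl)
      · exact delta _ _ _ _ (ih _ (by simp [Fml.size, Fml.size_replace]) _ _ _ rfl)

theorem Fml.mem_freeVars_replace_of_ne {A : Fml L Sk} {y : ℕ} {t : Tm L Sk} {v : Variable}
    (h : v ∈ A.freeVars) (hv : v ≠ Sum.inl y) : v ∈ (A.replace y t).freeVars := by
  have : Function.update (Term.var : Variable → Tm L Sk) (Sum.inl y) t v = .var v := by
    rw [Function.update_of_ne hv]
  exact mem_freeVars_subst_of_mem A h (by rw [this, mem_varFinset_var]) (.inl this)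

theorem Fml.of_mem_freeVars_replace {A : Fml L Sk} {y : ℕ} {t : Tm L Sk} {v : Variable}
    (h : v ∈ (A.replace y t).freeVars) :
    (v ∈ A.freeVars ∧ v ≠ Sum.inl y) ∨ (v ∈ t.varFinset ∧ Sum.inl y ∈ A.freeVars) := by
  obtain ⟨w, hw, hv⟩ := exists_of_mem_freeVars_subst A h
  by_cases hwy : w = Sum.inl y
  · subst hwy; rw [Function.update_self] at hv; exact .inr ⟨hv, hw⟩
  · rw [Function.update_of_ne hwy, mem_varFinset_var] at hv
    subst hv; exact .inl ⟨hw, hwy⟩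

theorem Fml.of_mem_syms_replace {A : Fml L Sk} {y : ℕ} {t : Tm L Sk} {c : Σ m, FunSym L Sk m}
    (h : c ∈ (A.replace y t).syms) : c ∈ A.syms ∨ c ∈ tmSyms t := by
  rcases mem_syms_of_mem_subst A h with h | ⟨w, hw, hc⟩
  · exact .inl h
  · by_cases hwy : w = Sum.inl y
    · subst hwy; rw [Function.update_self] at hc; exact .inr hc
    · simp [Function.update_of_ne hwy, tmSyms] at hc

theorem syms_subset_skolemize (δ : DeltaFn L Sk) (p : Bool) (xs : List ℕ) (G : Fml L Sk) :
    G.syms ⊆ (skolemize δ p xs G).syms := by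
  induction p, xs, G using skolemize_induction δ with
  | rel p xs k R ts => rw [skolemize]
  | neg p xs A ih => rw [skolemize]; exact ih
  | or p xs A B ihA ihB => rw [skolemize]; exact Set.union_subset_union ihA ihB
  | and p xs A B ihA ihB => rw [skolemize]; exact Set.union_subset_union ihA ihB
  | gamma p xs x H ih => rw [skolemize_gamma]; exact ih
  | delta p xs y H ih => rw [skolemize_delta]; exact (H.syms_subset_subst _).trans ih

theorem freeVars_subset_skolemize (δ : DeltaFn L Sk) (p : Bool) (xs : List ℕ) (G : Fml L Sk) :
    G.freeVars ⊆ (skolemize δ p xs G).freeVars := by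
  induction p, xs, G using skolemize_induction δ with
  | rel p xs k R ts => rw [skolemize]
  | neg p xs A ih => rw [skolemize]; exact ih
  | or p xs A B ihA ihB => rw [skolemize]; exact Finset.union_subset_union ihA ihB
  | and p xs A B ihA ihB => rw [skolemize]; exact Finset.union_subset_union ihA ihB
  | gamma p xs x H ih => rw [skolemize_gamma]; exact Finset.erase_subset_erase _ ih
  | delta p xs y H ih =>
    rw [skolemize_delta]
    refine subset_trans (fun v hv => ?_) ih
    simp only [Fml.freeVars, Finset.mem_erase] at hv
    exact Fml.mem_freeVars_replace_of_ne hv.2 hv.1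

/-! ### Invariants of Skolemization -/

/-- The properties that the recursion of `skolemize` preserves. -/
structure Stage (xs : List ℕ) (G : Fml L Sk) : Prop where
  noVacuous : G.NoVacuous
  nodup : G.binders.Nodup
  notFree : ∀ x ∈ G.binders, Sum.inl x ∉ G.freeVars
  notMem : ∀ x ∈ G.binders, x ∉ xs
  flat : G.Flat fun v => ∃ x ∈ xs, v = Sum.inl x
  noGammaVar : ∀ x, Sum.inr x ∉ G.freeVars

namespace Stage

variable {xs : List ℕ}

theorem of_rectified {A : Fml L Sk} (hA : A.Original) (hr : A.Rectified) : Stage [] A where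
  noVacuous := hr.1
  nodup := hr.2.1
  notFree := hr.2.2
  notMem := by simp
  flat := hA.flat _ (by simp)
  noGammaVar := hA.inr_notMem

theorem neg {A : Fml L Sk} (h : Stage xs (.neg A)) : Stage xs A := ⟨h.1, h.2, h.3, h.4, h.5, h.6⟩

theorem or_left {A B : Fml L Sk} (h : Stage xs (.or A B)) : Stage xs A where
  noVacuous := h.1.1
  nodup := h.2.of_append_left
  notFree x hx hf := h.3 x (by simp [Fml.binders, hx]) (by simp [Fml.freeVars, hf])
  notMem x hx := h.4 x (by simp [Fml.binders, hx])
  flat := h.5.1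
  noGammaVar x hx := h.6 x (by simp [Fml.freeVars, hx])

theorem or_right {A B : Fml L Sk} (h : Stage xs (.or A B)) : Stage xs B where
  noVacuous := h.1.2
  nodup := h.2.of_append_right
  notFree x hx hf := h.3 x (by simp [Fml.binders, hx]) (by simp [Fml.freeVars, hf])
  notMem x hx := h.4 x (by simp [Fml.binders, hx])
  flat := h.5.2
  noGammaVar x hx := h.6 x (by simp [Fml.freeVars, hx])

theorem and_left {A B : Fml L Sk} (h : Stage xs (.and A B)) : Stage xs A :=
  or_left (B := B) ⟨h.1, h.2, h.3, h.4, h.5, h.6⟩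

theorem and_right {A B : Fml L Sk} (h : Stage xs (.and A B)) : Stage xs B :=
  or_right (A := A) ⟨h.1, h.2, h.3, h.4, h.5, h.6⟩

theorem gamma {q : Quantifier} {x : ℕ} {H : Fml L Sk} (h : Stage xs (.quant q x H)) :
    Stage (xs ++ [x]) H := by
  have hx : ∀ z ∈ H.binders, z ≠ x := fun z hz hzx => (List.nodup_cons.1 h.2).1 (hzx ▸ hz)
  have hm : ∀ z ∈ H.binders, z ∉ xs ++ [x] := fun z hz hz' => by
    rcases List.mem_append.1 hz' with hz' | hz'
    · exact h.4 z (by simp [Fml.binders, hz]) hz'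
    · exact hx z hz (by simpa using hz')
  exact
    { noVacuous := h.1.2
      nodup := (List.nodup_cons.1 h.2).2
      notFree := fun z hz hf => h.3 z (by simp [Fml.binders, hz]) (by
        simp only [Fml.freeVars, Finset.mem_erase]
        exact ⟨fun h' => hx z hz (Sum.inl.inj h'), hf⟩)
      notMem := hm
      flat := h.5.1.mono (fun v _ ⟨z, hz, hv⟩ => ⟨z, by simp [hz], hv⟩) (by
        rintro z hz ⟨z', hz', h'⟩
        cases h'
        exact hm z hz hz')
      noGammaVar := fun z hz => h.6 z (by simp [Fml.freeVars, hz]) }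

/-- The arguments of the Skolem term come from `xs`, and no quantifier of the formula binds a
variable in `xs`. So nothing is captured, and rectification and flatness persist. -/
theorem delta {q : Quantifier} {y : ℕ} {H : Fml L Sk} (h : Stage xs (.quant q y H))
    (δ : DeltaFn L Sk) (B : Fml L Sk) : Stage xs (H.replace y (deltaTerm δ B (skArgs xs H))) where
  noVacuous := h.1.2.subst _
  nodup := by rw [Fml.binders_replace]; exact (List.nodup_cons.1 h.2).2
  notFree z hz hf := by
    rw [Fml.binders_replace] at hz
    rcases Fml.of_mem_freeVars_replace hf with hf | ⟨hf, -⟩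
    · exact h.3 z (by simp [Fml.binders, hz]) (by simp [Fml.freeVars, hf.1, hf.2])
    · rw [mem_varFinset_deltaTerm, mem_skArgs] at hf
      obtain ⟨⟨z', hz', h'⟩, -⟩ := hf
      cases h'
      exact h.4 z (by simp [Fml.binders, hz]) hz'
  notMem z hz := by
    rw [Fml.binders_replace] at hz
    exact h.4 z (by simp [Fml.binders, hz])
  flat := by
    refine h.5.1.subst (fun v => ?_) fun v hv => ?_
    · by_cases hv : v = Sum.inl y
      · subst hv
        rw [Function.update_self]
        exact tmFlat_deltaTerm fun x hx => (mem_skArgs.1 hx).1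
      · rw [Function.update_of_ne hv]; trivial
    · rw [Function.update_of_ne]
      rintro rfl
      exact h.5.2 hv
  noGammaVar z hf := by
    rcases Fml.of_mem_freeVars_replace hf with hf | ⟨hf, -⟩
    · exact h.6 z (by simp [Fml.freeVars, hf.1])
    · rw [mem_varFinset_deltaTerm, mem_skArgs] at hf
      obtain ⟨⟨z', hz', h'⟩, -⟩ := hf
      cases h'

end Stage

theorem skolemize_freeVars_subset (δ : DeltaFn L Sk) (p : Bool) (xs : List ℕ) (G : Fml L Sk)
    (hG : Stage xs G) : (skolemize δ p xs G).freeVars ⊆ G.freeVars := by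
  induction p, xs, G using skolemize_induction δ with
  | rel p xs k R ts => rw [skolemize]
  | neg p xs A ih => rw [skolemize]; exact ih hG.neg
  | or p xs A B ihA ihB =>
    rw [skolemize]; exact Finset.union_subset_union (ihA hG.or_left) (ihB hG.or_right)
  | and p xs A B ihA ihB =>
    rw [skolemize]; exact Finset.union_subset_union (ihA hG.and_left) (ihB hG.and_right)
  | gamma p xs x H ih => rw [skolemize_gamma]; exact Finset.erase_subset_erase _ (ih hG.gamma)
  | delta p xs y H ih =>
    rw [skolemize_delta]
    refine (ih (hG.delta δ _)).trans fun v hv => ?_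
    simp only [Fml.freeVars, Finset.mem_erase]
    rcases Fml.of_mem_freeVars_replace hv with hv | ⟨hv, -⟩
    · exact ⟨hv.2, hv.1⟩
    · rw [mem_varFinset_deltaTerm, mem_skArgs] at hv
      obtain ⟨⟨z, hz, rfl⟩, hv⟩ := hv
      refine ⟨fun h => hG.4 y (by simp [Fml.binders]) ?_, hv⟩
      cases h; exact hz

/-- The symbol is really inserted because the quantifier is not vacuous, and later stages never
remove a symbol. This makes the Skolem terms of the Skolemized form eligible as `candidates`. -/
theorem sym_mem_skolemize {δ : DeltaFn L Sk} {p : Bool} {xs : List ℕ} {y : ℕ} {H : Fml L Sk}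
    (hy : Sum.inl y ∈ H.freeVars) :
    skSym L (δ.sym (.quant (deltaQ p) y H) (skArgs xs H)) ∈
      (skolemize δ p xs (.quant (deltaQ p) y H)).syms := by
  rw [skolemize_delta]
  refine syms_subset_skolemize _ _ _ _ (Fml.tmSyms_subset_syms_subst H hy ?_)
  rw [Function.update_self, tmSyms_deltaTerm]
  rfl

/-- Together with the next lemma this settles an empty champ fini: there the expansion exists only
if no γ-quantifier occurs. -/
theorem NoGamma.qf_skolemize (δ : DeltaFn L Sk) (p : Bool) (xs : List ℕ) (G : Fml L Sk)
    (hG : NoGamma p G) : (skolemize δ p xs G).QF := by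
  induction p, xs, G using skolemize_induction δ with
  | rel p xs k R ts => rw [skolemize]; trivial
  | neg p xs A ih => rw [skolemize]; exact ih hG
  | or p xs A B ihA ihB => rw [skolemize]; exact ⟨ihA hG.1, ihB hG.2⟩
  | and p xs A B ihA ihB => rw [skolemize]; exact ⟨ihA hG.1, ihB hG.2⟩
  | gamma p xs x H ih => exact absurd rfl hG.1
  | delta p xs y H ih => rw [skolemize_delta]; exact ih ((noGamma_subst H p _).2 hG.2)

theorem noGamma_of_isExpansion (δ : DeltaFn L Sk) {T : Set (Tm L Sk)} (hT : ¬ T.Nonempty)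
    (p : Bool) (xs : List ℕ) (G : Fml L Sk) :
    ∀ {E}, IsExpansion T (skolemize δ p xs G) E → NoGamma p G := by
  induction p, xs, G using skolemize_induction δ with
  | rel p xs k R ts => exact fun _ => trivial
  | neg p xs A ih =>
    intro E hE; rw [skolemize] at hE; cases hE with | neg h => exact ih h
  | or p xs A B ihA ihB =>
    intro E hE; rw [skolemize] at hE; cases hE with | or h h' => exact ⟨ihA h, ihB h'⟩
  | and p xs A B ihA ihB =>
    intro E hE; rw [skolemize] at hE; cases hE with | and h h' => exact ⟨ihA h, ihB h'⟩
  | gamma p xs x H ih =>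
    intro E hE
    rw [skolemize_gamma] at hE
    generalize gammaQ p = q at hE
    cases hE with
    | ex _ h t l hnd ht => exact absurd ⟨t, (ht t).1 (by simp)⟩ hT
    | all _ h t l hnd ht => exact absurd ⟨t, (ht t).1 (by simp)⟩ hT
  | delta p xs y H ih =>
    intro E hE
    rw [skolemize_delta] at hE
    exact ⟨(gammaQ_ne_deltaQ p).symm, (noGamma_subst H p _).1 (ih hE)⟩

/-! ## Interpretations of the Skolem symbols -/

/-- Interpretations of the Skolem symbols by functions on terms. -/
abbrev Interp (L : FirstOrder.Language.{u, v}) (Sk : ℕ → Type w) :=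
  (Σ m, Sk m) → List (Tm L Sk) → Tm L Sk

/-- A list of arguments of `δ`, each of which contains only Skolem symbols that come from arguments
further down in the list. -/
def Layered (δ : DeltaFn L Sk) (V : Fml L Sk → List Variable → Prop) :
    List (Fml L Sk × List Variable) → Prop
  | [] => True
  | e :: l => (V e.1 e.2 ∧ e.2.Nodup ∧ ∀ y ∈ e.2, y ∈ e.1.freeVars) ∧
      (∀ s, skSym L s ∈ e.1.syms → ∃ e' ∈ l, s = δ.sym e'.1 e'.2) ∧ Layered δ V l

theorem Layered.valid {δ : DeltaFn L Sk} {V : Fml L Sk → List Variable → Prop}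
    {l : List (Fml L Sk × List Variable)} (h : Layered δ V l) :
    ∀ e ∈ l, V e.1 e.2 ∧ e.2.Nodup ∧ ∀ y ∈ e.2, y ∈ e.1.freeVars := by
  induction l with
  | nil => simp
  | cons e l ih =>
    intro e' he'
    rcases List.mem_cons.1 he' with rfl | he'
    · exact h.1
    · exact ih h.2.2 e' he'

theorem Layered.closed {δ : DeltaFn L Sk} {V : Fml L Sk → List Variable → Prop}
    {l : List (Fml L Sk × List Variable)} (h : Layered δ V l) :
    ∀ e ∈ l, ∀ s, skSym L s ∈ e.1.syms → ∃ e' ∈ l, s = δ.sym e'.1 e'.2 := by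
  induction l with
  | nil => simp
  | cons e l ih =>
    intro e' he' s hs
    rcases List.mem_cons.1 he' with rfl | he'
    · obtain ⟨e'', h1, h2⟩ := h.2.1 s hs; exact ⟨e'', .tail _ h1, h2⟩
    · obtain ⟨e'', h1, h2⟩ := ih h.2.2 e' he' s hs; exact ⟨e'', .tail _ h1, h2⟩

/-- The recursion equations `I (C, ys)^δ = Φ I C ys` have a solution on every layered list, provided
that `Φ` respects the renamings that `δ` may identify. -/
theorem exists_interp {δ : DeltaFn L Sk} (hδ : δ.Admissible)
    {V : Fml L Sk → List Variable → Prop}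
    (Φ : Interp L Sk → Fml L Sk → List Variable → List (Tm L Sk) → Tm L Sk)
    (Pb : (Σ m, Sk m) → (List (Tm L Sk) → Tm L Sk) → Prop) (φ₀ : List (Tm L Sk) → Tm L Sk)
    (h₀ : ∀ s, Pb s φ₀)
    (hPb : ∀ (I : Interp L Sk) C ys, (∀ s, Pb s (I s)) → V C ys → ys.Nodup →
      (∀ y ∈ ys, y ∈ C.freeVars) → Pb (δ.sym C ys) (Φ I C ys))
    (hloc : ∀ (I I' : Interp L Sk) C ys, (∀ s, skSym L s ∈ C.syms → I s = I' s) →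
      Φ I C ys = Φ I' C ys)
    (hvar : ∀ (I : Interp L Sk) C ys C' ys', (∀ s, Pb s (I s)) → V C ys → V C' ys' →
      ys.Nodup → ys'.Nodup → ys.length = ys'.length →
      Ren (listRel ys ys') C C' → ∀ ts, ts.length = ys.length → Φ I C ys ts = Φ I C' ys' ts)
    (l : List (Fml L Sk × List Variable)) (hl : Layered δ V l) :
    ∃ I : Interp L Sk, (∀ s, Pb s (I s)) ∧
      ∀ e ∈ l, ∀ ts : List (Tm L Sk), ts.length = e.2.length →
        I (δ.sym e.1 e.2) ts = Φ I e.1 e.2 ts := by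
  classical
  induction l with
  | nil => exact ⟨fun _ => φ₀, h₀, by simp⟩
  | cons e l ih =>
    obtain ⟨I, hI, hIl⟩ := ih hl.2.2
    -- If the symbol already belongs to an entry of the tail, the old interpretation is kept: by
    -- admissibility the two entries are equal or differ by a renaming, to which `Φ` is insensitive.
    by_cases hs : ∃ e' ∈ l, δ.sym e.1 e.2 = δ.sym e'.1 e'.2
    · refine ⟨I, hI, fun e'' he'' ts hts => ?_⟩
      rcases List.mem_cons.1 he'' with rfl | he''
      · obtain ⟨e', he', hs⟩ := hs
        obtain ⟨hV, hn, hf⟩ := hl.1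
        obtain ⟨hV', hn', hf'⟩ := hl.2.2.valid e' he'
        have hlen : e'.2.length = e''.2.length := (congrArg Sigma.fst hs).symm
        rw [hs, hIl e' he' ts (hts.trans hlen.symm)]
        rcases hδ e'.1 e''.1 e'.2 e''.2 hn' hf' hn hf hs.symm with ⟨h1, h2⟩ | h
        · rw [h1, h2]
        · exact hvar I _ _ _ _ hI hV' hV hn' hn hlen h ts (hts.trans hlen.symm)
      · exact hIl e'' he'' ts hts
    -- Otherwise the symbol is new. Every formula in the list contains only symbols of entries in
    -- `l`, so redefining the interpretation at the new symbol leaves all right-hand sides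
    -- unchanged.
    · have hne : ∀ s, (∃ e' ∈ l, s = δ.sym e'.1 e'.2) → s ≠ δ.sym e.1 e.2 := by
        rintro s ⟨e', he', rfl⟩ h
        exact hs ⟨e', he', h.symm⟩
      set I' : Interp L Sk := Function.update I (δ.sym e.1 e.2) (Φ I e.1 e.2) with hI'
      refine ⟨I', fun s => ?_, fun e' he' ts hts => ?_⟩
      · by_cases hse : s = δ.sym e.1 e.2
        · subst hse
          rw [hI', Function.update_self]
          exact hPb I _ _ hI hl.1.1 hl.1.2.1 hl.1.2.2
        · rw [hI', Function.update_of_ne hse]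
          exact hI s
      · rcases List.mem_cons.1 he' with rfl | he'
        · rw [hloc I' I e'.1 e'.2 fun s hs' => by
            rw [hI', Function.update_of_ne (hne s (hl.2.1 s hs'))]]
          rw [hI', Function.update_self]
        · rw [hloc I' I e'.1 e'.2 fun s hs' => by
            rw [hI', Function.update_of_ne (hne s (hl.2.2.closed e' he' s hs'))]]
          rw [hI', Function.update_of_ne (hne _ ⟨e', he', rfl⟩)]
          exact hIl e' he' ts hts


/-! ## Semantic values of formulas -/

/-- The values of variables: free ordinary variables stand for themselves, γ-variables take terms as
values, and variables of δ-quantifiers take Skolem terms as values. -/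
inductive Leaf (L : FirstOrder.Language.{u, v}) (Sk : ℕ → Type w)
  | ord (x : ℕ) : Leaf L Sk
  | val (t : Tm L Sk) : Leaf L Sk
  | sk (t : Tm L Sk) : Leaf L Sk

/-- Values of formulas, with quantifiers in higher-order abstract syntax. -/
inductive Key (L : FirstOrder.Language.{u, v}) (Sk : ℕ → Type w) : Type (max u v w)
  | rel {k : ℕ} (R : L.Relations k) (ts : Fin k → (extLang L Sk).Term (Leaf L Sk)) : Key L Sk
  | neg (K : Key L Sk) : Key L Sk
  | or (K K' : Key L Sk) : Key L Sk
  | and (K K' : Key L Sk) : Key L Sk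
  | quant (q : Quantifier) (f : Leaf L Sk → Key L Sk) : Key L Sk

section Values

variable (F : Fml L Sk) (c₀ : Tm L Sk)

/-- The term behind a leaf, with variables foreign to `F` replaced by `c₀`. -/
def Leaf.tm : Leaf L Sk → Tm L Sk
  | .ord x => if Sum.inl x ∈ F.freeVars then .var (Sum.inl x) else c₀
  | .val t => t
  | .sk t => t

open Classical in
/-- The term behind a value, with symbols foreign to `F` replaced by `c₀`. -/
noncomputable def flatten : (extLang L Sk).Term (Leaf L Sk) → Tm L Sk
  | .var ℓ => ℓ.tm F c₀
  | .func (l := m) f ts =>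
      if (⟨m, f⟩ : Σ m, FunSym L Sk m) ∈ F.syms then .func f fun i => flatten (ts i) else c₀

/-- The value of a term. -/
noncomputable def tmVal (I : Interp L Sk) (ρ : Variable → Leaf L Sk) :
    Tm L Sk → (extLang L Sk).Term (Leaf L Sk)
  | .var v => .var (ρ v)
  | .func f ts =>
      match FunSym.sk? f with
      -- A Skolem term becomes a single leaf, just like the variable of the δ-quantifier that it
      -- replaces.
      | some s => .var (.sk (I s (List.ofFn fun i => flatten F c₀ (tmVal I ρ (ts i)))))
      | none => .func f fun i => tmVal I ρ (ts i)

open Classical in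
/-- Disjunction or conjunction of values, collapsed if the values are equal. -/
noncomputable def Key.join (op : Key L Sk → Key L Sk → Key L Sk) (K K' : Key L Sk) : Key L Sk :=
  if K = K' then K else op K K'

/-- The value of a formula; repetitions produced by the rule of simplification are collapsed. -/
noncomputable def key (I : Interp L Sk) : (Variable → Leaf L Sk) → Fml L Sk → Key L Sk
  | ρ, .rel R ts => .rel R fun i => tmVal F c₀ I ρ (ts i)
  | ρ, .neg A => .neg (key I ρ A)
  | ρ, .or A B => .join .or (key I ρ A) (key I ρ B)
  | ρ, .and A B => .join .and (key I ρ A) (key I ρ B)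
  | ρ, .quant q x A => .quant q fun ℓ => key I (Function.update ρ (Sum.inl x) ℓ) A

variable {F c₀}

theorem tmVal_congr {I I' : Interp L Sk} {ρ ρ' : Variable → Leaf L Sk} {t : Tm L Sk}
    (hI : ∀ s, skSym L s ∈ tmSyms t → I s = I' s) (hρ : ∀ v ∈ t.varFinset, ρ v = ρ' v) :
    tmVal F c₀ I ρ t = tmVal F c₀ I' ρ' t := by
  induction t with
  | var v => simp only [tmVal, hρ v (mem_varFinset_var.2 rfl)]
  | @func m f ts ih =>
    have ih' : ∀ i, tmVal F c₀ I ρ (ts i) = tmVal F c₀ I' ρ' (ts i) := fun i =>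
      ih i (fun s hs => hI s (.inr (Set.mem_iUnion.2 ⟨i, hs⟩)))
        fun v hv => hρ v (mem_varFinset_func.2 ⟨i, hv⟩)
    simp only [tmVal, ih']
    cases hf : FunSym.sk? f with
    | none => rfl
    | some s => simp only [hI s (.inl (sk?_eq_some.1 hf).symm)]

theorem key_congr {I I' : Interp L Sk} {A : Fml L Sk} (hI : ∀ s, skSym L s ∈ A.syms → I s = I' s) :
    ∀ {ρ ρ' : Variable → Leaf L Sk}, (∀ v ∈ A.freeVars, ρ v = ρ' v) →
      key F c₀ I ρ A = key F c₀ I' ρ' A := by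
  induction A with
  | rel R ts =>
    intro ρ ρ' hρ
    simp only [key]
    congr 1
    funext i
    exact tmVal_congr (fun s hs => hI s (Set.mem_iUnion.2 ⟨i, hs⟩))
      fun v hv => hρ v (Fml.mem_freeVars_rel.2 ⟨i, hv⟩)
  | neg A ih => intro ρ ρ' hρ; simp only [key, ih hI hρ]
  | or A B ihA ihB =>
    intro ρ ρ' hρ
    simp only [Fml.freeVars, Finset.mem_union] at hρ
    simp only [key, ihA (fun s hs => hI s (.inl hs)) fun v hv => hρ v (.inl hv),
      ihB (fun s hs => hI s (.inr hs)) fun v hv => hρ v (.inr hv)]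
  | and A B ihA ihB =>
    intro ρ ρ' hρ
    simp only [Fml.freeVars, Finset.mem_union] at hρ
    simp only [key, ihA (fun s hs => hI s (.inl hs)) fun v hv => hρ v (.inl hv),
      ihB (fun s hs => hI s (.inr hs)) fun v hv => hρ v (.inr hv)]
  | quant q x A ih =>
    intro ρ ρ' hρ
    simp only [key]
    congr 1
    funext ℓ
    refine ih hI fun v hv => ?_
    by_cases hvx : v = Sum.inl x
    · subst hvx; simp
    · rw [Function.update_of_ne hvx, Function.update_of_ne hvx]
      exact hρ v (by simp [Fml.freeVars, hv, hvx])

theorem tmVal_ren {I : Interp L Sk} {r : Variable → Variable → Prop} {t u : Tm L Sk}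
    (h : TmRen r t u) {ρ ρ' : Variable → Leaf L Sk} (hρ : ∀ a b, r a b → ρ a = ρ' b) :
    tmVal F c₀ I ρ t = tmVal F c₀ I ρ' u := by
  induction h with
  | var h => simp only [tmVal, hρ _ _ h]
  | func f h ih => simp only [tmVal, ih]

/-- The names of bound variables have disappeared from values: corresponding quantifiers feed the
same leaf to both bodies. This is why values cannot distinguish formulas that `δ` may identify. -/
theorem key_ren {I : Interp L Sk} {r : Variable → Variable → Prop} {A B : Fml L Sk}
    (h : Ren r A B) : ∀ {ρ ρ' : Variable → Leaf L Sk}, (∀ a b, r a b → ρ a = ρ' b) →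
      key F c₀ I ρ A = key F c₀ I ρ' B := by
  induction h with
  | rel R h => intro ρ ρ' hρ; simp only [key, fun i => tmVal_ren (F := F) (c₀ := c₀) (I := I) (h i) hρ]
  | neg h ih => intro ρ ρ' hρ; simp only [key, ih hρ]
  | or hA hB ihA ihB => intro ρ ρ' hρ; simp only [key, ihA hρ, ihB hρ]
  | and hA hB ihA ihB => intro ρ ρ' hρ; simp only [key, ihA hρ, ihB hρ]
  | quant q x y h ih =>
    intro ρ ρ' hρ
    simp only [key]
    congr 1
    funext ℓ
    refine ih fun a b hab => ?_
    rcases hab with ⟨rfl, rfl⟩ | ⟨ha, hb, hab⟩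
    · simp
    · rw [Function.update_of_ne ha, Function.update_of_ne hb, hρ a b hab]

theorem tmVal_subst {I : Interp L Sk} {ρ ρ' : Variable → Leaf L Sk} {t : Tm L Sk}
    {s : Variable → Tm L Sk} (hs : ∀ v ∈ t.varFinset, tmVal F c₀ I ρ (s v) = .var (ρ' v)) :
    tmVal F c₀ I ρ (t.subst s) = tmVal F c₀ I ρ' t := by
  induction t with
  | var v => exact hs v (mem_varFinset_var.2 rfl)
  | func f ts ih =>
    simp only [Term.subst, tmVal, fun i => ih i fun v hv => hs v (mem_varFinset_func.2 ⟨i, hv⟩)]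

/-- Substitution lemma for substitutions whose terms evaluate to single leaves; the second
hypothesis excludes capture. γ-variables and Skolem terms are of this kind, so both quantifier rules
are covered. -/
theorem key_subst {I : Interp L Sk} {A : Fml L Sk} : ∀ {ρ ρ' : Variable → Leaf L Sk}
    {s : Variable → Tm L Sk}, (∀ v ∈ A.freeVars, tmVal F c₀ I ρ (s v) = .var (ρ' v)) →
    (∀ v ∈ A.freeVars, s v = .var v ∨ ∀ x ∈ A.binders, Sum.inl x ∉ (s v).varFinset) →
    key F c₀ I ρ (A.subst s) = key F c₀ I ρ' A := by
  induction A with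
  | rel R ts =>
    intro ρ ρ' s hs _
    simp only [Fml.subst, key]
    congr 1
    funext i
    exact tmVal_subst fun v hv => hs v (Fml.mem_freeVars_rel.2 ⟨i, hv⟩)
  | neg A ih => intro ρ ρ' s hs hb; simp only [Fml.subst, key, ih hs hb]
  | or A B ihA ihB =>
    intro ρ ρ' s hs hb
    simp only [Fml.freeVars, Finset.mem_union, Fml.binders, List.mem_append] at hs hb
    simp only [Fml.subst, key,
      ihA (fun v hv => hs v (.inl hv)) (fun v hv => (hb v (.inl hv)).imp_right fun h x hx => h x (.inl hx)),
      ihB (fun v hv => hs v (.inr hv)) (fun v hv => (hb v (.inr hv)).imp_right fun h x hx => h x (.inr hx))]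
  | and A B ihA ihB =>
    intro ρ ρ' s hs hb
    simp only [Fml.freeVars, Finset.mem_union, Fml.binders, List.mem_append] at hs hb
    simp only [Fml.subst, key,
      ihA (fun v hv => hs v (.inl hv)) (fun v hv => (hb v (.inl hv)).imp_right fun h x hx => h x (.inl hx)),
      ihB (fun v hv => hs v (.inr hv)) (fun v hv => (hb v (.inr hv)).imp_right fun h x hx => h x (.inr hx))]
  | quant q x A ih =>
    intro ρ ρ' s hs hb
    simp only [Fml.freeVars, Finset.mem_erase, Fml.binders, List.mem_cons] at hs hb
    simp only [Fml.subst, key]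
    congr 1
    funext ℓ
    refine ih (fun v hv => ?_) fun v hv => ?_
    · by_cases hvx : v = Sum.inl x
      · subst hvx; simp [tmVal]
      · rw [Function.update_of_ne hvx, Function.update_of_ne hvx, ← hs v ⟨hvx, hv⟩]
        refine tmVal_congr (fun _ _ => rfl) fun w hw => Function.update_of_ne ?_ _ _
        rintro rfl
        rcases hb v ⟨hvx, hv⟩ with h | h
        · rw [h, mem_varFinset_var] at hw; exact hvx hw.symm
        · exact h x (.inl rfl) hw
    · by_cases hvx : v = Sum.inl x
      · subst hvx; simp
      · rw [Function.update_of_ne hvx]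
        exact (hb v ⟨hvx, hv⟩).imp_right fun h y hy => h y (.inr hy)

theorem key_replace {I : Interp L Sk} {A : Fml L Sk} {ρ : Variable → Leaf L Sk} {y : ℕ}
    {t : Tm L Sk} {ℓ : Leaf L Sk} (ht : tmVal F c₀ I ρ t = .var ℓ)
    (hb : ∀ x ∈ A.binders, Sum.inl x ∉ t.varFinset) :
    key F c₀ I ρ (A.replace y t) = key F c₀ I (Function.update ρ (Sum.inl y) ℓ) A := by
  refine key_subst (fun v _ => ?_) fun v _ => ?_
  · by_cases hv : v = Sum.inl y
    · subst hv; simp [ht]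
    · rw [Function.update_of_ne hv, Function.update_of_ne hv]; rfl
  · by_cases hv : v = Sum.inl y
    · subst hv; rw [Function.update_self]; exact .inr hb
    · rw [Function.update_of_ne hv]; exact .inl rfl

/-- In contrast to `tmVal_subst`, the substituted terms may be compound, so their values need not be
leaves. Agreement after flattening suffices; it is needed for the substitution of a witness. -/
theorem flatten_tmVal_subst {I : Interp L Sk} {ρ ρ' : Variable → Leaf L Sk} {t : Tm L Sk}
    {s : Variable → Tm L Sk}
    (hs : ∀ v ∈ t.varFinset, flatten F c₀ (tmVal F c₀ I ρ (s v)) = (ρ' v).tm F c₀) :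
    flatten F c₀ (tmVal F c₀ I ρ (t.subst s)) = flatten F c₀ (tmVal F c₀ I ρ' t) := by
  induction t with
  | var v => exact hs v (mem_varFinset_var.2 rfl)
  | @func m f ts ih =>
    have ih' := fun i => ih i fun v hv => hs v (mem_varFinset_func.2 ⟨i, hv⟩)
    simp only [Term.subst, tmVal]
    cases hf : FunSym.sk? f with
    | none => simp only [flatten, ih']
    | some s => simp only [ih']

theorem tmVal_deltaTerm (δ : DeltaFn L Sk) (I : Interp L Sk) (ρ : Variable → Leaf L Sk)
    (B : Fml L Sk) (xs : List Variable) :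
    tmVal F c₀ I ρ (deltaTerm δ B xs) =
      .var (.sk (I (δ.sym B xs) (xs.map fun v => (ρ v).tm F c₀))) := by
  have : xs.map (fun v => (ρ v).tm F c₀) = List.ofFn fun i => (ρ (xs.get i)).tm F c₀ := by
    rw [← List.ofFn_get (xs.map _)]
    apply List.ext_get <;> simp
  rw [this]
  rfl

/-! ### Heights of values -/

/-- The height of a leaf; a Skolem term counts as much as the largest of its arguments. -/
def Leaf.ht : Leaf L Sk → ℕ
  | .ord _ => 0
  | .val t => height t
  | .sk t => height t - 1

/-- The maximal height of a leaf of a value. -/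
def valHt : (extLang L Sk).Term (Leaf L Sk) → ℕ
  | .var ℓ => ℓ.ht
  | .func _ ts => Finset.univ.sup fun i => valHt (ts i)

/-- The maximal height of a leaf of a value. -/
def Key.ht : Key L Sk → ℕ
  | .rel _ ts => Finset.univ.sup fun i => valHt (ts i)
  | .neg K => K.ht
  | .or K K' => max K.ht K'.ht
  | .and K K' => max K.ht K'.ht
  -- The bound variable must not contribute; a leaf of height zero achieves this.
  | .quant _ f => (f (.ord 0)).ht

/-- Collapsing equal values is harmless because the maximum is idempotent. -/
theorem key_or_ht (I : Interp L Sk) (ρ : Variable → Leaf L Sk) (A B : Fml L Sk) :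
    (key F c₀ I ρ (.or A B)).ht = max (key F c₀ I ρ A).ht (key F c₀ I ρ B).ht := by
  simp only [key, Key.join]
  split_ifs with h
  · rw [h, max_self]
  · rfl

theorem key_and_ht (I : Interp L Sk) (ρ : Variable → Leaf L Sk) (A B : Fml L Sk) :
    (key F c₀ I ρ (.and A B)).ht = max (key F c₀ I ρ A).ht (key F c₀ I ρ B).ht := by
  simp only [key, Key.join]
  split_ifs with h
  · rw [h, max_self]
  · rfl

/-- The interpretation of the Skolem symbols by themselves. -/
def herbrand (c₀ : Tm L Sk) : Interp L Sk := fun s ts =>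
  Term.func (L := extLang L Sk) (FunSym.skolem s.2) fun i : Fin s.1 => ts.getD i c₀

/-- By flatness, the variable occurs either as a leaf of its own or directly below a Skolem symbol.
In the second case the leaf is a Skolem term of height at least `height t + 1`, and `Leaf.ht` takes
one off. -/
theorem height_le_valHt {P : Variable → Prop} {ρ : Variable → Leaf L Sk} {t u : Tm L Sk}
    {y : Variable} (hu : TmFlat P u) (hy : y ∈ u.varFinset) (hρ : ρ y = .val t) :
    height t ≤ valHt (tmVal F c₀ (herbrand c₀) ρ u) := by
  induction u with
  | var v =>
    rw [mem_varFinset_var] at hy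
    subst hy
    simp [tmVal, hρ, valHt, Leaf.ht]
  | @func m f ts ih =>
    obtain ⟨i, hi⟩ := mem_varFinset_func.1 hy
    simp only [tmVal]
    cases hf : FunSym.sk? f with
    | none =>
      simp only [valHt]
      exact (ih i (hu.1 i) hi).trans (Finset.le_sup (f := fun i => valHt (tmVal F c₀ (herbrand c₀) ρ (ts i)))
        (Finset.mem_univ i))
    | some s =>
      obtain ⟨v, hv, -⟩ := hu.2 (by rw [hf]; rfl) i
      have hm : s.1 = m := (congrArg Sigma.fst (sk?_eq_some.1 hf)).symm
      subst hm
      rw [hv, mem_varFinset_var] at hi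
      subst hi
      simp only [valHt, Leaf.ht, herbrand, height, Nat.add_sub_cancel_left]
      refine le_trans (le_of_eq ?_) (Finset.le_sup (Finset.mem_univ i))
      simp [hv, tmVal, hρ, flatten, Leaf.tm]

theorem height_le_ht {P : Variable → Prop} {t : Tm L Sk} {y : Variable} {C : Fml L Sk}
    (hC : C.Flat P) : ∀ {ρ : Variable → Leaf L Sk}, y ∈ C.freeVars → ρ y = .val t →
    height t ≤ (key F c₀ (herbrand c₀) ρ C).ht := by
  induction C with
  | rel R ts =>
    intro ρ hy hρ
    obtain ⟨i, hi⟩ := Fml.mem_freeVars_rel.1 hy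
    exact (height_le_valHt (hC i) hi hρ).trans
      (Finset.le_sup (f := fun i => valHt (tmVal F c₀ (herbrand c₀) ρ (ts i)))
        (Finset.mem_univ i))
  | neg A ih => exact fun hy hρ => ih hC hy hρ
  | or A B ihA ihB =>
    intro ρ hy hρ
    rw [key_or_ht]
    simp only [Fml.freeVars, Finset.mem_union] at hy
    rcases hy with hy | hy
    · exact (ihA hC.1 hy hρ).trans (le_max_left _ _)
    · exact (ihB hC.2 hy hρ).trans (le_max_right _ _)
  | and A B ihA ihB =>
    intro ρ hy hρ
    rw [key_and_ht]
    simp only [Fml.freeVars, Finset.mem_union] at hy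
    rcases hy with hy | hy
    · exact (ihA hC.1 hy hρ).trans (le_max_left _ _)
    · exact (ihB hC.2 hy hρ).trans (le_max_right _ _)
  | quant q x A ih =>
    intro ρ hy hρ
    simp only [Fml.freeVars, Finset.mem_erase] at hy
    exact ih hC.1 hy.2 (by rwa [Function.update_of_ne hy.1])

/-- The opposite estimate: a Skolem leaf has arguments of height at most `N`, thus height at most `N
+ 1`, and counts as at most `N`. The γ-variables must have `.val` leaves, since for a `.sk` leaf
`Leaf.ht` would understate the height of an argument by one. -/
theorem valHt_le {I : Interp L Sk} {N : ℕ} {t : Tm L Sk}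
    (hI : ∀ s ts, ts.length = s.1 → (∀ t ∈ ts, height t ≤ N) → height (I s ts) ≤ N + 1)
    (ht : TmFlat (fun v => v.isRight) t) {ρ : Variable → Leaf L Sk}
    (hρ : ∀ v ∈ t.varFinset, (ρ v).ht ≤ N)
    (hγ : ∀ x, Sum.inr x ∈ t.varFinset → ∃ u, ρ (Sum.inr x) = .val u) :
    valHt (tmVal F c₀ I ρ t) ≤ N := by
  induction t with
  | var v => exact hρ v (mem_varFinset_var.2 rfl)
  | @func m f ts ih =>
    simp only [tmVal]
    cases hf : FunSym.sk? f with
    | none =>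
      simp only [valHt]
      exact Finset.sup_le fun i _ => ih i (ht.1 i)
        (fun v hv => hρ v (mem_varFinset_func.2 ⟨i, hv⟩))
        fun x hx => hγ x (mem_varFinset_func.2 ⟨i, hx⟩)
    | some s =>
      simp only [valHt, Leaf.ht]
      refine Nat.sub_le_of_le_add (hI s _ ?_ fun t h => ?_)
      · simp [show s.1 = m from (congrArg Sigma.fst (sk?_eq_some.1 hf)).symm]
      · obtain ⟨i, rfl⟩ := (List.mem_ofFn' _ _).1 h
        obtain ⟨v, hv, hr⟩ := ht.2 (by rw [hf]; rfl) i
        obtain ⟨x, rfl⟩ := Sum.isRight_iff.1 hr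
        have hx : Sum.inr x ∈ (Term.func f ts).varFinset :=
          mem_varFinset_func.2 ⟨i, by rw [hv]; exact mem_varFinset_var.2 rfl⟩
        obtain ⟨u, hu⟩ := hγ x hx
        have := hρ _ hx
        rw [hu] at this
        simpa [hv, tmVal, flatten, hu, Leaf.tm, Leaf.ht] using this

theorem ht_le {I : Interp L Sk} {N : ℕ} {C : Fml L Sk}
    (hI : ∀ s ts, ts.length = s.1 → (∀ t ∈ ts, height t ≤ N) → height (I s ts) ≤ N + 1)
    (hC : C.Flat fun v => v.isRight) : ∀ {ρ : Variable → Leaf L Sk},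
    (∀ v ∈ C.freeVars, (ρ v).ht ≤ N) →
    (∀ x, Sum.inr x ∈ C.freeVars → ∃ u, ρ (Sum.inr x) = .val u) →
    (key F c₀ I ρ C).ht ≤ N := by
  induction C with
  | rel R ts =>
    intro ρ hρ hγ
    exact Finset.sup_le fun i _ => valHt_le hI (hC i)
      (fun v hv => hρ v (Fml.mem_freeVars_rel.2 ⟨i, hv⟩))
      fun x hx => hγ x (Fml.mem_freeVars_rel.2 ⟨i, hx⟩)
  | neg A ih => exact fun hρ hγ => ih hC hρ hγ
  | or A B ihA ihB =>
    intro ρ hρ hγ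
    simp only [Fml.freeVars, Finset.mem_union] at hρ hγ
    rw [key_or_ht]
    exact max_le (ihA hC.1 (fun v hv => hρ v (.inl hv)) fun x hx => hγ x (.inl hx))
      (ihB hC.2 (fun v hv => hρ v (.inr hv)) fun x hx => hγ x (.inr hx))
  | and A B ihA ihB =>
    intro ρ hρ hγ
    simp only [Fml.freeVars, Finset.mem_union] at hρ hγ
    rw [key_and_ht]
    exact max_le (ihA hC.1 (fun v hv => hρ v (.inl hv)) fun x hx => hγ x (.inl hx))
      (ihB hC.2 (fun v hv => hρ v (.inr hv)) fun x hx => hγ x (.inr hx))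
  | quant q x A ih =>
    intro ρ hρ hγ
    simp only [Fml.freeVars, Finset.mem_erase] at hρ hγ
    refine ih hC.1 (fun v hv => ?_) fun z hz => ?_
    · by_cases hvx : v = Sum.inl x
      · subst hvx; simp [Leaf.ht]
      · rw [Function.update_of_ne hvx]; exact hρ v ⟨hvx, hv⟩
    · rw [Function.update_of_ne (by simp)]
      exact hγ z ⟨by simp, hz⟩

/-! ### Truth -/

variable (F c₀) in
/-- The Skolem terms over `F` that can belong to a value. -/
def candidates (δ : DeltaFn L Sk) (K : Key L Sk) : Set (Tm L Sk) :=
  {c | ∃ (C : Fml L Sk) (ys : List Variable) (ρ : Variable → Leaf L Sk) (ts : List (Tm L Sk)),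
    skSym L (δ.sym C ys) ∈ F.syms ∧ (∀ y ∈ ys, y ∈ C.freeVars) ∧ (∃ P, C.Flat P) ∧
    (∀ t ∈ ts, TermOver F t) ∧ ys.map ρ = ts.map .val ∧ K = key F c₀ (herbrand c₀) ρ C ∧
    c = herbrand c₀ (δ.sym C ys) ts}

open Classical in
variable (F c₀) in
/-- The range of a quantifier at a position of polarity `p`. -/
noncomputable def range (δ : DeltaFn L Sk) (T : Set (Tm L Sk)) (p : Bool) (q : Quantifier)
    (K : Key L Sk) : Set (Leaf L Sk) :=
  if q = gammaQ p then Leaf.val '' T else Leaf.sk '' candidates F c₀ δ K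

variable (F c₀) in
/-- The truth value at a position of polarity `p`. -/
def holds (δ : DeltaFn L Sk) (T : Set (Tm L Sk))
    (val : ∀ k : ℕ, L.Relations k → (Fin k → Tm L Sk) → Prop) : Bool → Key L Sk → Prop
  | _, .rel R ts => val _ R fun i => flatten F c₀ (ts i)
  | p, .neg K => ¬ holds δ T val (!p) K
  | p, .or K K' => holds δ T val p K ∨ holds δ T val p K'
  | p, .and K K' => holds δ T val p K ∧ holds δ T val p K'
  | p, .quant .ex f => ∃ ℓ ∈ range F c₀ δ T p .ex (.quant .ex f), holds δ T val p (f ℓ)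
  | p, .quant .all f => ∀ ℓ ∈ range F c₀ δ T p .all (.quant .all f), holds δ T val p (f ℓ)

/-- Implication, the other way round for negative polarity. -/
def PolImp : Bool → Prop → Prop → Prop
  | true, a, b => a → b
  | false, a, b => b → a

theorem PolImp.rfl {p : Bool} {a : Prop} : PolImp p a a := by cases p <;> exact id

theorem PolImp.not {p : Bool} {a b : Prop} (h : PolImp (!p) a b) : PolImp p (¬ a) (¬ b) := by
  cases p <;> exact fun h' h'' => h' (h h'')

theorem PolImp.or {p : Bool} {a b a' b' : Prop} (h : PolImp p a b) (h' : PolImp p a' b') :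
    PolImp p (a ∨ a') (b ∨ b') := by
  cases p <;> exact Or.imp h h'

theorem PolImp.and {p : Bool} {a b a' b' : Prop} (h : PolImp p a b) (h' : PolImp p a' b') :
    PolImp p (a ∧ a') (b ∧ b') := by
  cases p <;> exact And.imp h h'

variable {δ : DeltaFn L Sk} {T : Set (Tm L Sk)}
  {val : ∀ k : ℕ, L.Relations k → (Fin k → Tm L Sk) → Prop}

/-- Collapsing does not change truth, by idempotence of the connective. -/
theorem holds_key_or {p : Bool} {I : Interp L Sk} {ρ : Variable → Leaf L Sk} {A B : Fml L Sk} :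
    holds F c₀ δ T val p (key F c₀ I ρ (.or A B)) ↔
      holds F c₀ δ T val p (key F c₀ I ρ A) ∨ holds F c₀ δ T val p (key F c₀ I ρ B) := by
  simp only [key, Key.join]
  split_ifs with h
  · rw [h, or_self]
  · rfl

theorem holds_key_and {p : Bool} {I : Interp L Sk} {ρ : Variable → Leaf L Sk} {A B : Fml L Sk} :
    holds F c₀ δ T val p (key F c₀ I ρ (.and A B)) ↔
      holds F c₀ δ T val p (key F c₀ I ρ A) ∧ holds F c₀ δ T val p (key F c₀ I ρ B) := by
  simp only [key, Key.join]
  split_ifs with h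
  · rw [h, and_self]
  · rfl

variable (F c₀ δ T val) in
/-- `c` makes a value with an outermost δ-quantifier as false as possible at a positive position,
and as true as possible at a negative one. -/
def Critical : Key L Sk → Tm L Sk → Prop
  | .quant .all f, c => ¬ holds F c₀ δ T val true (f (.sk c))
  | .quant .ex f, c => holds F c₀ δ T val false (f (.sk c))
  | _, _ => False

open Classical in
variable (F c₀ δ T val) in
/-- A critical candidate, if there is one. -/
noncomputable def worst (K : Key L Sk) : Tm L Sk :=
  if h : ∃ c ∈ candidates F c₀ δ K, Critical F c₀ δ T val K c then h.choose
  else if h : ∃ c, c ∈ candidates F c₀ δ K then h.choose else c₀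

theorem worst_mem_or (K : Key L Sk) :
    worst F c₀ δ T val K ∈ candidates F c₀ δ K ∨ worst F c₀ δ T val K = c₀ := by
  unfold worst
  split_ifs with h h'
  · exact .inl h.choose_spec.1
  · exact .inl h'.choose_spec
  · exact .inr rfl

theorem critical_worst {K : Key L Sk}
    (h : ∃ c ∈ candidates F c₀ δ K, Critical F c₀ δ T val K c) :
    Critical F c₀ δ T val K (worst F c₀ δ T val K) := by
  unfold worst
  rw [dif_pos h]
  exact h.choose_spec.2

/-- If any candidate falsifies the body at a positive position, then the chosen one does; hence its
instance implies the quantified statement. At a negative position the same holds with truth and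
implication reversed. -/
theorem polImp_worst (p : Bool) (f : Leaf L Sk → Key L Sk) :
    PolImp p (holds F c₀ δ T val p (f (.sk (worst F c₀ δ T val (.quant (deltaQ p) f)))))
      (holds F c₀ δ T val p (.quant (deltaQ p) f)) := by
  cases p with
  | true =>
    intro h ℓ hℓ
    rw [range, if_neg (by simp [gammaQ])] at hℓ
    obtain ⟨c, hc, rfl⟩ := hℓ
    by_contra hn
    exact critical_worst (T := T) (val := val) (K := .quant .all f) ⟨c, hc, hn⟩ h
  | false =>
    rintro ⟨ℓ, hℓ, h⟩
    rw [range, if_neg (by simp [gammaQ])] at hℓ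
    obtain ⟨c, hc, rfl⟩ := hℓ
    exact critical_worst (T := T) (val := val) (K := .quant .ex f) ⟨c, hc, h⟩

theorem polImp_gamma (p : Bool) (f : Leaf L Sk → Key L Sk) {t : Tm L Sk} (ht : t ∈ T) :
    PolImp p (holds F c₀ δ T val p (f (.val t)))
      (holds F c₀ δ T val p (.quant (gammaQ p) f)) := by
  have : Leaf.val t ∈ range F c₀ δ T p (gammaQ p) (.quant (gammaQ p) f) := by
    rw [range, if_pos rfl]; exact ⟨t, ht, rfl⟩
  cases p with
  | true => exact fun h => ⟨_, this, h⟩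
  | false => exact fun h => h _ this

theorem termOver_herbrand {s : Σ m, Sk m} {ts : List (Tm L Sk)} (hc : TermOver F c₀)
    (hs : skSym L s ∈ F.syms) (hts : ∀ t ∈ ts, TermOver F t) : TermOver F (herbrand c₀ s ts) := by
  refine ⟨.inl hs, fun i => ?_⟩
  by_cases hi : (i : ℕ) < ts.length
  · simp [List.getD_eq_getElem?_getD, hi, hts _ (List.getElem_mem hi)]
  -- `herbrand` fills up argument lists that are too short with `c₀`, which is a term over `F` as
  -- well.
  · simp [List.getD_eq_getElem?_getD, hi, hc]

theorem termOver_worst (hc : TermOver F c₀) (K : Key L Sk) :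
    TermOver F (worst F c₀ δ T val K) := by
  rcases worst_mem_or (F := F) (c₀ := c₀) (δ := δ) (T := T) (val := val) K with h | h
  · obtain ⟨C, ys, ρ, ts, hs, -, -, hts, -, -, h⟩ := h
    rw [h]
    exact termOver_herbrand hc hs hts
  · rw [h]; exact hc

/-- A candidate may stem from another formula than the one at hand, but both have the value `K`. Its
arguments are values of variables that occur free in that formula, so their heights can be read off
from `K`. -/
theorem height_worst (hc : height c₀ = 1) (K : Key L Sk) :
    height (worst F c₀ δ T val K) ≤ K.ht + 1 := by
  rcases worst_mem_or (F := F) (c₀ := c₀) (δ := δ) (T := T) (val := val) K with h | h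
  · obtain ⟨C, ys, ρ, ts, -, hy, ⟨P, hP⟩, -, hρ, hK, h⟩ := h
    rw [h]
    simp only [herbrand, height]
    rw [add_comm]
    refine Nat.add_le_add_right (Finset.sup_le fun i _ => ?_) 1
    have hlen : ys.length = ts.length := by simpa using congrArg List.length hρ
    have hi : (i : ℕ) < ts.length := hlen ▸ i.2
    have hi' : (i : ℕ) < ys.length := i.2
    have : ρ (ys[(i : ℕ)]) = .val (ts[(i : ℕ)]) := by
      have := congrArg (fun l => l[(i : ℕ)]?) hρ
      simpa [hi, hi'] using this
    rw [hK]
    have h' := height_le_ht (F := F) (c₀ := c₀) hP (hy _ (List.getElem_mem hi')) this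
    simpa [List.getD_eq_getElem?_getD, hi] using h'
  -- Without any candidate the value is `c₀`, whose height one is always within the bound.
  · rw [h, hc]; omega

end Values


/-! ## Contexts -/

namespace Ctx

theorem freeVars_fill {X Y : Fml L Sk} (h : X.freeVars ⊆ Y.freeVars) (C : Ctx L Sk) :
    (C.fill X).freeVars ⊆ (C.fill Y).freeVars := by
  induction C with
  | hole => exact h
  | neg C ih => exact ih
  | orL C B ih => exact Finset.union_subset_union ih subset_rfl
  | orR B C ih => exact Finset.union_subset_union subset_rfl ih
  | andL C B ih => exact Finset.union_subset_union ih subset_rfl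
  | andR B C ih => exact Finset.union_subset_union subset_rfl ih
  | quant q x C ih => exact Finset.erase_subset_erase _ ih

theorem noVacuous_fill {X Y : Fml L Sk} (h : X.freeVars ⊆ Y.freeVars)
    (hV : X.NoVacuous → Y.NoVacuous) (C : Ctx L Sk) :
    (C.fill X).NoVacuous → (C.fill Y).NoVacuous := by
  induction C with
  | hole => exact hV
  | neg C ih => exact ih
  | orL C B ih => exact And.imp ih id
  | orR B C ih => exact And.imp id ih
  | andL C B ih => exact And.imp ih id
  | andR B C ih => exact And.imp id ih
  | quant q x C ih => exact And.imp (fun h' => freeVars_fill h C h') ih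

theorem noVacuous_of_fill {X : Fml L Sk} (C : Ctx L Sk) : (C.fill X).NoVacuous → X.NoVacuous := by
  induction C with
  | hole => exact id
  | neg C ih => exact ih
  | orL C B ih => exact fun h => ih h.1
  | orR B C ih => exact fun h => ih h.2
  | andL C B ih => exact fun h => ih h.1
  | andR B C ih => exact fun h => ih h.2
  | quant q x C ih => exact fun h => ih h.2

theorem flat_fill {P : Variable → Prop} {X Y : Fml L Sk} (h : X.Flat P → Y.Flat P)
    (C : Ctx L Sk) : (C.fill X).Flat P → (C.fill Y).Flat P := by
  induction C with
  | hole => exact h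
  | neg C ih => exact ih
  | orL C B ih => exact And.imp ih id
  | orR B C ih => exact And.imp id ih
  | andL C B ih => exact And.imp ih id
  | andR B C ih => exact And.imp id ih
  | quant q x C ih => exact And.imp ih id

theorem flat_of_fill {P : Variable → Prop} {X : Fml L Sk} (C : Ctx L Sk) :
    (C.fill X).Flat P → X.Flat P := by
  induction C with
  | hole => exact id
  | neg C ih => exact ih
  | orL C B ih => exact fun h => ih h.1
  | orR B C ih => exact fun h => ih h.2
  | andL C B ih => exact fun h => ih h.1
  | andR B C ih => exact fun h => ih h.2
  | quant q x C ih => exact fun h => ih h.1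

theorem syms_subset_fill (X : Fml L Sk) (C : Ctx L Sk) : X.syms ⊆ (C.fill X).syms := by
  induction C with
  | hole => exact subset_rfl
  | neg C ih => exact ih
  | orL C B ih => exact ih.trans Set.subset_union_left
  | orR B C ih => exact ih.trans Set.subset_union_right
  | andL C B ih => exact ih.trans Set.subset_union_left
  | andR B C ih => exact ih.trans Set.subset_union_right
  | quant q x C ih => exact ih

theorem of_mem_syms_fill {X Y : Fml L Sk} {c : Σ m, FunSym L Sk m} (C : Ctx L Sk) :
    c ∈ (C.fill Y).syms → c ∈ (C.fill X).syms ∨ c ∈ Y.syms := by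
  induction C with
  | hole => exact .inr
  | neg C ih => exact ih
  | orL C B ih => simp only [fill, Fml.syms, Set.mem_union]; tauto
  | orR B C ih => simp only [fill, Fml.syms, Set.mem_union]; tauto
  | andL C B ih => simp only [fill, Fml.syms, Set.mem_union]; tauto
  | andR B C ih => simp only [fill, Fml.syms, Set.mem_union]; tauto
  | quant q x C ih => exact ih

theorem Accessible.freeVars_subset {C : Ctx L Sk} (hC : C.Accessible) (X : Fml L Sk) :
    X.freeVars ⊆ (C.fill X).freeVars := by
  induction C with
  | hole => exact subset_rfl
  | neg C ih => exact ih hC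
  | orL C B ih => exact (ih hC).trans Finset.subset_union_left
  | orR B C ih => exact (ih hC).trans Finset.subset_union_right
  | andL C B ih => exact (ih hC).trans Finset.subset_union_left
  | andR B C ih => exact (ih hC).trans Finset.subset_union_right
  | quant q x C ih => exact hC.elim

/-- If the whole formula has polarity `p`, the hole has polarity `C.positive == p`; generalizing
over `p` is what lets the induction pass negations. -/
theorem noGamma_fill {X Y : Fml L Sk} (C : Ctx L Sk) : ∀ {p : Bool},
    (NoGamma (C.positive == p) Y → NoGamma (C.positive == p) X) →
    NoGamma p (C.fill Y) → NoGamma p (C.fill X) := by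
  induction C with
  | hole => intro p h; cases p <;> exact h
  | neg C ih =>
    intro p h
    have hp : ((neg C).positive == p) = (C.positive == !p) := by
      simp only [positive]; cases C.positive <;> cases p <;> rfl
    rw [hp] at h
    exact ih h
  | orL C B ih => exact fun h => And.imp (ih h) id
  | orR B C ih => exact fun h => And.imp id (ih h)
  | andL C B ih => exact fun h => And.imp (ih h) id
  | andR B C ih => exact fun h => And.imp id (ih h)
  | quant q x C ih => exact fun h => And.imp id (ih h)

/-- Equality of values under all assignments passes through quantifiers. Hence simplification, which
is allowed at inaccessible positions, needs no monotonicity. -/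
theorem key_fill {F : Fml L Sk} {c₀ : Tm L Sk} {I : Interp L Sk} {X Y : Fml L Sk} (C : Ctx L Sk)
    (h : ∀ ρ, key F c₀ I ρ Y = key F c₀ I ρ X) :
    ∀ ρ, key F c₀ I ρ (C.fill Y) = key F c₀ I ρ (C.fill X) := by
  induction C with
  | hole => exact h
  | neg C ih => intro ρ; simp only [fill, key, ih]
  | orL C B ih => intro ρ; simp only [fill, key, ih]
  | orR B C ih => intro ρ; simp only [fill, key, ih]
  | andL C B ih => intro ρ; simp only [fill, key, ih]
  | andR B C ih => intro ρ; simp only [fill, key, ih]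
  | quant q x C ih => intro ρ; simp only [fill, key, ih]

/-- An implication at one assignment passes only through sentential connectives, reversed by each
negation. An implication below a quantifier would not suffice, because the range of a δ-quantifier
depends on the value itself. -/
theorem Accessible.holds_fill {F : Fml L Sk} {c₀ : Tm L Sk} {I : Interp L Sk} {δ : DeltaFn L Sk}
    {T : Set (Tm L Sk)} {val : ∀ k : ℕ, L.Relations k → (Fin k → Tm L Sk) → Prop}
    {X Y : Fml L Sk} {ρ : Variable → Leaf L Sk} {C : Ctx L Sk} (hC : C.Accessible) :
    ∀ {p : Bool}, PolImp (C.positive == p) (holds F c₀ δ T val (C.positive == p) (key F c₀ I ρ Y))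
      (holds F c₀ δ T val (C.positive == p) (key F c₀ I ρ X)) →
    PolImp p (holds F c₀ δ T val p (key F c₀ I ρ (C.fill Y)))
      (holds F c₀ δ T val p (key F c₀ I ρ (C.fill X))) := by
  induction C with
  | hole => intro p h; cases p <;> exact h
  | neg C ih =>
    intro p h
    have hp : ((neg C).positive == p) = (C.positive == !p) := by
      simp only [positive]; cases C.positive <;> cases p <;> rfl
    rw [hp] at h
    exact (ih hC h).not
  | orL C B ih =>
    intro p h; simp only [fill, holds_key_or]; exact (ih hC h).or PolImp.rfl
  | orR B C ih =>
    intro p h; simp only [fill, holds_key_or]; exact PolImp.rfl.or (ih hC h)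
  | andL C B ih =>
    intro p h; simp only [fill, holds_key_and]; exact (ih hC h).and PolImp.rfl
  | andR B C ih =>
    intro p h; simp only [fill, holds_key_and]; exact PolImp.rfl.and (ih hC h)
  | quant q x C ih => exact hC.elim

end Ctx

/-! ## Soundness of the calculus -/

section Soundness

variable {F : Fml L Sk} {c₀ : Tm L Sk} {δ : DeltaFn L Sk} {T : Set (Tm L Sk)}
  {val : ∀ k : ℕ, L.Relations k → (Fin k → Tm L Sk) → Prop}

/-- Makes the lemmas on `List.idxOf` available, by which variables are matched with positions in
argument lists. -/
instance : LawfulBEq Variable where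
  eq_of_beq {a b} h := by
    cases a <;> cases b <;> simp_all [BEq.beq, Sum.instBEq.beq]
  rfl {a} := by cases a <;> simp [BEq.beq, Sum.instBEq.beq]

/-- The variables `ys` take the values `ts`; all other variables take a default value. -/
def assign (c₀ : Tm L Sk) (ys : List Variable) (ts : List (Tm L Sk)) (v : Variable) : Leaf L Sk :=
  match ts[ys.idxOf v]? with
  | some t => .val t
  | none => Sum.elim .ord (fun _ => .val c₀) v

theorem assign_eq_val {ys : List Variable} {ts : List (Tm L Sk)} (h : ts.length = ys.length)
    {v : Variable} (hv : v ∈ ys) : ∃ t ∈ ts, assign c₀ ys ts v = .val t := by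
  have hlt : ys.idxOf v < ts.length := h ▸ List.idxOf_lt_length_iff.2 hv
  exact ⟨ts[ys.idxOf v], List.getElem_mem hlt, by simp [assign, hlt]⟩

theorem assign_of_notMem {ys : List Variable} {ts : List (Tm L Sk)} (h : ts.length = ys.length)
    {v : Variable} (hv : v ∉ ys) : assign c₀ ys ts v = Sum.elim .ord (fun _ => .val c₀) v := by
  simp [assign, List.idxOf_eq_length hv, h]

theorem assign_map {ys : List Variable} (g : Variable → Tm L Sk) {v : Variable} (hv : v ∈ ys) :
    assign c₀ ys (ys.map g) v = .val (g v) := by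
  have hlt : ys.idxOf v < ys.length := List.idxOf_lt_length_iff.2 hv
  simp [assign, hlt]

/-- In lists without repetitions, corresponding variables have the same index and so receive the
same term. -/
theorem assign_eq_of_listRel {ys ys' : List Variable} {ts : List (Tm L Sk)}
    (hn : ys.Nodup) (hn' : ys'.Nodup) (h : ts.length = ys.length) (h' : ys.length = ys'.length)
    {a b : Variable} (hab : listRel ys ys' a b) : assign c₀ ys ts a = assign c₀ ys' ts b := by
  rcases hab with ⟨i, ha, hb⟩ | ⟨ha, hb, rfl⟩
  · obtain ⟨hi, rfl⟩ := List.getElem?_eq_some_iff.1 ha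
    obtain ⟨hi', rfl⟩ := List.getElem?_eq_some_iff.1 hb
    have hi'' : i < ts.length := h ▸ hi
    simp [assign, hn.idxOf_getElem, hn'.idxOf_getElem, hi'']
  · rw [assign_of_notMem h ha, assign_of_notMem (h.trans h') hb]

/-- The arguments of `δ` in applications of the rule of δ⁺⁺-quantification. -/
def IsDeltaArg (C : Fml L Sk) (ys : List Variable) : Prop :=
  (C.Flat fun v => v.isRight) ∧ (∀ x, Sum.inr x ∈ C.freeVars → Sum.inr x ∈ ys) ∧
    ∀ y ∈ ys, y.isRight

variable (F c₀ δ T val) in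
/-- An interpretation takes worst values at the elements of a list. -/
def Solves (I : Interp L Sk) (l : List (Fml L Sk × List Variable)) : Prop :=
  ∀ e ∈ l, ∀ ts : List (Tm L Sk), ts.length = e.2.length →
    I (δ.sym e.1 e.2) ts = worst F c₀ δ T val (key F c₀ I (assign c₀ e.2 ts) e.1)

variable (F) in
/-- The values of a function are terms over `F`, higher by at most one than the arguments. -/
def Moderate (s : Σ m, Sk m) (φ : List (Tm L Sk) → Tm L Sk) : Prop :=
  ∀ ts, ts.length = s.1 → TermOver F (φ ts) ∧
    ∀ N, (∀ t ∈ ts, height t ≤ N) → height (φ ts) ≤ N + 1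

/-- The worst value depends only on the key, which is invariant under the renamings that `δ` may
identify; so the recursion scheme applies. Terms of `F` with moderate height come out because a
worst value is a candidate or `c₀`. -/
theorem exists_solves (hδ : δ.Admissible) (hc : TermOver F c₀) (hc' : height c₀ = 1)
    {l : List (Fml L Sk × List Variable)} (hl : Layered δ IsDeltaArg l) :
    ∃ I : Interp L Sk, (∀ s, Moderate F s (I s)) ∧ Solves F c₀ δ T val I l := by
  refine exists_interp hδ
    (fun I C ys ts => worst F c₀ δ T val (key F c₀ I (assign c₀ ys ts) C)) (Moderate F)
    (fun _ => c₀) (fun s ts _ => ⟨hc, fun N _ => by simp only [hc']; omega⟩) ?_ ?_ ?_ l hl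
  · intro I C ys hI hV _ _ ts hts
    refine ⟨termOver_worst hc _, fun N hN => (height_worst hc' _).trans
      (Nat.add_le_add_right (ht_le (fun s ts h h' => (hI s ts h).2 N h') hV.1 ?_ ?_) 1)⟩
    · intro v hv
      by_cases hvy : v ∈ ys
      · obtain ⟨t, ht, h⟩ := assign_eq_val (c₀ := c₀) hts hvy
        rw [h]; exact hN t ht
      · rw [assign_of_notMem hts hvy]
        cases v with
        | inl x => simp [Leaf.ht]
        | inr x => exact absurd (hV.2.1 x hv) hvy
    · intro x hx
      obtain ⟨t, -, h⟩ := assign_eq_val (c₀ := c₀) hts (hV.2.1 x hx)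
      exact ⟨t, h⟩
  · intro I I' C ys h
    funext ts
    rw [key_congr h fun _ _ => rfl]
  · intro I C ys C' ys' _ _ _ hn hn' hlen hren ts hts
    rw [key_ren hren fun a b hab => assign_eq_of_listRel hn hn' hts hlen hab]

theorem Variant.key_eq {I : Interp L Sk} {H H' : Fml L Sk} (h : Variant H H')
    (ρ : Variable → Leaf L Sk) : key F c₀ I ρ H = key F c₀ I ρ H' :=
  key_ren h fun _ _ hab => by rw [hab]

-- Induction from the conclusion backwards to the premise. Going up, the list grows by the argument
-- of `δ` at each δ-inference, and that formula contains only symbols recorded before. The clause on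
-- `NoGamma` serves the case of an empty champ fini.
variable (F c₀ T val) in
theorem exists_layered_of_steps {A : Fml L Sk} (hA : A.Original) (hV : A.NoVacuous) {G : Fml L Sk}
    (h : Relation.ReflTransGen (Step δ) G A) :
    ∃ l, Layered δ IsDeltaArg l ∧ (∀ s, skSym L s ∈ G.syms → ∃ e ∈ l, s = δ.sym e.1 e.2) ∧
      G.NoVacuous ∧ (G.Flat fun v => v.isRight) ∧
      (NoGamma true G → (∀ x, Sum.inr x ∉ G.freeVars) → NoGamma true A) ∧
      ∀ I, Solves F c₀ δ T val I l → ∀ ρ : Variable → Leaf L Sk, (∀ x, ρ (.inl x) = .ord x) →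
        (∀ x, Sum.inr x ∈ G.freeVars → ∃ t ∈ T, ρ (.inr x) = .val t) →
        holds F c₀ δ T val true (key F c₀ I ρ G) → holds F c₀ δ T val true (key F c₀ I ρ A) := by
  induction h using Relation.ReflTransGen.head_induction_on with
  | refl =>
    exact ⟨[], trivial, fun s hs => absurd hs (hA.skSym_notMem s), hV, hA.flat _ (by simp),
      fun h _ => h, fun I _ ρ _ _ h => h⟩
  | @head G G' hstep _ ih =>
    obtain ⟨l, hl, hsyms, hGV, hGF, hNG, hsound⟩ := ih
    cases hstep with
    | simplification C H H' hvar =>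
      have hfv : H.freeVars ⊆ (alphaOp C.positive H H').freeVars := by
        cases C.positive <;> exact Finset.subset_union_left
      refine ⟨l, hl, fun s hs => ?_, C.noVacuous_fill hfv (fun h => ?_) hGV,
        C.flat_fill (P := fun v => v.isRight) (fun h => ?_) hGF, fun h h' => hNG (C.noGamma_fill (fun h => ?_) h)
          fun x hx => h' x (C.freeVars_fill hfv hx), fun I hI ρ hρ hρ' hh => ?_⟩
      · rcases C.of_mem_syms_fill hs with hs | hs
        · exact hsyms s hs
        · refine hsyms s (C.syms_subset_fill H ?_)
          have := Ren.syms_eq hvar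
          cases hp : C.positive <;> simpa [hp, alphaOp, Fml.syms, ← this] using hs
      · have := Ren.noVacuous hvar h
        cases C.positive <;> exact ⟨h, this⟩
      · have := Ren.flat hvar (P := fun v => v.isRight) (Q := fun v => v.isRight)
          (fun a b hab => by rw [hab]; exact id) (by simp) h
        cases C.positive <;> exact ⟨h, this⟩
      · revert h
        generalize (C.positive == true) = p
        cases C.positive <;> exact fun h => h.1
      · refine hsound I hI ρ hρ (fun x hx => hρ' x (C.freeVars_fill hfv hx)) ?_
        -- Both members of the duplicate have the same value, so `Key.join` collapses them: premise
        -- and conclusion have equal values.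
        rwa [C.key_fill (X := H) (fun ρ => ?_) ρ] at hh
        have := hvar.key_eq (F := F) (c₀ := c₀) (I := I) ρ
        cases C.positive <;> simp [alphaOp, key, ← this, Key.join]
    | gamma C hC x H =>
      have hx : Sum.inl x ∈ H.freeVars := (C.noVacuous_of_fill hGV).1
      have hfv : (Fml.quant (gammaQ C.positive) x H).freeVars ⊆
          (H.replace x (.var (.inr x))).freeVars := fun v hv => by
        simp only [Fml.freeVars, Finset.mem_erase] at hv
        exact Fml.mem_freeVars_replace_of_ne hv.2 hv.1
      -- Since the quantifier is not vacuous, the γ-variable does occur in the premise; therefore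
      -- `hρ'` provides it with a value in `T`.
      have hγ : Sum.inr x ∈ (C.fill (H.replace x (.var (.inr x)))).freeVars :=
        hC.freeVars_subset _ (Fml.mem_freeVars_subst_of_mem H hx
          (by rw [Function.update_self, mem_varFinset_var]) (.inr (by simp)))
      refine ⟨l, hl, fun s hs => ?_, C.noVacuous_fill hfv (fun h => h.2.subst _) hGV,
        C.flat_fill (P := fun v => v.isRight) (X := .quant (gammaQ C.positive) x H)
          (fun h => Fml.Flat.subst h.1 (fun v => ?_) fun v hv => ?_) hGF,
        fun _ h' => absurd hγ (h' x), fun I hI ρ hρ hρ' hh => ?_⟩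
      · rcases C.of_mem_syms_fill hs with hs | hs
        · exact hsyms s hs
        · refine hsyms s (C.syms_subset_fill (Fml.quant _ _ _) ?_)
          rcases Fml.of_mem_syms_replace hs with hs | hs
          · exact hs
          · simp [tmSyms] at hs
      · by_cases hv : v = Sum.inl x
        · subst hv; simp [TmFlat]
        · rw [Function.update_of_ne hv]; trivial
      · rw [Function.update_of_ne]; rintro rfl; simp at hv
      · obtain ⟨t, ht, hρx⟩ := hρ' x hγ
        refine hsound I hI ρ hρ (fun x hx => hρ' x (C.freeVars_fill hfv hx))
          (hC.holds_fill (p := true) ?_ hh)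
        rw [beq_true, key_replace (ℓ := .val t) (by simp [tmVal, hρx])
          (by simp), key]
        exact polImp_gamma _ (fun ℓ => key F c₀ I (Function.update ρ (Sum.inl x) ℓ) H) ht
    | delta C hC y H xs hnd hxs =>
      set B := Fml.quant (deltaQ C.positive) y H with hB
      have hy : Sum.inl y ∈ H.freeVars := (C.noVacuous_of_fill hGV).1
      have hfv : B.freeVars ⊆
          (H.replace y (deltaTerm δ B (xs.map Sum.inr))).freeVars := fun v hv => by
        simp only [hB, Fml.freeVars, Finset.mem_erase] at hv
        exact Fml.mem_freeVars_replace_of_ne hv.2 hv.1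
      have hBF : B.Flat fun v => v.isRight := C.flat_of_fill hGF
      have harg : IsDeltaArg B (xs.map Sum.inr) :=
        ⟨hBF, fun x hx => List.mem_map.2 ⟨x, (hxs x).2 hx, rfl⟩, by simp⟩
      -- The quantified formula already occurs in the conclusion, so its Skolem symbols come from
      -- `l`, and the list remains layered.
      refine ⟨(B, xs.map Sum.inr) :: l, ⟨⟨harg, hnd.map Sum.inr_injective, ?_⟩,
        fun s hs => hsyms s (C.syms_subset_fill B hs), hl⟩, fun s hs => ?_,
        C.noVacuous_fill hfv (fun h => h.2.subst _) hGV,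
        C.flat_fill (P := fun v => v.isRight) (X := .quant (deltaQ C.positive) y H)
          (fun h => Fml.Flat.subst h.1 (fun v => ?_) fun v hv => ?_) hGF,
        fun h h' => hNG (C.noGamma_fill (fun h => ⟨?_, (noGamma_subst H _ _).1 h⟩) h)
          fun x hx => h' x (C.freeVars_fill hfv hx),
        fun I hI ρ hρ hρ' hh => ?_⟩
      · intro v hv
        obtain ⟨x, hx, rfl⟩ := List.mem_map.1 hv
        exact (hxs x).1 hx
      · rcases C.of_mem_syms_fill (X := B) hs with hs | hs
        · obtain ⟨e, he, h⟩ := hsyms s hs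
          exact ⟨e, .tail _ he, h⟩
        · rcases Fml.of_mem_syms_replace hs with hs | hs
          · obtain ⟨e, he, h⟩ := hsyms s (C.syms_subset_fill B hs)
            exact ⟨e, .tail _ he, h⟩
          · rw [tmSyms_deltaTerm, Set.mem_singleton_iff] at hs
            refine ⟨_, .head _, ?_⟩
            have := congrArg (fun c : Σ m, FunSym L Sk m => FunSym.sk? c.2) hs
            simpa [skSym, FunSym.sk?] using this
      · by_cases hv : v = Sum.inl y
        · subst hv; rw [Function.update_self]; exact tmFlat_deltaTerm (by simp)
        · rw [Function.update_of_ne hv]; trivial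
      · rw [Function.update_of_ne]; rintro rfl; simp at hv
      · rw [beq_true]; exact (gammaQ_ne_deltaQ _).symm
      · refine hsound I (fun e he => hI e (.tail _ he)) ρ hρ
          (fun x hx => hρ' x (C.freeVars_fill hfv hx)) (hC.holds_fill (p := true) ?_ hh)
        rw [beq_true, key_replace (tmVal_deltaTerm δ I ρ B _) (fun x _ => by
          rw [mem_varFinset_deltaTerm]; simp)]
        -- The new symbol takes the worst value for `B` under the assignment read off from its
        -- arguments. This is the value of `B` under `ρ`: all free γ-variables of `B` are arguments,
        -- and ordinary variables stand for themselves.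
        rw [hI _ (.head _) _ (by simp)]
        have : key F c₀ I (assign c₀ (xs.map Sum.inr) ((xs.map Sum.inr).map
            fun v => (ρ v).tm F c₀)) B = key F c₀ I ρ B := by
          refine key_congr (fun _ _ => rfl) fun v hv => ?_
          cases v with
          | inl x => rw [assign_of_notMem (by simp) (by simp), hρ]; rfl
          | inr x =>
            rw [assign_map _ (harg.2.1 x hv)]
            obtain ⟨t, -, ht⟩ := hρ' x (C.freeVars_fill hfv (hC.freeVars_subset _ hv))
            rw [ht, Leaf.tm]
        simp only
        rw [this, hB, key]
        exact polImp_worst _ fun ℓ => key F c₀ I (Function.update ρ (Sum.inl y) ℓ) H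

/-! ## The Skolemized form -/

/-- No symbol is foreign to `F`, and `herbrand` rebuilds each Skolem term from its arguments; what
remains of evaluation is substitution. -/
theorem flatten_tmVal_eq_subst {P : Variable → Prop} {t : Tm L Sk} {ρ : Variable → Leaf L Sk}
    {θ : Variable → Tm L Sk} (ht : TmFlat P t) (hs : tmSyms t ⊆ F.syms)
    (hv : ∀ v ∈ t.varFinset, (ρ v).tm F c₀ = θ v) :
    flatten F c₀ (tmVal F c₀ (herbrand c₀) ρ t) = t.subst θ := by
  induction t with
  | var v => exact hv v (mem_varFinset_var.2 rfl)
  | @func m f ts ih =>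
    have ih' := fun i => ih i (ht.1 i) (fun c hc => hs (.inr (Set.mem_iUnion.2 ⟨i, hc⟩)))
      fun v h => hv v (mem_varFinset_func.2 ⟨i, h⟩)
    simp only [tmVal, Term.subst]
    cases hf : FunSym.sk? f with
    | none =>
      simp only [flatten, ih']
      rw [if_pos (hs (.inl rfl))]
    | some s =>
      have := sk?_eq_some.1 hf
      cases this
      simp only [flatten, Leaf.tm, ih', herbrand]
      congr 1
      funext i
      simp

/-- Evaluation and expansion treat γ-quantifiers alike, both ranging over `T`. At a δ-quantifier the
semantics considers all candidates and the Skolemized form one of them, which gives an implication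
whose direction follows the polarity. The variables in `xs` carry their instances both as leaves in
`ρ` and as terms in `θ`. -/
theorem eval_of_holds (hT : ∀ t ∈ T, TermOver F t) (p : Bool) (xs : List ℕ)
    (G : Fml L Sk) (hG : Stage xs G) : ∀ (ρ : Variable → Leaf L Sk) (θ : Variable → Tm L Sk) {E},
    (∀ x ∈ xs, ρ (.inl x) = .val (θ (.inl x)) ∧ TermOver F (θ (.inl x))) →
    (∀ x, Sum.inl x ∈ G.freeVars → x ∈ xs ∨ Sum.inl x ∈ F.freeVars ∧ ρ (.inl x) = .ord x) →
    (∀ v ∈ F.freeVars, θ v = .var v) → (∀ x ∈ G.binders, Sum.inl x ∉ F.freeVars) →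
    (skolemize δ p xs G).syms ⊆ F.syms → IsExpansion T (skolemize δ p xs G) E →
    PolImp p (holds F c₀ δ T val p (key F c₀ (herbrand c₀) ρ G)) ((E.subst θ).eval val) := by
  -- Elements of `T` contain only free variables of `F`, all fixed by `θ`, so inserting them one
  -- after the other amounts to a simultaneous substitution.
  have hTθ : ∀ t ∈ T, ∀ θ : Variable → Tm L Sk, (∀ v ∈ F.freeVars, θ v = .var v) →
      t.subst θ = t := by
    intro t ht θ hθ
    refine tmSubst_eq_self fun v hv => hθ v ?_
    have := hT t ht
    clear ht
    induction t with
    | var w => rw [mem_varFinset_var] at hv; subst hv; exact this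
    | func f ts ih =>
      obtain ⟨i, hi⟩ := mem_varFinset_func.1 hv
      exact ih i hi (this.2 i)
  have hrep : ∀ {B : Fml L Sk} (x : ℕ) (t : Tm L Sk) (θ : Variable → Tm L Sk), B.QF → t ∈ T →
      (∀ v ∈ F.freeVars, θ v = .var v) →
      (B.replace x t).subst θ = B.subst (Function.update θ (Sum.inl x) t) := by
    intro B x t θ hB ht hθ
    rw [Fml.replace, hB.subst_subst]
    congr 1
    funext v
    by_cases hv : v = Sum.inl x
    · subst hv; simp [hTθ t ht θ hθ]
    · simp [Function.update_of_ne hv, Term.subst]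
  induction p, xs, G using skolemize_induction δ with
  | rel p xs k R ts =>
    intro ρ θ E hxs hfv hθ hb hs hE
    rw [skolemize] at hE hs
    cases hE
    have : ∀ i, flatten F c₀ (tmVal F c₀ (herbrand c₀) ρ (ts i)) = (ts i).subst θ := fun i => by
      refine flatten_tmVal_eq_subst (hG.flat i)
        ((Set.subset_iUnion (fun i => tmSyms (ts i)) i).trans hs) fun v hv => ?_
      have hv' : v ∈ (Fml.rel R ts).freeVars := Fml.mem_freeVars_rel.2 ⟨i, hv⟩
      cases v with
      | inl x =>
        rcases hfv x hv' with hx | ⟨hx, hρ⟩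
        · rw [(hxs x hx).1, Leaf.tm]
        · rw [hρ, Leaf.tm, if_pos hx, hθ _ hx]
      | inr x => exact absurd hv' (hG.noGammaVar x)
    simp only [key, holds, Fml.subst, Fml.eval, this]
    exact PolImp.rfl
  | neg p xs A ih =>
    intro ρ θ E hxs hfv hθ hb hs hE
    rw [skolemize] at hE hs
    cases hE with
    | neg h => exact (ih hG.neg ρ θ hxs hfv hθ hb hs h).not
  | or p xs A B ihA ihB =>
    intro ρ θ E hxs hfv hθ hb hs hE
    rw [skolemize] at hE hs
    simp only [Fml.freeVars, Finset.mem_union, Fml.binders, List.mem_append] at hfv hb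
    rw [holds_key_or]
    cases hE with
    | or h h' =>
      exact (ihA hG.or_left ρ θ hxs (fun x hx => hfv x (.inl hx)) hθ (fun x hx => hb x (.inl hx))
        (Set.subset_union_left.trans hs) h).or
        (ihB hG.or_right ρ θ hxs (fun x hx => hfv x (.inr hx)) hθ (fun x hx => hb x (.inr hx))
        (Set.subset_union_right.trans hs) h')
  | and p xs A B ihA ihB =>
    intro ρ θ E hxs hfv hθ hb hs hE
    rw [skolemize] at hE hs
    simp only [Fml.freeVars, Finset.mem_union, Fml.binders, List.mem_append] at hfv hb
    rw [holds_key_and]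
    cases hE with
    | and h h' =>
      exact (ihA hG.and_left ρ θ hxs (fun x hx => hfv x (.inl hx)) hθ (fun x hx => hb x (.inl hx))
        (Set.subset_union_left.trans hs) h).and
        (ihB hG.and_right ρ θ hxs (fun x hx => hfv x (.inr hx)) hθ (fun x hx => hb x (.inr hx))
        (Set.subset_union_right.trans hs) h')
  | gamma p xs x H ih =>
    intro ρ θ E hxs hfv hθ hb hs hE
    simp only [Fml.freeVars, Finset.mem_erase, Fml.binders, List.mem_cons] at hfv hb
    rw [skolemize_gamma] at hE hs
    have key' : ∀ {B}, IsExpansion T (skolemize δ p (xs ++ [x]) H) B → ∀ t ∈ T,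
        PolImp p (holds F c₀ δ T val p
          (key F c₀ (herbrand c₀) (Function.update ρ (Sum.inl x) (.val t)) H))
          (((B.replace x t).subst θ).eval val) := by
      intro B hB t ht
      rw [hrep x t θ hB.qf ht hθ]
      refine ih hG.gamma _ _ (fun z hz => ?_) (fun z hz => ?_) (fun v hv => ?_)
        (fun z hz => hb z (.inr hz)) hs hB
      · by_cases hzx : z = x
        · subst hzx; simp [hT t ht]
        · have h' : (Sum.inl z : Variable) ≠ Sum.inl x := fun h => hzx (Sum.inl.inj h)
          rw [Function.update_of_ne h', Function.update_of_ne h']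
          refine hxs z ?_
          simpa [hzx] using hz
      · by_cases hzx : z = x
        · simp [hzx]
        · have h' : (Sum.inl z : Variable) ≠ Sum.inl x := fun h => hzx (Sum.inl.inj h)
          rw [Function.update_of_ne h']
          exact (hfv z ⟨h', hz⟩).imp_left fun h => by simp [h]
      · rw [Function.update_of_ne, hθ v hv]
        rintro rfl
        exact hb x (.inl rfl) hv
    cases p with
    | true =>
      cases hE with
      | ex _ h t l hnd ht =>
        rintro ⟨ℓ, hℓ, hh⟩
        rw [range, if_pos (by rfl)] at hℓ
        obtain ⟨u, hu, rfl⟩ := hℓ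
        rw [Fml.bigOr_subst, Fml.eval_bigOr]
        refine ⟨_, ?_, key' h u hu hh⟩
        have := (ht u).2 hu
        simp only [List.mem_cons, List.mem_map] at this ⊢
        rcases this with rfl | hu'
        · exact .inl rfl
        · exact .inr ⟨_, ⟨u, hu', rfl⟩, rfl⟩
    | false =>
      cases hE with
      | all _ h t l hnd ht =>
        intro hh ℓ hℓ
        rw [range, if_pos (by rfl)] at hℓ
        obtain ⟨u, hu, rfl⟩ := hℓ
        rw [Fml.bigAnd_subst, Fml.eval_bigAnd] at hh
        refine key' h u hu (hh _ ?_)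
        have := (ht u).2 hu
        simp only [List.mem_cons, List.mem_map] at this ⊢
        rcases this with rfl | hu'
        · exact .inl rfl
        · exact .inr ⟨_, ⟨u, hu', rfl⟩, rfl⟩
  | delta p xs y H ih =>
    intro ρ θ E hxs hfv hθ hb hs hE
    have hmem := hs (sym_mem_skolemize (δ := δ) (p := p) (xs := xs) hG.noVacuous.1)
    simp only [Fml.freeVars, Finset.mem_erase, Fml.binders, List.mem_cons] at hfv hb
    rw [skolemize_delta] at hE hs
    set B := Fml.quant (deltaQ p) y H with hB
    set ys := skArgs xs H with hys
    have hyxs : y ∉ xs := hG.notMem y (by simp [hB, Fml.binders])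
    have hvals : ∀ v ∈ ys, ∃ x ∈ xs, v = Sum.inl x ∧ ρ v = .val (θ v) ∧ TermOver F (θ v) := by
      intro v hv
      obtain ⟨⟨x, hx, rfl⟩, -⟩ := mem_skArgs.1 hv
      exact ⟨x, hx, rfl, hxs x hx⟩
    have key' := ih (hG.delta δ B) ρ θ hxs (fun x hx => by
      rcases Fml.of_mem_freeVars_replace hx with hx | ⟨hx, -⟩
      · exact hfv x ⟨hx.2, hx.1⟩
      · rw [mem_varFinset_deltaTerm, mem_skArgs] at hx
        obtain ⟨⟨z, hz, h⟩, -⟩ := hx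
        cases h; exact .inl hz) hθ (fun x hx => by
      rw [Fml.binders_replace] at hx; exact hb x (.inr hx)) hs hE
    have htm : ys.map (fun v => (ρ v).tm F c₀) = ys.map θ := List.map_congr_left fun v hv => by
      obtain ⟨x, -, -, h, -⟩ := hvals v hv
      rw [h, Leaf.tm]
    rw [key_replace (tmVal_deltaTerm δ _ ρ B _) (fun z hz h => by
      rw [mem_varFinset_deltaTerm, mem_skArgs] at h
      obtain ⟨⟨z', hz', h⟩, -⟩ := h
      cases h
      exact hG.notMem z (by simp [hB, Fml.binders, hz]) hz'), htm] at key'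
    -- The Skolem term inserted at this stage is a candidate by definition: its symbol survives in
    -- `F`, its arguments are terms over `F`, and its formula has the value in question.
    have hcand : herbrand c₀ (δ.sym B ys) (ys.map θ) ∈
        candidates F c₀ δ (key F c₀ (herbrand c₀) ρ B) := by
      refine ⟨B, ys, ρ, ys.map θ, hmem, fun v hv => ?_, ⟨_, hG.flat⟩, ?_, ?_, rfl, rfl⟩
      · obtain ⟨x, hx, rfl, -⟩ := hvals v hv
        simp only [hB, Fml.freeVars, Finset.mem_erase]
        refine ⟨fun h => hyxs ?_, (mem_skArgs.1 hv).2⟩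
        cases h; exact hx
      · intro t ht
        obtain ⟨v, hv, rfl⟩ := List.mem_map.1 ht
        obtain ⟨x, -, -, -, h⟩ := hvals v hv
        exact h
      · rw [List.map_map]
        exact List.map_congr_left fun v hv => by
          obtain ⟨x, -, -, h, -⟩ := hvals v hv
          exact h
    have hrange : Leaf.sk (herbrand c₀ (δ.sym B ys) (ys.map θ)) ∈
        range F c₀ δ T p (deltaQ p) (key F c₀ (herbrand c₀) ρ B) := by
      rw [range, if_neg (gammaQ_ne_deltaQ p).symm]
      exact ⟨_, hcand, rfl⟩
    cases p with
    | true => exact fun h => key' (h _ hrange)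
    | false => exact fun h => ⟨_, hrange, key' h⟩

end Soundness

/-! ## The champ fini -/

theorem finite_tmSyms (t : Tm L Sk) : (tmSyms t).Finite := by
  induction t with
  | var v => exact Set.finite_empty
  | func f ts ih => exact (Set.finite_iUnion ih).insert _

theorem Fml.finite_syms (A : Fml L Sk) : A.syms.Finite := by
  induction A with
  | rel R ts => exact Set.finite_iUnion fun i => finite_tmSyms _
  | neg A ih => exact ih
  | or A B ihA ihB => exact ihA.union ihB
  | and A B ihA ihB => exact ihA.union ihB
  | quant q x A ih => exact ih

theorem finite_champFini (n : ℕ) (F : Fml L Sk) : (champFini n F).Finite := by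
  induction n with
  | zero => exact Set.finite_empty.subset fun t ht => absurd ht.2 (Nat.not_lt_zero _)
  | succ n ih =>
    have h1 : ((fun v => (Term.var v : Tm L Sk)) '' ↑F.freeVars).Finite :=
      F.freeVars.finite_toSet.image _
    have h2 : (⋃ c ∈ insert ⟨0, FunSym.bullet⟩ F.syms,
        (fun ts : Fin c.1 → Tm L Sk => (Term.func (L := extLang L Sk) c.2 ts : Tm L Sk)) ''
          Set.pi Set.univ fun _ => champFini n F).Finite :=
      (F.finite_syms.insert _).biUnion fun c _ => (Set.Finite.pi' fun _ => ih).image _ |>.subset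
        (Set.image_mono fun ts hts i => hts i trivial)
    refine (h1.union h2).subset ?_
    rintro t ⟨ht, hh⟩
    cases t with
    | var v => exact .inl ⟨v, ht, rfl⟩
    | @func m f ts =>
      refine .inr (Set.mem_biUnion (x := (⟨m, f⟩ : Σ m, FunSym L Sk m)) ?_
        ⟨ts, fun i _ => ⟨ht.2 i, ?_⟩, rfl⟩)
      · exact ht.1.elim .inr fun h => .inl h.2
      · simp only [height] at hh
        have := Finset.le_sup (f := fun i => height (ts i)) (Finset.mem_univ i)
        omega

/-- A term of least height always exists; for lack of constants and free variables it is `•`. Hence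
the champ fini is empty only if no term at all has height below `n`. -/
theorem exists_termOver (F : Fml L Sk) : ∃ c : Tm L Sk, TermOver F c ∧ height c = 1 := by
  by_cases h : NoConstant F
  · exact ⟨Term.func (L := extLang L Sk) (FunSym.bullet : FunSym L Sk 0) Fin.elim0,
      ⟨.inr ⟨h, rfl⟩, fun i => i.elim0⟩, by simp [height]⟩
  · simp only [NoConstant, not_and_or, not_forall, not_not] at h
    rcases h with ⟨c, hc⟩ | h
    · exact ⟨Term.func (L := extLang L Sk) c Fin.elim0, ⟨.inl hc, fun i => i.elim0⟩,
        by simp [height]⟩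
    · obtain ⟨v, hv⟩ := Finset.nonempty_iff_ne_empty.2 h
      exact ⟨.var v, hv, by simp [height]⟩

theorem exists_isExpansion {T : Set (Tm L Sk)} (hT : T.Finite) {A : Fml L Sk}
    (h : T.Nonempty ∨ A.QF) : ∃ E, IsExpansion T A E := by
  induction A with
  | rel R ts => exact ⟨_, .rel R ts⟩
  | neg A ih => obtain ⟨E, hE⟩ := ih h; exact ⟨_, .neg hE⟩
  | or A B ihA ihB =>
    obtain ⟨E, hE⟩ := ihA (h.imp_right And.left)
    obtain ⟨E', hE'⟩ := ihB (h.imp_right And.right)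
    exact ⟨_, .or hE hE'⟩
  | and A B ihA ihB =>
    obtain ⟨E, hE⟩ := ihA (h.imp_right And.left)
    obtain ⟨E', hE'⟩ := ihB (h.imp_right And.right)
    exact ⟨_, .and hE hE'⟩
  | quant q x A ih =>
    have hne : T.Nonempty := h.resolve_right id
    obtain ⟨E, hE⟩ := ih (.inl hne)
    have hmem : ∀ s, s ∈ hT.toFinset.toList ↔ s ∈ T := by simp
    have hnd := hT.toFinset.nodup_toList
    obtain ⟨t₀, ht₀⟩ := hne
    cases hl : hT.toFinset.toList with
    | nil => rw [← hmem, hl] at ht₀; simp at ht₀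
    | cons t l =>
      rw [hl] at hmem hnd
      cases q with
      | ex => exact ⟨_, .ex x hE t l hnd hmem⟩
      | all => exact ⟨_, .all x hE t l hnd hmem⟩

/-! ### From derivations to Property C* -/

/-- For quantifier-free formulas truth is sentential evaluation under the valuation pulled back
along the evaluation of terms. So tautologies are true in the structure. -/
theorem holds_key_iff_eval {F : Fml L Sk} {c₀ : Tm L Sk} {δ : DeltaFn L Sk} {T : Set (Tm L Sk)}
    {val : ∀ k : ℕ, L.Relations k → (Fin k → Tm L Sk) → Prop} {I : Interp L Sk}
    {ρ₀ ρ : Variable → Leaf L Sk} {s : Variable → Tm L Sk} {B : Fml L Sk} (hB : B.QF)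
    (hs : ∀ v, flatten F c₀ (tmVal F c₀ I ρ₀ (s v)) = (ρ v).tm F c₀) (p : Bool) :
    (B.subst s).eval (fun _ R ts => val _ R fun i => flatten F c₀ (tmVal F c₀ I ρ₀ (ts i))) ↔
      holds F c₀ δ T val p (key F c₀ I ρ B) := by
  induction B generalizing p with
  | rel R ts =>
    simp only [Fml.subst, Fml.eval, key, holds,
      fun i => flatten_tmVal_subst (F := F) (c₀ := c₀) (I := I) (t := ts i) fun v _ => hs v]
  | neg A ih => exact not_congr (ih hB _)
  | or A B ihA ihB => rw [holds_key_or]; exact or_congr (ihA hB.1 p) (ihB hB.2 p)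
  | and A B ihA ihB => rw [holds_key_and]; exact and_congr (ihA hB.1 p) (ihB hB.2 p)
  | quant q x A ih => exact hB.elim

/-- Every symbol contributes at most one to the height of a value: Skolem symbols because they are
`Moderate`, foreign symbols because they are replaced by `c₀`. -/
theorem flatten_tmVal_spec {F : Fml L Sk} {c₀ : Tm L Sk} (hc : TermOver F c₀)
    (hc' : height c₀ = 1) {I : Interp L Sk} (hI : ∀ s, Moderate F s (I s)) (t : Tm L Sk) :
    TermOver F (flatten F c₀ (tmVal F c₀ I (assign c₀ [] []) t)) ∧
      height (flatten F c₀ (tmVal F c₀ I (assign c₀ [] []) t)) ≤ height t := by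
  induction t with
  | var v =>
    cases v with
    | inl x =>
      simp only [tmVal, flatten, assign, List.getElem?_nil, Sum.elim_inl, Leaf.tm]
      split_ifs with h
      · exact ⟨h, le_rfl⟩
      · exact ⟨hc, by simp [hc', height]⟩
    | inr x =>
      simp only [tmVal, flatten, assign, List.getElem?_nil, Sum.elim_inr, Leaf.tm]
      exact ⟨hc, by simp [hc', height]⟩
  | @func m f ts ih =>
    simp only [tmVal]
    cases hf : FunSym.sk? f with
    | none =>
      simp only [flatten]
      split_ifs with h
      · refine ⟨⟨.inl h, fun i => (ih i).1⟩, ?_⟩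
        simp only [height]
        exact Nat.add_le_add_left (Finset.sup_mono_fun fun i _ => (ih i).2) 1
      · exact ⟨hc, by rw [hc']; exact one_le_height _⟩
    | some s =>
      have := sk?_eq_some.1 hf
      cases this
      simp only [flatten, Leaf.tm]
      refine (hI s _ (by simp)).imp id fun h => ?_
      simp only [height]
      rw [add_comm]
      refine h _ fun t ht => ?_
      obtain ⟨i, rfl⟩ := (List.mem_ofFn' _ _).1 ht
      exact (ih i).2.trans (Finset.le_sup (f := fun i => height (ts i)) (Finset.mem_univ i))

theorem IsDerivation.reflTransGen {δ : DeltaFn L Sk} {B A : Fml L Sk} {D : List (Fml L Sk)}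
    (h : IsDerivation δ B A D) : Relation.ReflTransGen (Step δ) B A := by
  obtain ⟨h1, h2, h3⟩ := h
  induction D generalizing B with
  | nil => simp at h2
  | cons G D ih =>
    simp only [List.head?_cons, Option.some.injEq] at h2
    subst h2
    cases D with
    | nil => simp at h3; rw [h3]
    | cons G' D =>
      rw [List.isChain_cons_cons] at h1
      exact .head h1.1 (ih h1.2 rfl (by simpa using h3))

/-- Soundness: a derivation from an instance of a tautology entails Property C*. -/
theorem propertyCstar_of_isWitness {δ : DeltaFn L Sk} (hδ : δ.Admissible) {A B : Fml L Sk} {n : ℕ}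
    (hA : A.Original) (hr : A.Rectified) {σ : ℕ → Tm L Sk} {D : List (Fml L Sk)}
    (hw : IsWitness δ n A B σ D) : PropertyCstar δ n A := by
  set F := skolemForm δ A with hF
  obtain ⟨c₀, hc, hc'⟩ := exists_termOver F
  have hst := Stage.of_rectified hA hr
  have hsteps := hw.derivation.reflTransGen
  have hne : ∀ x, Sum.inr x ∈ B.freeVars → (champFini n F).Nonempty := fun x hx =>
    ⟨c₀, hc, by have := hw.height_lt x hx; have := one_le_height (σ x); omega⟩
  -- With an empty champ fini there is no term of height below `n`, so `B` has no γ-variables. Then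
  -- no γ-inference occurs, `A` has no γ-quantifier, and its Skolemized form is quantifier-free.
  have hex : (champFini n F).Nonempty ∨ F.QF := by
    by_cases h : (champFini n F).Nonempty
    · exact .inl h
    · obtain ⟨l, -, -, -, -, hNG, -⟩ :=
        exists_layered_of_steps F c₀ (champFini n F) (fun _ _ _ => True) hA hr.1 hsteps
      exact .inr (NoGamma.qf_skolemize δ true [] A (hNG (hw.qf.noGamma _) fun x hx => h (hne x hx)))
  obtain ⟨E, hE⟩ := exists_isExpansion (finite_champFini n F) hex
  refine ⟨E, hE, hE.qf, fun val => ?_⟩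
  obtain ⟨l, hl, -, -, -, -, hsound⟩ :=
    exists_layered_of_steps F c₀ (champFini n F) val hA hr.1 hsteps
  obtain ⟨I, hI, hsol⟩ := exists_solves (T := champFini n F) (val := val) hδ hc hc' hl
  set π : Tm L Sk → Tm L Sk := fun t => flatten F c₀ (tmVal F c₀ I (assign c₀ [] []) t) with hπ
  set ρ : Variable → Leaf L Sk := Sum.elim .ord fun x => .val (π (σ x)) with hρ
  -- Terms of `σ` are evaluated into the champ fini by `π`; the tautology is used at the valuation
  -- of atoms through `π`.
  have hB : holds F c₀ δ (champFini n F) val true (key F c₀ I ρ B) := by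
    rw [← holds_key_iff_eval hw.qf (ρ₀ := assign c₀ [] [])
      (s := Sum.elim (fun x => .var (Sum.inl x)) σ)]
    · exact hw.tautology.2 _
    · rintro (x | x)
      · simp [hρ, tmVal, flatten, assign]
      · simp [hρ, hπ, Leaf.tm]
  have hAh := hsound I hsol ρ (fun x => rfl) (fun x hx => ⟨π (σ x), ⟨
    (flatten_tmVal_spec hc hc' hI _).1,
    (flatten_tmVal_spec hc hc' hI _).2.trans_lt (hw.height_lt x hx)⟩, rfl⟩) hB
  -- The original formula contains no Skolem symbols, so the interpretation by worst values may be
  -- exchanged for the one that fits the Skolemized form.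
  rw [key_congr (I' := herbrand c₀) (ρ' := ρ) (fun s hs => absurd hs (hA.skSym_notMem s))
    fun _ _ => rfl] at hAh
  have hsub := freeVars_subset_skolemize δ true [] A
  have hsub' := skolemize_freeVars_subset δ true [] A hst
  have := eval_of_holds (fun t ht => ht.1) true [] A hst ρ Term.var (by simp)
    (fun x hx => .inr ⟨hsub hx, rfl⟩) (fun _ _ => rfl)
    (fun x hx h => hst.notFree x hx (hsub' h)) subset_rfl hE hAh
  rwa [Fml.subst_var] at this


/-! ## Inferences at accessible positions -/

namespace Ctx

/-- Composition of contexts. -/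
def comp : Ctx L Sk → Ctx L Sk → Ctx L Sk
  | hole, K => K
  | neg C, K => neg (C.comp K)
  | orL C B, K => orL (C.comp K) B
  | orR B C, K => orR B (C.comp K)
  | andL C B, K => andL (C.comp K) B
  | andR B C, K => andR B (C.comp K)
  | quant q x C, K => quant q x (C.comp K)

theorem fill_comp (C K : Ctx L Sk) (X : Fml L Sk) : (C.comp K).fill X = C.fill (K.fill X) := by
  induction C with
  | hole => rfl
  | _ => simp_all [comp, fill]

theorem positive_comp (C K : Ctx L Sk) : (C.comp K).positive = (C.positive == K.positive) := by
  induction C with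
  | hole => simp [comp, positive]
  | neg C ih => simp only [comp, positive, ih]; cases C.positive <;> cases K.positive <;> rfl
  | _ => simp_all [comp, positive]

theorem accessible_comp {C K : Ctx L Sk} (hC : C.Accessible) (hK : K.Accessible) :
    (C.comp K).Accessible := by
  induction C with
  | hole => exact hK
  | quant q x C ih => exact hC.elim
  | neg C ih | orL C B ih | orR B C ih | andL C B ih | andR B C ih => exact ih hC

end Ctx

/-- One inference in a formula at a position of polarity `p`, without inferences in the scope of
quantifiers. -/
inductive AStep (δ : DeltaFn L Sk) : Bool → Fml L Sk → Fml L Sk → Prop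
  | simplification (p : Bool) (H H' : Fml L Sk) (h : Variant H H') : AStep δ p (alphaOp p H H') H
  | gamma (p : Bool) (x : ℕ) (H : Fml L Sk) :
      AStep δ p (H.replace x (.var (Sum.inr x))) (.quant (gammaQ p) x H)
  | delta (p : Bool) (y : ℕ) (H : Fml L Sk) (xs : List ℕ) (hnd : xs.Nodup)
      (hxs : ∀ x, x ∈ xs ↔ Sum.inr x ∈ (Fml.quant (deltaQ p) y H).freeVars) :
      AStep δ p (H.replace y (deltaTerm δ (.quant (deltaQ p) y H) (xs.map Sum.inr)))
        (.quant (deltaQ p) y H)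
  | neg {p : Bool} {A A' : Fml L Sk} (h : AStep δ (!p) A A') : AStep δ p (.neg A) (.neg A')
  | orL {p : Bool} {A A' : Fml L Sk} (h : AStep δ p A A') (B : Fml L Sk) :
      AStep δ p (.or A B) (.or A' B)
  | orR {p : Bool} {A A' : Fml L Sk} (B : Fml L Sk) (h : AStep δ p A A') :
      AStep δ p (.or B A) (.or B A')
  | andL {p : Bool} {A A' : Fml L Sk} (h : AStep δ p A A') (B : Fml L Sk) :
      AStep δ p (.and A B) (.and A' B)
  | andR {p : Bool} {A A' : Fml L Sk} (B : Fml L Sk) (h : AStep δ p A A') :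
      AStep δ p (.and B A) (.and B A')

/-- The connectives passed on the way to the inference are moved into an accessible context, whose
polarity absorbs the negations. -/
theorem AStep.fill {δ : DeltaFn L Sk} {p : Bool} {G G' : Fml L Sk} (h : AStep δ p G G') :
    ∀ C : Ctx L Sk, C.Accessible → C.positive = p → Step δ (C.fill G) (C.fill G') := by
  induction h with
  | simplification p H H' h => rintro C - rfl; exact .simplification C H H' h
  | gamma p x H => rintro C hC rfl; exact .gamma C hC x H
  | delta p y H xs hnd hxs => rintro C hC rfl; exact .delta C hC y H xs hnd hxs
  | neg h ih =>
    intro C hC hp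
    have := ih (C.comp (.neg .hole)) (Ctx.accessible_comp hC trivial)
      (by rw [Ctx.positive_comp, hp]; simp [Ctx.positive])
    simpa only [Ctx.fill_comp, Ctx.fill] using this
  | orL h B ih =>
    intro C hC hp
    have := ih (C.comp (.orL .hole B)) (Ctx.accessible_comp hC trivial)
      (by rw [Ctx.positive_comp, hp]; simp [Ctx.positive])
    simpa only [Ctx.fill_comp, Ctx.fill] using this
  | orR B h ih =>
    intro C hC hp
    have := ih (C.comp (.orR B .hole)) (Ctx.accessible_comp hC trivial)
      (by rw [Ctx.positive_comp, hp]; simp [Ctx.positive])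
    simpa only [Ctx.fill_comp, Ctx.fill] using this
  | andL h B ih =>
    intro C hC hp
    have := ih (C.comp (.andL .hole B)) (Ctx.accessible_comp hC trivial)
      (by rw [Ctx.positive_comp, hp]; simp [Ctx.positive])
    simpa only [Ctx.fill_comp, Ctx.fill] using this
  | andR B h ih =>
    intro C hC hp
    have := ih (C.comp (.andR B .hole)) (Ctx.accessible_comp hC trivial)
      (by rw [Ctx.positive_comp, hp]; simp [Ctx.positive])
    simpa only [Ctx.fill_comp, Ctx.fill] using this

theorem AStep.step {δ : DeltaFn L Sk} {G G' : Fml L Sk} (h : AStep δ true G G') : Step δ G G' :=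
  h.fill .hole trivial rfl

/-- The formula `G` is derivable from the quantifier-free formula `B`. -/
def Red (δ : DeltaFn L Sk) (p : Bool) (G B : Fml L Sk) : Prop :=
  B.QF ∧ Relation.ReflTransGen (AStep δ p) B G

namespace Red

variable {δ : DeltaFn L Sk} {p : Bool}

theorem neg {G B : Fml L Sk} (h : Red δ (!p) G B) : Red δ p (.neg G) (.neg B) :=
  ⟨h.1, h.2.lift Fml.neg fun _ _ => .neg⟩

theorem or {G B G' B' : Fml L Sk} (h : Red δ p G B) (h' : Red δ p G' B') :
    Red δ p (.or G G') (.or B B') :=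
  ⟨⟨h.1, h'.1⟩, (h.2.lift (Fml.or · B') fun _ _ h => .orL h B').trans
    (h'.2.lift (Fml.or G) fun _ _ h => .orR G h)⟩

theorem and {G B G' B' : Fml L Sk} (h : Red δ p G B) (h' : Red δ p G' B') :
    Red δ p (.and G G') (.and B B') :=
  ⟨⟨h.1, h'.1⟩, (h.2.lift (Fml.and · B') fun _ _ h => .andL h B').trans
    (h'.2.lift (Fml.and G) fun _ _ h => .andR G h)⟩

theorem step {G G' B : Fml L Sk} (h : Red δ p G' B) (hs : AStep δ p G' G) : Red δ p G B :=
  ⟨h.1, h.2.tail hs⟩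

/-- Read backwards: simplification splits `G` into itself and a variant, which are then derived
independently. -/
theorem dup {G D B B' : Fml L Sk} (h : Red δ p G B) (hv : Variant G D) (h' : Red δ p D B') :
    Red δ p G (alphaOp p B B') := by
  refine step (G' := alphaOp p G D) ?_ (.simplification p G D hv)
  cases p
  · exact h.and h'
  · exact h.or h'

end Red

/-- An enumeration of the γ-variables of a formula. -/
noncomputable def gammas (G : Fml L Sk) : List ℕ := G.freeVars.toRight.toList

theorem mem_gammas {G : Fml L Sk} {x : ℕ} : x ∈ gammas G ↔ Sum.inr x ∈ G.freeVars := by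
  simp [gammas]

theorem nodup_gammas (G : Fml L Sk) : (gammas G).Nodup := Finset.nodup_toList _

/-- Supplies a filler for the copy that stays behind after each duplication. Its truth value does
not matter; only the absence of γ-variables is tracked, for the case of an empty champ fini. -/
theorem exists_red (δ : DeltaFn L Sk) (p : Bool) (G : Fml L Sk) :
    ∃ B, Red δ p G B ∧ (NoGamma p G → ∀ x, Sum.inr x ∈ B.freeVars → Sum.inr x ∈ G.freeVars) := by
  induction hn : G.size using Nat.strong_induction_on generalizing p G with
  | _ n ih =>
    subst hn
    cases G with
    | rel R ts => exact ⟨.rel R ts, ⟨trivial, .refl⟩, fun _ _ h => h⟩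
    | neg A =>
      obtain ⟨B, hB, h⟩ := ih _ (by simp [Fml.size]) (!p) A rfl
      exact ⟨_, hB.neg, h⟩
    | or A A' =>
      obtain ⟨B, hB, h⟩ := ih _ (by rw [Fml.size]; omega) p A rfl
      obtain ⟨B', hB', h'⟩ := ih _ (by rw [Fml.size]; omega) p A' rfl
      refine ⟨_, hB.or hB', fun hn x hx => ?_⟩
      simp only [Fml.freeVars, Finset.mem_union] at hx ⊢
      exact hx.imp (h hn.1 x) (h' hn.2 x)
    | and A A' =>
      obtain ⟨B, hB, h⟩ := ih _ (by rw [Fml.size]; omega) p A rfl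
      obtain ⟨B', hB', h'⟩ := ih _ (by rw [Fml.size]; omega) p A' rfl
      refine ⟨_, hB.and hB', fun hn x hx => ?_⟩
      simp only [Fml.freeVars, Finset.mem_union] at hx ⊢
      exact hx.imp (h hn.1 x) (h' hn.2 x)
    | quant q x A =>
      rcases eq_gammaQ_or_deltaQ p q with rfl | rfl
      · obtain ⟨B, hB, -⟩ := ih _ (by simp [Fml.size, Fml.size_replace]) p
          (A.replace x (.var (Sum.inr x))) rfl
        exact ⟨B, hB.step (.gamma p x A), fun hn => absurd rfl hn.1⟩
      · obtain ⟨B, hB, h⟩ := ih _ (by simp [Fml.size, Fml.size_replace]) p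
          (A.replace x (deltaTerm δ (.quant (deltaQ p) x A)
            ((gammas (.quant (deltaQ p) x A)).map Sum.inr))) rfl
        refine ⟨B, hB.step (.delta p x A _ (nodup_gammas _) fun _ => mem_gammas), fun hn z hz => ?_⟩
        rcases Fml.of_mem_freeVars_replace (h ((noGamma_subst A p _).2 hn.2) z hz) with h | ⟨h, -⟩
        · simp [Fml.freeVars, h.1]
        · rw [mem_varFinset_deltaTerm] at h
          obtain ⟨z', hz', h'⟩ := List.mem_map.1 h
          cases h'
          exact mem_gammas.1 hz'

/-- One copy per list element. At positive polarity copies are joined by a disjunction, which each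
of them implies; at negative polarity by a conjunction, which implies each of them. -/
theorem exists_red_of_list {δ : DeltaFn L Sk} {p : Bool} {G B₀ : Fml L Sk} (h₀ : Red δ p G B₀)
    {ι : Type*} (Q : ι → Fml L Sk → Prop) (l : List ι)
    (hl : ∀ i ∈ l, ∃ D B, Variant G D ∧ Red δ p D B ∧ Q i B) :
    ∃ B, Red δ p G B ∧ ∀ i ∈ l, ∃ B', Q i B' ∧ ∀ s val,
      PolImp p ((B'.subst s).eval val) ((B.subst s).eval val) := by
  induction l with
  | nil => exact ⟨B₀, h₀, by simp⟩
  | cons i l ih =>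
    obtain ⟨B, hB, h⟩ := ih fun j hj => hl j (.tail _ hj)
    obtain ⟨D, B', hD, hB', hQ⟩ := hl i (.head _)
    refine ⟨_, hB.dup hD hB', fun j hj => ?_⟩
    rcases List.mem_cons.1 hj with rfl | hj
    · refine ⟨B', hQ, fun s val => ?_⟩
      cases p
      · exact And.right
      · exact Or.inr
    · obtain ⟨B'', hQ', h''⟩ := h j hj
      refine ⟨B'', hQ', fun s val => ?_⟩
      have := h'' s val
      cases p
      · exact fun hh => this hh.1
      · exact fun hh => .inl (this hh)

/-! ## Renaming lemmas -/

theorem TmRen.refl {r : Variable → Variable → Prop} {t : Tm L Sk} (h : ∀ v ∈ t.varFinset, r v v) :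
    TmRen r t t := by
  induction t with
  | var v => exact .var (h v (mem_varFinset_var.2 rfl))
  | func f ts ih => exact .func f fun i => ih i fun v hv => h v (mem_varFinset_func.2 ⟨i, hv⟩)

theorem TmRen.eq {t u : Tm L Sk} (h : TmRen Eq t u) : t = u := by
  induction h with
  | var h => rw [h]
  | func f h ih => rw [funext ih]

/-- Renaming of free variables without captures. -/
theorem tmRen_subst {r : Variable → Variable → Prop} {t : Tm L Sk} {s : Variable → Tm L Sk}
    (h : ∀ a ∈ t.varFinset, ∃ b, s a = .var b ∧ r a b) : TmRen r t (t.subst s) := by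
  induction t with
  | var v =>
    obtain ⟨b, hb, hr⟩ := h v (mem_varFinset_var.2 rfl)
    rw [Term.subst, hb]; exact .var hr
  | func f ts ih => exact .func f fun i => ih i fun v hv => h v (mem_varFinset_func.2 ⟨i, hv⟩)

theorem ren_subst (A : Fml L Sk) : ∀ {r : Variable → Variable → Prop} {s : Variable → Tm L Sk},
    (∀ a ∈ A.freeVars, ∃ b, s a = .var b ∧ r a b ∧ ∀ x ∈ A.binders, a ≠ Sum.inl x → b ≠ Sum.inl x) →
    Ren r A (A.subst s) := by
  induction A with
  | rel R ts =>
    exact fun h => .rel R fun i => tmRen_subst fun a ha => by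
      obtain ⟨b, hb, hr, -⟩ := h a (Fml.mem_freeVars_rel.2 ⟨i, ha⟩)
      exact ⟨b, hb, hr⟩
  | neg A ih => exact fun h => .neg (ih h)
  | or A B ihA ihB =>
    intro r s h
    refine .or (ihA fun a ha => ?_) (ihB fun a ha => ?_) <;>
    · obtain ⟨b, hb, hr, hx⟩ := h a (by simp [Fml.freeVars, ha])
      exact ⟨b, hb, hr, fun x hx' => hx x (by simp [Fml.binders, hx'])⟩
  | and A B ihA ihB =>
    intro r s h
    refine .and (ihA fun a ha => ?_) (ihB fun a ha => ?_) <;>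
    · obtain ⟨b, hb, hr, hx⟩ := h a (by simp [Fml.freeVars, ha])
      exact ⟨b, hb, hr, fun x hx' => hx x (by simp [Fml.binders, hx'])⟩
  | quant q x A ih =>
    intro r s h
    refine .quant q x x (ih fun a ha => ?_)
    by_cases hax : a = Sum.inl x
    · subst hax
      exact ⟨Sum.inl x, by simp, .inl ⟨rfl, rfl⟩, fun _ _ h => h⟩
    · obtain ⟨b, hb, hr, hx⟩ := h a (by simp [Fml.freeVars, ha, hax])
      refine ⟨b, by rw [Function.update_of_ne hax, hb],
        .inr ⟨hax, hx x (by simp [Fml.binders]) hax, hr⟩,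
        fun z hz => hx z (by simp [Fml.binders, hz])⟩

theorem Variant.refl (A : Fml L Sk) : Variant A A := by
  have : Ren Eq A (A.subst Term.var) := ren_subst A fun a _ => ⟨a, rfl, rfl, fun _ _ h => h⟩
  rwa [Fml.subst_var] at this

/-- Renaming of an outermost quantifier. -/
theorem variant_rename (q : Quantifier) {x z : ℕ} {H : Fml L Sk} (hz : z ∉ H.binders)
    (hz' : Sum.inl z ∉ H.freeVars) :
    Variant (.quant q x H) (.quant q z (H.replace x (.var (Sum.inl z)))) := by
  refine .quant q x z (ren_subst H fun a ha => ?_)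
  by_cases hax : a = Sum.inl x
  · subst hax
    exact ⟨Sum.inl z, by simp, .inl ⟨rfl, rfl⟩, fun y hy _ h => hz (by cases h; exact hy)⟩
  · exact ⟨a, by rw [Function.update_of_ne hax],
      .inr ⟨hax, fun h => hz' (h ▸ ha), rfl⟩, fun _ _ h => h⟩

/-- After renaming the bound variable to a fresh `z`, the instances of the quantified formula are
the old ones. -/
theorem replace_replace {x z : ℕ} {H : Fml L Sk} (hz : z ∉ H.binders)
    (hz' : Sum.inl z ∉ H.freeVars) (t : Tm L Sk) :
    (H.replace x (.var (Sum.inl z))).replace z t = H.replace x t := by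
  rw [Fml.replace, Fml.replace, Fml.subst_subst]
  · refine Fml.subst_congr fun v hv => ?_
    by_cases hvx : v = Sum.inl x
    · subst hvx; simp [Term.subst]
    · rw [Function.update_of_ne hvx, Function.update_of_ne hvx, Term.subst,
        Function.update_of_ne (by rintro rfl; exact hz' hv)]
  · intro v _
    by_cases hvx : v = Sum.inl x
    · subst hvx
      rw [Function.update_self]
      refine .inr fun y hy h => ?_
      rw [mem_varFinset_var] at h
      cases h; exact hz hy
    · rw [Function.update_of_ne hvx]; exact .inl rfl

theorem TmRen.subst {r r' : Variable → Variable → Prop} {t u : Tm L Sk} (h : TmRen r t u)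
    {s s' : Variable → Tm L Sk} (hs : ∀ a b, r a b → TmRen r' (s a) (s' b)) :
    TmRen r' (t.subst s) (u.subst s') := by
  induction h with
  | var h => exact hs _ _ h
  | func f h ih => exact .func f ih

/-- Related variables are either left alone on both sides or replaced by one and the same term of
γ-variables; such terms cannot be captured, since γ-variables are never bound. -/
theorem Ren.subst {r : Variable → Variable → Prop} {A B : Fml L Sk} (h : Ren r A B) :
    ∀ {r' : Variable → Variable → Prop} {s s' : Variable → Tm L Sk}, (∀ z, r' (.inr z) (.inr z)) →
    (∀ a b, r a b → (s a = .var a ∧ s' b = .var b ∧ r' a b) ∨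
      (s a = s' b ∧ ∀ v ∈ (s a).varFinset, v.isRight)) →
    Ren r' (A.subst s) (B.subst s') := by
  induction h with
  | rel R h =>
    intro r' s s' hr' hs
    refine .rel R fun i => (h i).subst fun a b hab => ?_
    rcases hs a b hab with ⟨h1, h2, h3⟩ | ⟨h1, h2⟩
    · rw [h1, h2]; exact .var h3
    · rw [← h1]
      refine .refl fun v hv => ?_
      obtain ⟨z, rfl⟩ := Sum.isRight_iff.1 (h2 v hv)
      exact hr' z
  | neg h ih => exact fun hr' hs => .neg (ih hr' hs)
  | or hA hB ihA ihB => exact fun hr' hs => .or (ihA hr' hs) (ihB hr' hs)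
  | and hA hB ihA ihB => exact fun hr' hs => .and (ihA hr' hs) (ihB hr' hs)
  | quant q x y h ih =>
    intro r' s s' hr' hs
    refine .quant q x y (ih (fun z => .inr ⟨by simp, by simp, hr' z⟩) fun a b hab => ?_)
    rcases hab with ⟨rfl, rfl⟩ | ⟨ha, hb, hab⟩
    · exact .inl ⟨by simp, by simp, .inl ⟨rfl, rfl⟩⟩
    · rw [Function.update_of_ne ha, Function.update_of_ne hb]
      rcases hs a b hab with ⟨h1, h2, h3⟩ | h
      · exact .inl ⟨h1, h2, .inr ⟨ha, hb, h3⟩⟩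
      · exact .inr h

theorem Ren.replace {x y : ℕ} {A B : Fml L Sk} (h : Ren (bindRel Eq x y) A B) {t : Tm L Sk}
    (ht : ∀ v ∈ t.varFinset, v.isRight) : Variant (A.replace x t) (B.replace y t) := by
  refine Ren.subst h (fun _ => rfl) fun a b hab => ?_
  rcases hab with ⟨rfl, rfl⟩ | ⟨ha, hb, rfl⟩
  · exact .inr ⟨by simp, by simpa using ht⟩
  · rw [Function.update_of_ne ha, Function.update_of_ne hb]
    exact .inl ⟨rfl, rfl, rfl⟩

/-! ## Canonical variants -/

open Classical in
/-- A variant without bound variables in `Z`, the same for all variants of the formula. -/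
noncomputable def canonical (Z : Set ℕ) (G : Fml L Sk) : Fml L Sk :=
  @Classical.epsilon _ ⟨G⟩ fun G' => Variant G G' ∧ ∀ x ∈ G'.binders, x ∉ Z

theorem canonical_spec {Z : Set ℕ} {G : Fml L Sk} (h : ∀ x ∈ G.binders, x ∉ Z) :
    Variant G (canonical Z G) ∧ ∀ x ∈ (canonical Z G).binders, x ∉ Z :=
  Classical.epsilon_spec (p := fun G' => Variant G G' ∧ ∀ x ∈ G'.binders, x ∉ Z)
    ⟨G, Variant.refl G, h⟩

/-- The defining predicate is the same for all variants, so the choice operator returns the same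
formula, even if the specification cannot be met. -/
theorem canonical_eq {Z : Set ℕ} {G G' : Fml L Sk} (h : Variant G G') :
    canonical Z G = canonical Z G' := by
  have : (fun K : Fml L Sk => Variant G K ∧ ∀ x ∈ K.binders, x ∉ Z) =
      fun K => Variant G' K ∧ ∀ x ∈ K.binders, x ∉ Z := by
    funext K
    exact propext (and_congr_left fun _ => ⟨h.symm.trans, h.trans⟩)
  simp only [canonical, this]


/-! ## Translation of Skolemized forms into the calculus -/

section Translation

variable (zz : Tm L Sk → ℕ)

/-- The substitution given by a partial assignment. -/
def envSubst (env : Variable → Option (Tm L Sk)) (v : Variable) : Tm L Sk := (env v).getD (.var v)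

/-- Translation of terms: a variable with value `t` becomes the γ-variable for `t`, a Skolem term is
translated according to the values of its arguments. -/
def trTm (M : Interp L Sk) (env : Variable → Option (Tm L Sk)) : Tm L Sk → Tm L Sk
  | .var v =>
      match env v with
      | some t => .var (Sum.inr (zz t))
      | none => .var v
  | .func f ts =>
      match FunSym.sk? f with
      | some s => M s (List.ofFn fun i => (ts i).subst (envSubst env))
      | none => .func f fun i => trTm M env (ts i)

/-- Translation of formulas. -/
def tr (M : Interp L Sk) : (Variable → Option (Tm L Sk)) → Fml L Sk → Fml L Sk
  | env, .rel R ts => .rel R fun i => trTm zz M env (ts i)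
  | env, .neg A => .neg (tr M env A)
  | env, .or A B => .or (tr M env A) (tr M env B)
  | env, .and A B => .and (tr M env A) (tr M env B)
  | env, .quant q x A => .quant q x (tr M (Function.update env (Sum.inl x) none) A)

/-- The values of a function are terms with a single function symbol, whose variables are among the
γ-variables for the arguments. -/
def Shallow (s : Σ m, Sk m) (φ : List (Tm L Sk) → Tm L Sk) : Prop :=
  ∀ ts, ts.length = s.1 → (∀ v ∈ (φ ts).varFinset, ∃ t ∈ ts, v = Sum.inr (zz t)) ∧
    ∃ (m : ℕ) (f : FunSym L Sk m) (vs : Fin m → Variable),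
      φ ts = Term.func (L := extLang L Sk) f fun i => .var (vs i)

variable {zz}

theorem binders_tr (M : Interp L Sk) (A : Fml L Sk) : ∀ env, (tr zz M env A).binders = A.binders := by
  induction A with
  | rel R ts => exact fun _ => rfl
  | neg A ih => exact ih
  | or A B ihA ihB => exact fun env => by simp only [tr, Fml.binders, ihA, ihB]
  | and A B ihA ihB => exact fun env => by simp only [tr, Fml.binders, ihA, ihB]
  | quant q x A ih => exact fun env => by simp only [tr, Fml.binders, ih]

theorem noGamma_tr (M : Interp L Sk) (A : Fml L Sk) : ∀ (p : Bool) env,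
    NoGamma p (tr zz M env A) ↔ NoGamma p A := by
  induction A with
  | rel R ts => exact fun _ _ => Iff.rfl
  | neg A ih => exact fun p env => ih _ env
  | or A B ihA ihB => exact fun p env => and_congr (ihA p env) (ihB p env)
  | and A B ihA ihB => exact fun p env => and_congr (ihA p env) (ihB p env)
  | quant q x A ih => exact fun p env => and_congr Iff.rfl (ih p _)

theorem trTm_congr {M M' : Interp L Sk} {env env' : Variable → Option (Tm L Sk)} {t : Tm L Sk}
    (hM : ∀ s, skSym L s ∈ tmSyms t → M s = M' s) (he : ∀ v ∈ t.varFinset, env v = env' v) :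
    trTm zz M env t = trTm zz M' env' t := by
  induction t with
  | var v => simp only [trTm, he v (mem_varFinset_var.2 rfl)]
  | @func m f ts ih =>
    have hv := fun i v hv => he v (mem_varFinset_func.2 ⟨i, hv⟩)
    have h1 := fun i => ih i (fun s hs => hM s (.inr (Set.mem_iUnion.2 ⟨i, hs⟩))) (hv i)
    have h2 : ∀ i, (ts i).subst (envSubst env) = (ts i).subst (envSubst env') := fun i =>
      tmSubst_congr fun v h => by simp only [envSubst, hv i v h]
    simp only [trTm, h1, h2]
    cases hf : FunSym.sk? f with
    | none => rfl
    | some s => simp only [hM s (.inl (sk?_eq_some.1 hf).symm)]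

theorem tr_congr {M M' : Interp L Sk} {A : Fml L Sk} (hM : ∀ s, skSym L s ∈ A.syms → M s = M' s) :
    ∀ {env env' : Variable → Option (Tm L Sk)}, (∀ v ∈ A.freeVars, env v = env' v) →
      tr zz M env A = tr zz M' env' A := by
  induction A with
  | rel R ts =>
    intro env env' he
    simp only [tr]
    congr 1
    funext i
    exact trTm_congr (fun s hs => hM s (Set.mem_iUnion.2 ⟨i, hs⟩))
      fun v hv => he v (Fml.mem_freeVars_rel.2 ⟨i, hv⟩)
  | neg A ih => intro env env' he; simp only [tr, ih hM he]
  | or A B ihA ihB =>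
    intro env env' he
    simp only [Fml.freeVars, Finset.mem_union] at he
    simp only [tr, ihA (fun s hs => hM s (.inl hs)) fun v hv => he v (.inl hv),
      ihB (fun s hs => hM s (.inr hs)) fun v hv => he v (.inr hv)]
  | and A B ihA ihB =>
    intro env env' he
    simp only [Fml.freeVars, Finset.mem_union] at he
    simp only [tr, ihA (fun s hs => hM s (.inl hs)) fun v hv => he v (.inl hv),
      ihB (fun s hs => hM s (.inr hs)) fun v hv => he v (.inr hv)]
  | quant q x A ih =>
    intro env env' he
    simp only [tr]
    rw [ih hM fun v hv => ?_]
    by_cases hvx : v = Sum.inl x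
    · subst hvx; simp
    · rw [Function.update_of_ne hvx, Function.update_of_ne hvx]
      exact he v (by simp [Fml.freeVars, hv, hvx])

theorem sk?_args {P : Variable → Prop} {m : ℕ} {f : FunSym L Sk m} {ts : Fin m → Tm L Sk}
    {s : Σ m, Sk m} (hf : f.sk? = some s)
    (hflat : TmFlat P (Term.func (L := extLang L Sk) f ts))
    {env : Variable → Option (Tm L Sk)} (hP : ∀ v, P v → (env v).isSome) :
    (List.ofFn fun i => (ts i).subst (envSubst env)).length = s.1 ∧
    ∀ t ∈ List.ofFn fun i => (ts i).subst (envSubst env),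
      ∃ v ∈ (Term.func (L := extLang L Sk) f ts).varFinset, env v = some t := by
  have hm : s.1 = m := (congrArg Sigma.fst (sk?_eq_some.1 hf)).symm
  refine ⟨by simp [hm], fun t ht => ?_⟩
  obtain ⟨i, rfl⟩ := (List.mem_ofFn' _ _).1 ht
  obtain ⟨v, hv, hPv⟩ := hflat.2 (by rw [hf]; rfl) i
  obtain ⟨t, ht⟩ := Option.isSome_iff_exists.1 (hP v hPv)
  refine ⟨v, mem_varFinset_func.2 ⟨i, by rw [hv, mem_varFinset_var]⟩, ?_⟩
  simp [hv, Term.subst, envSubst, ht]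

theorem isRight_of_shallow {M : Interp L Sk} (hM : ∀ s, Shallow zz s (M s)) {s : Σ m, Sk m}
    {ts : List (Tm L Sk)} (h : ts.length = s.1) : ∀ v ∈ (M s ts).varFinset, v.isRight := by
  intro v hv
  obtain ⟨t, -, rfl⟩ := (hM s ts h).1 v hv
  rfl

theorem trTm_ren {M : Interp L Sk} (hM : ∀ s, Shallow zz s (M s)) {r : Variable → Variable → Prop}
    {t u : Tm L Sk} (h : TmRen r t u) {r' : Variable → Variable → Prop}
    {env env' : Variable → Option (Tm L Sk)} (hr' : ∀ z, r' (.inr z) (.inr z)) {P : Variable → Prop}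
    (hP : ∀ v, P v → (env v).isSome) (ht : TmFlat P t)
    (hr : ∀ a b, r a b → (env a = env' b ∧ (env a).isSome) ∨
      (env a = none ∧ env' b = none ∧ r' a b)) :
    TmRen r' (trTm zz M env t) (trTm zz M env' u) := by
  induction h with
  | @var a b h =>
    rcases hr a b h with ⟨h1, h2⟩ | ⟨h1, h2, h3⟩
    · obtain ⟨t, h2⟩ := Option.isSome_iff_exists.1 h2
      simp only [trTm, ← h1, h2]; exact .var (hr' _)
    · simp only [trTm, h1, h2]; exact .var h3
  | @func m f ts us h ih =>
    simp only [trTm]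
    cases hf : FunSym.sk? f with
    | none => exact .func f fun i => ih i (ht.1 i)
    | some s =>
      have : ∀ i, (us i).subst (envSubst env') = (ts i).subst (envSubst env) := fun i => by
        obtain ⟨v, hv, hPv⟩ := ht.2 (by rw [hf]; rfl) i
        obtain ⟨b, hb, hrb⟩ := TmRen.eq_var (hv ▸ h i)
        rw [hv, hb]
        rcases hr v b hrb with ⟨h1, -⟩ | ⟨h1, -⟩
        · obtain ⟨t, ht⟩ := Option.isSome_iff_exists.1 (hP v hPv)
          simp [Term.subst, envSubst, ← h1, ht]
        · have := hP v hPv; simp [h1] at this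
      simp only [this]
      refine .refl fun v hv => ?_
      obtain ⟨z, rfl⟩ := Sum.isRight_iff.1 (isRight_of_shallow hM (sk?_args hf ht hP).1 v hv)
      exact hr' z

/-- Translations of formulas that agree up to a renaming of the assigned variables are variants of
each other. Flatness guarantees that arguments of Skolem symbols are assigned variables, so
corresponding Skolem terms have identical translations. -/
theorem tr_ren {M : Interp L Sk} (hM : ∀ s, Shallow zz s (M s)) {r : Variable → Variable → Prop}
    {A B : Fml L Sk} (h : Ren r A B) : ∀ {r' : Variable → Variable → Prop}
    {env env' : Variable → Option (Tm L Sk)} {P : Variable → Prop}, (∀ z, r' (.inr z) (.inr z)) →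
    (∀ v, P v → (env v).isSome) → A.Flat P →
    (∀ a b, r a b → (env a = env' b ∧ (env a).isSome) ∨
      (env a = none ∧ env' b = none ∧ r' a b)) →
    Ren r' (tr zz M env A) (tr zz M env' B) := by
  induction h with
  | rel R h => exact fun hr' hP hA hr => .rel R fun i => trTm_ren hM (h i) hr' hP (hA i) hr
  | neg h ih => exact fun hr' hP hA hr => .neg (ih hr' hP hA hr)
  | or _ _ ihA ihB => exact fun hr' hP hA hr => .or (ihA hr' hP hA.1 hr) (ihB hr' hP hA.2 hr)
  | and _ _ ihA ihB => exact fun hr' hP hA hr => .and (ihA hr' hP hA.1 hr) (ihB hr' hP hA.2 hr)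
  | quant q x y h ih =>
    intro r' env env' P hr' hP hA hr
    refine .quant q x y (ih (P := P) (fun z => .inr ⟨by simp, by simp, hr' z⟩) (fun v hv => ?_) hA.1
      fun a b hab => ?_)
    · rw [Function.update_of_ne (by rintro rfl; exact hA.2 hv)]
      exact hP v hv
    · rcases hab with ⟨rfl, rfl⟩ | ⟨ha, hb, hab⟩
      · exact .inr ⟨by simp, by simp, .inl ⟨rfl, rfl⟩⟩
      · rw [Function.update_of_ne ha, Function.update_of_ne hb]
        exact (hr a b hab).imp_right fun h => ⟨h.1, h.2.1, .inr ⟨ha, hb, h.2.2⟩⟩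

theorem trTm_subst {M : Interp L Sk} (hM : ∀ s, Shallow zz s (M s))
    {env env' : Variable → Option (Tm L Sk)} {P : Variable → Prop} {s s' : Variable → Tm L Sk}
    {t : Tm L Sk} (ht : TmFlat P t) (hs' : ∀ z, s' (.inr z) = .var (.inr z))
    (hP : ∀ v, P v → s v = .var v ∧ env v = env' v ∧ (env v).isSome)
    (hs : ∀ v ∈ t.varFinset, trTm zz M env (s v) = (trTm zz M env' (.var v)).subst s') :
    trTm zz M env (t.subst s) = (trTm zz M env' t).subst s' := by
  induction t with
  | var v => exact hs v (mem_varFinset_var.2 rfl)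
  | @func m f ts ih =>
    have ih' := fun i => ih i (ht.1 i) fun v hv => hs v (mem_varFinset_func.2 ⟨i, hv⟩)
    simp only [Term.subst, trTm]
    cases hf : FunSym.sk? f with
    | none => simp only [ih', Term.subst]
    | some σ =>
      have : ∀ i, ((ts i).subst s).subst (envSubst env) = (ts i).subst (envSubst env') :=
        fun i => by
          obtain ⟨v, hv, hPv⟩ := ht.2 (by rw [hf]; rfl) i
          rw [hv]
          simp [Term.subst, (hP v hPv).1, envSubst, (hP v hPv).2.1]
      simp only [this]
      refine (tmSubst_eq_self fun v hv => ?_).symm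
      obtain ⟨z, rfl⟩ := Sum.isRight_iff.1 (isRight_of_shallow hM
        (sk?_args hf ht fun v hv => (hP v hv).2.1 ▸ (hP v hv).2.2).1 v hv)
      exact hs' z

/-- Translation commutes with inserting a term for a quantified variable. Variables that may be
arguments of Skolem symbols are left alone by `s`, and `s'` fixes the γ-variables in translated
Skolem terms. -/
theorem tr_subst {M : Interp L Sk} (hM : ∀ s, Shallow zz s (M s)) (A : Fml L Sk) :
    ∀ {env env' : Variable → Option (Tm L Sk)} {P : Variable → Prop} {s s' : Variable → Tm L Sk},
    A.Flat P → (∀ z, s' (.inr z) = .var (.inr z)) →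
    (∀ v, P v → s v = .var v ∧ env v = env' v ∧ (env v).isSome) →
    (∀ v ∈ A.freeVars, s v = .var v ∨ ∀ x ∈ A.binders, Sum.inl x ∉ (s v).varFinset) →
    (∀ v ∈ A.freeVars, trTm zz M env (s v) = (trTm zz M env' (.var v)).subst s') →
    tr zz M env (A.subst s) = (tr zz M env' A).subst s' := by
  induction A with
  | rel R ts =>
    intro env env' P s s' hA hs' hP _ hs
    simp only [Fml.subst, tr]
    congr 1
    funext i
    exact trTm_subst hM (hA i) hs' hP fun v hv => hs v (Fml.mem_freeVars_rel.2 ⟨i, hv⟩)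
  | neg A ih => intro env env' P s s' hA hs' hP hb hs; simp only [Fml.subst, tr, ih hA hs' hP hb hs]
  | or A B ihA ihB =>
    intro env env' P s s' hA hs' hP hb hs
    simp only [Fml.freeVars, Finset.mem_union, Fml.binders, List.mem_append] at hb hs
    simp only [Fml.subst, tr]
    rw [ihA hA.1 hs' hP (fun v hv => (hb v (.inl hv)).imp_right fun h x hx => h x (.inl hx))
        fun v hv => hs v (.inl hv),
      ihB hA.2 hs' hP (fun v hv => (hb v (.inr hv)).imp_right fun h x hx => h x (.inr hx))
        fun v hv => hs v (.inr hv)]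
  | and A B ihA ihB =>
    intro env env' P s s' hA hs' hP hb hs
    simp only [Fml.freeVars, Finset.mem_union, Fml.binders, List.mem_append] at hb hs
    simp only [Fml.subst, tr]
    rw [ihA hA.1 hs' hP (fun v hv => (hb v (.inl hv)).imp_right fun h x hx => h x (.inl hx))
        fun v hv => hs v (.inl hv),
      ihB hA.2 hs' hP (fun v hv => (hb v (.inr hv)).imp_right fun h x hx => h x (.inr hx))
        fun v hv => hs v (.inr hv)]
  | quant q x A ih =>
    intro env env' P s s' hA hs' hP hb hs
    simp only [Fml.freeVars, Finset.mem_erase, Fml.binders, List.mem_cons] at hb hs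
    simp only [Fml.subst, tr]
    have hs₂ : ∀ z, Function.update s' (Sum.inl x) (.var (Sum.inl x)) (.inr z) = .var (.inr z) :=
      fun z => by rw [Function.update_of_ne (by simp)]; exact hs' z
    rw [ih (P := P) hA.1 hs₂ (fun v hv => ?_) (fun v hv => ?_) fun v hv => ?_]
    · have hvx : v ≠ Sum.inl x := by rintro rfl; exact hA.2 hv
      simp only [Function.update_of_ne hvx]
      exact hP v hv
    · by_cases hvx : v = Sum.inl x
      · subst hvx; simp
      · rw [Function.update_of_ne hvx]
        exact (hb v ⟨hvx, hv⟩).imp_right fun h y hy => h y (.inr hy)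
    · by_cases hvx : v = Sum.inl x
      · subst hvx; simp [trTm, Term.subst]
      · have h1 : trTm zz M (Function.update env (Sum.inl x) none) (s v) = trTm zz M env (s v) := by
          refine trTm_congr (fun _ _ => rfl) fun w hw => Function.update_of_ne ?_ _ _
          rintro rfl
          rcases hb v ⟨hvx, hv⟩ with h | h
          · rw [h, mem_varFinset_var] at hw; exact hvx hw.symm
          · exact h x (.inl rfl) hw
        rw [Function.update_of_ne hvx, h1, hs v ⟨hvx, hv⟩]
        simp only [trTm, Function.update_of_ne hvx]
        cases env' v with
        | none => simp [Term.subst, Function.update_of_ne hvx]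
        | some t => simp [Term.subst]

theorem mem_varFinset_trTm {M : Interp L Sk} (hM : ∀ s, Shallow zz s (M s))
    {env : Variable → Option (Tm L Sk)} {P : Variable → Prop} (hP : ∀ v, P v → (env v).isSome)
    {t : Tm L Sk} (ht : TmFlat P t) {v : Variable} (hv : v ∈ (trTm zz M env t).varFinset) :
    (v ∈ t.varFinset ∧ env v = none) ∨
      ∃ a ∈ t.varFinset, ∃ u, env a = some u ∧ v = Sum.inr (zz u) := by
  induction t with
  | var w =>
    simp only [trTm] at hv
    cases hw : env w with
    | none =>
      simp only [hw, mem_varFinset_var] at hv; subst hv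
      exact .inl ⟨mem_varFinset_var.2 rfl, hw⟩
    | some t =>
      simp only [hw, mem_varFinset_var] at hv
      exact .inr ⟨w, mem_varFinset_var.2 rfl, t, hw, hv⟩
  | @func m f ts ih =>
    simp only [trTm] at hv
    cases hf : FunSym.sk? f with
    | none =>
      simp only [hf] at hv
      obtain ⟨i, hi⟩ := mem_varFinset_func.1 hv
      rcases ih i (ht.1 i) hi with h | ⟨a, ha, h⟩
      · exact .inl ⟨mem_varFinset_func.2 ⟨i, h.1⟩, h.2⟩
      · exact .inr ⟨a, mem_varFinset_func.2 ⟨i, ha⟩, h⟩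
    | some s =>
      simp only [hf] at hv
      obtain ⟨h1, h2⟩ := sk?_args hf ht hP
      obtain ⟨t, ht, rfl⟩ := (hM s _ h1).1 v hv
      obtain ⟨a, ha, h⟩ := h2 t ht
      exact .inr ⟨a, ha, t, h, rfl⟩

theorem mem_freeVars_tr {M : Interp L Sk} (hM : ∀ s, Shallow zz s (M s)) (A : Fml L Sk) :
    ∀ {env : Variable → Option (Tm L Sk)} {P : Variable → Prop}, (∀ v, P v → (env v).isSome) →
    A.Flat P → ∀ {v : Variable}, v ∈ (tr zz M env A).freeVars →
    (v ∈ A.freeVars ∧ env v = none) ∨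
      ∃ a ∈ A.freeVars, ∃ u, env a = some u ∧ v = Sum.inr (zz u) := by
  induction A with
  | rel R ts =>
    intro env P hP hA v hv
    obtain ⟨i, hi⟩ := Fml.mem_freeVars_rel.1 hv
    rcases mem_varFinset_trTm hM hP (hA i) hi with h | ⟨a, ha, h⟩
    · exact .inl ⟨Fml.mem_freeVars_rel.2 ⟨i, h.1⟩, h.2⟩
    · exact .inr ⟨a, Fml.mem_freeVars_rel.2 ⟨i, ha⟩, h⟩
  | neg A ih => exact ih
  | or A B ihA ihB =>
    intro env P hP hA v hv
    simp only [tr, Fml.freeVars, Finset.mem_union] at hv ⊢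
    rcases hv with hv | hv
    · rcases ihA hP hA.1 hv with h | ⟨a, ha, h⟩
      · exact .inl ⟨.inl h.1, h.2⟩
      · exact .inr ⟨a, .inl ha, h⟩
    · rcases ihB hP hA.2 hv with h | ⟨a, ha, h⟩
      · exact .inl ⟨.inr h.1, h.2⟩
      · exact .inr ⟨a, .inr ha, h⟩
  | and A B ihA ihB =>
    intro env P hP hA v hv
    simp only [tr, Fml.freeVars, Finset.mem_union] at hv ⊢
    rcases hv with hv | hv
    · rcases ihA hP hA.1 hv with h | ⟨a, ha, h⟩
      · exact .inl ⟨.inl h.1, h.2⟩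
      · exact .inr ⟨a, .inl ha, h⟩
    · rcases ihB hP hA.2 hv with h | ⟨a, ha, h⟩
      · exact .inl ⟨.inr h.1, h.2⟩
      · exact .inr ⟨a, .inr ha, h⟩
  | quant q x A ih =>
    intro env P hP hA v hv
    simp only [tr, Fml.freeVars, Finset.mem_erase] at hv ⊢
    rcases ih (P := P) (fun v hv => by
      rw [Function.update_of_ne (by rintro rfl; exact hA.2 hv)]; exact hP v hv) hA.1 hv.2 with
      ⟨h, h'⟩ | ⟨a, ha, u, hu, h⟩
    · rw [Function.update_of_ne hv.1] at h'
      exact .inl ⟨⟨hv.1, h⟩, h'⟩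
    · have hax : a ≠ Sum.inl x := by rintro rfl; simp at hu
      rw [Function.update_of_ne hax] at hu
      exact .inr ⟨a, ⟨hax, ha⟩, u, hu, h⟩

/-! ### The function symbols of the calculus -/

/-- The partial assignment of `ts` to `ys`. -/
def envOf (ys : List Variable) (ts : List (Tm L Sk)) (v : Variable) : Option (Tm L Sk) :=
  ts[ys.idxOf v]?

theorem envOf_map {ys : List Variable} (g : Variable → Tm L Sk) {v : Variable} (hv : v ∈ ys) :
    envOf ys (ys.map g) v = some (g v) := by
  have hlt : ys.idxOf v < ys.length := List.idxOf_lt_length_iff.2 hv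
  simp [envOf, hlt]

theorem envOf_isSome {ys : List Variable} {ts : List (Tm L Sk)} (h : ts.length = ys.length)
    {v : Variable} (hv : v ∈ ys) : (envOf ys ts v).isSome := by
  have hlt : ys.idxOf v < ts.length := h ▸ List.idxOf_lt_length_iff.2 hv
  simp [envOf, hlt]

theorem envOf_of_notMem {ys : List Variable} {ts : List (Tm L Sk)} (h : ts.length = ys.length)
    {v : Variable} (hv : v ∉ ys) : envOf ys ts v = none := by
  simp [envOf, List.idxOf_eq_length hv, h]

/-- The arguments of `δ` in Skolemized forms. -/
def IsSkolemArg (Z : Set ℕ) (C : Fml L Sk) (ys : List Variable) : Prop :=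
  (C.Flat (· ∈ ys)) ∧ (∀ x ∈ C.binders, x ∉ Z) ∧ ∀ z, Sum.inr z ∉ C.freeVars

variable (zz) in
/-- An interpretation maps Skolem terms of the Skolemized form to Skolem terms of the calculus. -/
def Translates (δ : DeltaFn L Sk) (Z : Set ℕ) (M : Interp L Sk)
    (l : List (Fml L Sk × List Variable)) : Prop :=
  ∀ e ∈ l, ∀ ts : List (Tm L Sk), ts.length = e.2.length → M (δ.sym e.1 e.2) ts =
    deltaTerm δ (canonical Z (tr zz M (envOf e.2 ts) e.1))
      ((gammas (canonical Z (tr zz M (envOf e.2 ts) e.1))).map Sum.inr)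

/-- The same recursion scheme as for worst values. A Skolem symbol applied to terms goes to the
Skolem term that the δ-rule attaches to the translated formula; taking a canonical variant makes
this independent of the formula behind the symbol. -/
theorem exists_translates {δ : DeltaFn L Sk} (hδ : δ.Admissible) {Z : Set ℕ}
    {l : List (Fml L Sk × List Variable)} (hl : Layered δ (IsSkolemArg Z) l) :
    ∃ M : Interp L Sk, (∀ s, Shallow zz s (M s)) ∧ Translates zz δ Z M l := by
  refine exists_interp hδ (fun M C ys ts => deltaTerm δ (canonical Z (tr zz M (envOf ys ts) C))
    ((gammas (canonical Z (tr zz M (envOf ys ts) C))).map Sum.inr)) (Shallow zz)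
    (fun _ => Term.func (L := extLang L Sk) (FunSym.bullet : FunSym L Sk 0) Fin.elim0) ?_ ?_ ?_ ?_
    l hl
  -- Symbols outside the list are sent to `•`, which is shallow without any variables.
  · intro s ts _
    refine ⟨fun v hv => ?_, 0, .bullet, Fin.elim0, ?_⟩
    · obtain ⟨i, -⟩ := mem_varFinset_func.1 hv
      exact i.elim0
    · exact congrArg (Term.func _) (funext fun i => i.elim0)
  · intro M C ys hM hV hn hf ts hts
    refine ⟨fun v hv => ?_, _, _, _, rfl⟩
    rw [mem_varFinset_deltaTerm] at hv
    obtain ⟨z, hz, rfl⟩ := List.mem_map.1 hv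
    rw [mem_gammas, ← (canonical_spec (by rw [binders_tr]; exact hV.2.1)).1.mem_freeVars] at hz
    rcases mem_freeVars_tr hM C (fun v hv => envOf_isSome hts hv) hV.1 hz with
      ⟨h, -⟩ | ⟨a, -, u, hu, h⟩
    · exact absurd h (hV.2.2 z)
    · exact ⟨u, List.mem_of_getElem? hu, h⟩
  · intro M M' C ys h
    funext ts
    rw [tr_congr h fun _ _ => rfl]
  · intro M C ys C' ys' hM hV hV' hn hn' hlen hren ts hts
    -- Corresponding variables have equal indices and hence equal values, so they vanish from the
    -- translations; other free variables agree.
    have : Variant (tr zz M (envOf ys ts) C) (tr zz M (envOf ys' ts) C') := by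
      refine tr_ren hM hren (fun _ => rfl) (fun v hv => envOf_isSome hts hv) hV.1 fun a b hab => ?_
      rcases hab with ⟨i, ha, hb⟩ | ⟨ha, hb, rfl⟩
      · obtain ⟨hi, rfl⟩ := List.getElem?_eq_some_iff.1 ha
        obtain ⟨hi', rfl⟩ := List.getElem?_eq_some_iff.1 hb
        refine .inl ⟨?_, envOf_isSome hts (List.getElem_mem hi)⟩
        simp [envOf, hn.idxOf_getElem, hn'.idxOf_getElem]
      · exact .inr ⟨envOf_of_notMem hts ha, envOf_of_notMem (hts.trans hlen) hb, rfl⟩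
    rw [canonical_eq this]

/-! ### Translation of closed terms -/

open Classical in
variable (zz) in
/-- The term of the calculus that corresponds to a closed term of the Skolemized form. -/
noncomputable def trClosed (M : Interp L Sk) : Tm L Sk → Tm L Sk
  | .var v => .var v
  | .func f ts =>
      match FunSym.sk? f with
      | some s => (M s (List.ofFn ts)).subst fun v =>
          if h : ∃ i, v = Sum.inr (zz (ts i)) then trClosed M (ts h.choose) else .var v
      | none => .func f fun i => trClosed M (ts i)

/-- A shallow term is one symbol applied to γ-variables, each of which stands for an argument.
Inserting the translated arguments gives at most one more than their largest height. -/
theorem height_trClosed {M : Interp L Sk} (hM : ∀ s, Shallow zz s (M s)) (t : Tm L Sk) :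
    height (trClosed zz M t) ≤ height t := by
  induction t with
  | var v => exact le_rfl
  | @func m f ts ih =>
    simp only [trClosed]
    cases hf : FunSym.sk? f with
    | none =>
      simp only [height]
      exact Nat.add_le_add_left (Finset.sup_mono_fun fun i _ => ih i) 1
    | some s =>
      have := sk?_eq_some.1 hf
      cases this
      obtain ⟨h1, m, g, vs, h2⟩ := hM s (List.ofFn ts) (by simp)
      simp only [h2] at h1 ⊢
      simp only [Term.subst, height]
      refine Nat.add_le_add_left (Finset.sup_le fun i _ => ?_) 1
      obtain ⟨t, ht, hv⟩ := h1 (vs i) (mem_varFinset_func.2 ⟨i, mem_varFinset_var.2 rfl⟩)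
      obtain ⟨j, rfl⟩ := (List.mem_ofFn' _ _).1 ht
      have hex : ∃ j, vs i = Sum.inr (zz (ts j)) := ⟨j, hv⟩
      rw [dif_pos hex]
      exact (ih _).trans (Finset.le_sup (f := fun i => height (ts i)) (Finset.mem_univ _))

open Classical in
variable (zz) in
/-- The substitution for the γ-variables. -/
noncomputable def gammaSubst (M : Interp L Sk) (T : Set (Tm L Sk)) (t₀ : Tm L Sk) (z : ℕ) :
    Tm L Sk :=
  if h : ∃ t ∈ T, z = zz t then trClosed zz M h.choose else trClosed zz M t₀

theorem gammaSubst_eq {M : Interp L Sk} {T : Set (Tm L Sk)} {t₀ : Tm L Sk} (hz : T.InjOn zz)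
    {t : Tm L Sk} (ht : t ∈ T) : gammaSubst zz M T t₀ (zz t) = trClosed zz M t := by
  have h : ∃ u ∈ T, zz t = zz u := ⟨t, ht, rfl⟩
  rw [gammaSubst, dif_pos h, hz h.choose_spec.1 ht h.choose_spec.2.symm]

/-- The square that carries this direction: instantiating a term and translating the result is the
same as translating it to a term with γ-variables and then applying the substitution of the witness.
Injectivity of `zz` on `T` makes the choices in `trClosed` and `gammaSubst` immaterial. -/
theorem trClosed_subst {M : Interp L Sk} (hM : ∀ s, Shallow zz s (M s)) {T : Set (Tm L Sk)}
    {t₀ : Tm L Sk} (hz : T.InjOn zz) {env : Variable → Option (Tm L Sk)}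
    (henv : ∀ v t, env v = some t → t ∈ T) {P : Variable → Prop}
    (hP : ∀ v, P v → (env v).isSome) {t : Tm L Sk} (ht : TmFlat P t)
    (hγt : ∀ z, Sum.inr z ∉ t.varFinset) :
    trClosed zz M (t.subst (envSubst env)) =
      (trTm zz M env t).subst (Sum.elim (fun x => .var (Sum.inl x)) (gammaSubst zz M T t₀)) := by
  induction t with
  | var v =>
    simp only [Term.subst, trTm, envSubst]
    cases hv : env v with
    | some t => simp [Term.subst, gammaSubst_eq hz (henv v t hv)]
    | none =>
      cases v with
      | inl x => simp [Term.subst, trClosed]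
      | inr x => exact absurd (mem_varFinset_var.2 rfl) (hγt x)
  | @func m f ts ih =>
    simp only [Term.subst, trTm, trClosed]
    cases hf : FunSym.sk? f with
    | none =>
      simp only [Term.subst, fun i => ih i (ht.1 i) fun z h => hγt z (mem_varFinset_func.2 ⟨i, h⟩)]
    | some s =>
      obtain ⟨h1, h2⟩ := sk?_args hf ht hP
      refine tmSubst_congr fun v hv => ?_
      obtain ⟨t, hts, rfl⟩ := (hM s _ h1).1 v hv
      have hts' := hts
      obtain ⟨j, rfl⟩ := (List.mem_ofFn' _ _).1 hts'
      have hex : ∃ i, (Sum.inr (zz ((ts j).subst (envSubst env))) : Variable) =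
        Sum.inr (zz ((ts i).subst (envSubst env))) := ⟨j, rfl⟩
      have hmem : ∀ i, (ts i).subst (envSubst env) ∈ T := fun i => by
        obtain ⟨a, -, ha⟩ := h2 _ ((List.mem_ofFn' _ _).2 ⟨i, rfl⟩)
        exact henv a _ ha
      rw [dif_pos hex, Sum.elim_inr, gammaSubst_eq hz (hmem j)]
      congr 1
      exact (hz (hmem j) (hmem _) (Sum.inr.inj hex.choose_spec)).symm

end Translation


/-! ## Construction of derivations -/

theorem PolImp.trans {p : Bool} {a b c : Prop} (h : PolImp p a b) (h' : PolImp p b c) :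
    PolImp p a c := by
  cases p
  · exact fun hc => h (h' hc)
  · exact fun ha => h' (h ha)

theorem skSym_injective {s s' : Σ m, Sk m} (h : skSym L s = skSym L s') : s = s' := by
  have := congrArg (fun c : Σ m, FunSym L Sk m => FunSym.sk? c.2) h
  simpa [skSym, FunSym.sk?] using this

section Construction

variable (zz : Tm L Sk → ℕ) (δ : DeltaFn L Sk) (Z : Set ℕ) (W : Finset Variable)
  (T : Set (Tm L Sk)) (t₀ : Tm L Sk)

/-- For every partial assignment of elements of `T` to `xs`, the translation of `G` is derivable
from a quantifier-free formula that is at least as true as the expansion of the Skolemized form. -/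
def Simulates (M : Interp L Sk) (p : Bool) (xs : List ℕ) (G : Fml L Sk) : Prop :=
  ∀ (env : Variable → Option (Tm L Sk)) (E Gd : Fml L Sk),
    (∀ x ∈ xs, ∃ t ∈ T, env (.inl x) = some t) → (∀ v, (¬ ∃ x ∈ xs, v = Sum.inl x) → env v = none) →
    (∀ v ∈ W, env v = none) →
    (T.Nonempty ∨ (NoGamma p G ∧ ∀ x, Sum.inr x ∉ Gd.freeVars)) →
    IsExpansion T (skolemize δ p xs G) E → Variant (tr zz M env G) Gd → (∀ x ∈ Gd.binders, x ∉ Z) →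
    ∃ B, Red δ p Gd B ∧ (T.Nonempty ∨ ∀ x, Sum.inr x ∉ B.freeVars) ∧
      ∀ val : ∀ k : ℕ, L.Relations k → (Fin k → Tm L Sk) → Prop,
        PolImp p ((E.subst (envSubst env)).eval fun k R ts => val k R (trClosed zz M ∘ ts))
          ((B.instGamma (gammaSubst zz M T t₀)).eval val)

variable {zz δ Z W T t₀}

/-- Here `Gd` serves as the quantifier-free formula. Its atom becomes the translation of the
corresponding atom of the expansion, by `trClosed_subst`. -/
theorem Simulates.rel {M : Interp L Sk} (hM : ∀ s, Shallow zz s (M s)) (hz : T.InjOn zz) {p : Bool}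
    {xs : List ℕ} {k : ℕ} {R : L.Relations k} {ts : Fin k → Tm L Sk} (hG : Stage xs (.rel R ts)) :
    Simulates zz δ Z W T t₀ M p xs (.rel R ts) := by
  intro env E Gd hxs hn _ hT hE hv hb
  rw [skolemize] at hE
  cases hE
  refine ⟨Gd, ?_, hT.imp_right And.right, fun val => ?_⟩
  · cases hv; exact ⟨trivial, .refl⟩
  · cases hv with
    | rel _ h =>
      have h2 : ∀ i, trClosed zz M ((ts i).subst (envSubst env)) = (trTm zz M env (ts i)).subst
          (Sum.elim (fun x => .var (Sum.inl x)) (gammaSubst zz M T t₀)) := fun i =>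
        trClosed_subst hM hz (fun v t hv => by
          by_cases hx : ∃ x ∈ xs, v = Sum.inl x
          · obtain ⟨x, hx, rfl⟩ := hx
            obtain ⟨u, hu, h⟩ := hxs x hx
            rw [hv] at h; cases h; exact hu
          · rw [hn v hx] at hv; cases hv) (fun v ⟨x, hx, h⟩ => by
          obtain ⟨u, hu, h'⟩ := hxs x hx
          rw [h, h']; rfl) (hG.flat i)
          fun z hz => hG.noGammaVar z (Fml.mem_freeVars_rel.2 ⟨i, hz⟩)
      simp only [Fml.instGamma, Fml.subst, Fml.eval, ← fun i => (h i).eq, ← h2]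
      exact .rfl

theorem Simulates.neg {M : Interp L Sk} {p : Bool} {xs : List ℕ} {A : Fml L Sk}
    (h : Simulates zz δ Z W T t₀ M (!p) xs A) : Simulates zz δ Z W T t₀ M p xs (.neg A) := by
  intro env E Gd hxs hn hW hT hE hv hb
  rw [skolemize] at hE
  cases hE with
  | neg hE =>
    cases hv with
    | @neg _ _ Gd hv =>
      obtain ⟨B, hB, hB', hval⟩ := h env _ Gd hxs hn hW hT hE hv hb
      exact ⟨.neg B, hB.neg, hB', fun val => (hval val).not⟩

theorem Simulates.or {M : Interp L Sk} {p : Bool} {xs : List ℕ} {A A' : Fml L Sk}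
    (h : Simulates zz δ Z W T t₀ M p xs A) (h' : Simulates zz δ Z W T t₀ M p xs A') :
    Simulates zz δ Z W T t₀ M p xs (.or A A') := by
  intro env E Gd hxs hn hW hT hE hv hb
  rw [skolemize] at hE
  cases hE with
  | or hE hE' =>
    cases hv with
    | or hv hv' =>
      simp only [Fml.binders, List.mem_append] at hb
      simp only [Fml.freeVars, Finset.mem_union, not_or] at hT
      obtain ⟨B, hB, hBg, hval⟩ := h env _ _ hxs hn hW
        (hT.imp_right fun h => ⟨h.1.1, fun x => (h.2 x).1⟩) hE hv fun x hx => hb x (.inl hx)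
      obtain ⟨B', hB', hBg', hval'⟩ := h' env _ _ hxs hn hW
        (hT.imp_right fun h => ⟨h.1.2, fun x => (h.2 x).2⟩) hE' hv' fun x hx => hb x (.inr hx)
      refine ⟨.or B B', hB.or hB', ?_, fun val => (hval val).or (hval' val)⟩
      rcases hBg with hBg | hBg
      · exact .inl hBg
      · refine hBg'.imp_right fun hBg' x hx => ?_
        simp only [Fml.freeVars, Finset.mem_union] at hx
        exact hx.elim (hBg x) (hBg' x)

theorem Simulates.and {M : Interp L Sk} {p : Bool} {xs : List ℕ} {A A' : Fml L Sk}
    (h : Simulates zz δ Z W T t₀ M p xs A) (h' : Simulates zz δ Z W T t₀ M p xs A') :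
    Simulates zz δ Z W T t₀ M p xs (.and A A') := by
  intro env E Gd hxs hn hW hT hE hv hb
  rw [skolemize] at hE
  cases hE with
  | and hE hE' =>
    cases hv with
    | and hv hv' =>
      simp only [Fml.binders, List.mem_append] at hb
      simp only [Fml.freeVars, Finset.mem_union, not_or] at hT
      obtain ⟨B, hB, hBg, hval⟩ := h env _ _ hxs hn hW
        (hT.imp_right fun h => ⟨h.1.1, fun x => (h.2 x).1⟩) hE hv fun x hx => hb x (.inl hx)
      obtain ⟨B', hB', hBg', hval'⟩ := h' env _ _ hxs hn hW
        (hT.imp_right fun h => ⟨h.1.2, fun x => (h.2 x).2⟩) hE' hv' fun x hx => hb x (.inr hx)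
      refine ⟨.and B B', hB.and hB', ?_, fun val => (hval val).and (hval' val)⟩
      rcases hBg with hBg | hBg
      · exact .inl hBg
      · refine hBg'.imp_right fun hBg' x hx => ?_
        simp only [Fml.freeVars, Finset.mem_union] at hx
        exact hx.elim (hBg x) (hBg' x)

/-- Each instance of the expanded quantifier has its own copy, with the bound variable renamed to
`zz t`: the γ-rule ties the γ-variable to the name of the bound variable. -/
theorem Simulates.gamma {M : Interp L Sk} (hM : ∀ s, Shallow zz s (M s))
    (hzZ : ∀ t ∈ T, zz t ∈ Z) (hTW : ∀ t ∈ T, t.varFinset ⊆ W) {p : Bool} {xs : List ℕ} {x : ℕ}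
    {H : Fml L Sk} (hG : Stage xs (.quant (gammaQ p) x H))
    (hZf : ∀ z ∈ Z, Sum.inl z ∉ (Fml.quant (gammaQ p) x H).freeVars) (hxW : Sum.inl x ∉ W)
    (ih : Simulates zz δ Z W T t₀ M p (xs ++ [x]) H) :
    Simulates zz δ Z W T t₀ M p xs (.quant (gammaQ p) x H) := by
  intro env E Gd hxs hn hW hT hE hv hb
  -- The expansion of a γ-quantifier exists only over a nonempty set of terms.
  have hTne : T.Nonempty := hT.resolve_right fun h => h.1.1 rfl
  rw [skolemize_gamma] at hE
  have hP : ∀ v, (∃ x ∈ xs, v = Sum.inl x) → (env v).isSome := by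
    rintro v ⟨x, hx, rfl⟩
    obtain ⟨t, -, ht⟩ := hxs x hx
    rw [ht]; rfl
  have hxxs : x ∉ xs := hG.notMem x (by simp [Fml.binders])
  have hfv : ∀ z ∈ Z, Sum.inl z ∉ Gd.freeVars := by
    intro z hz' h
    rw [← hv.mem_freeVars] at h
    rcases mem_freeVars_tr hM _ hP hG.flat h with ⟨h, -⟩ | ⟨_, -, _, -, h⟩
    · exact hZf z hz' h
    · cases h
  obtain ⟨B₀, hB₀, -⟩ := exists_red δ p Gd
  have main : ∀ {E'}, IsExpansion T (skolemize δ p (xs ++ [x]) H) E' → ∀ t ∈ T, ∃ D B,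
      Variant Gd D ∧ Red δ p D B ∧
      ∀ val : ∀ k : ℕ, L.Relations k → (Fin k → Tm L Sk) → Prop,
        PolImp p (((E'.replace x t).subst (envSubst env)).eval
          fun k R ts => val k R (trClosed zz M ∘ ts))
          ((B.instGamma (gammaSubst zz M T t₀)).eval val) := by
    intro E' hE' t ht
    cases hv with
    | @quant _ _ _ x' _ Hd hv =>
      have hzb : zz t ∉ Hd.binders := fun h => hb _ (by simp [Fml.binders, h]) (hzZ t ht)
      have hzx : zz t ≠ x' := by rintro rfl; exact hb _ (by simp [Fml.binders]) (hzZ t ht)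
      have hzf : Sum.inl (zz t) ∉ Hd.freeVars := fun h => hfv _ (hzZ t ht) (by
        simp [Fml.freeVars, h, hzx])
      -- Assigning `t` to the bound variable has the same effect as leaving it unassigned and then
      -- inserting the γ-variable for `t`.
      have htr : tr zz M (Function.update env (.inl x) (some t)) H =
          (tr zz M (Function.update env (.inl x) none) H).replace x (.var (Sum.inr (zz t))) := by
        have := tr_subst hM H (env := Function.update env (.inl x) (some t))
          (env' := Function.update env (.inl x) none) (s := Term.var)
          (s' := Function.update Term.var (.inl x) (.var (Sum.inr (zz t)))) hG.flat.1
          (fun z => by rw [Function.update_of_ne (by simp)]) (fun v hv => by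
            have hvx : v ≠ Sum.inl x := by
              rintro rfl
              obtain ⟨z, hz, h⟩ := hv
              cases h; exact hxxs hz
            simp only [Function.update_of_ne hvx, true_and]
            exact hP v hv) (fun v _ => .inl rfl) fun v _ => by
            by_cases hvx : v = Sum.inl x
            · subst hvx; simp [trTm, Term.subst]
            · simp only [trTm, Function.update_of_ne hvx]
              cases env v with
              | none => simp [Term.subst, Function.update_of_ne hvx]
              | some t => simp [Term.subst]
        rwa [Fml.subst_var] at this
      obtain ⟨B, hB, -, hval⟩ := ih (Function.update env (.inl x) (some t)) E'
        (Hd.replace x' (.var (Sum.inr (zz t)))) (fun z hz => by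
          by_cases hzx : z = x
          · subst hzx; exact ⟨t, ht, by simp⟩
          · rw [Function.update_of_ne fun h => hzx (Sum.inl.inj h)]
            exact hxs z (by simpa [hzx] using hz)) (fun v hv => by
          rw [Function.update_of_ne]
          · exact hn v fun ⟨z, hz, h⟩ => hv ⟨z, by simp [hz], h⟩
          · rintro rfl; exact hv ⟨x, by simp, rfl⟩) (fun v hv => by
          rw [Function.update_of_ne (by rintro rfl; exact hxW hv)]
          exact hW v hv) (.inl hTne) hE' (by
          rw [htr]
          exact hv.replace (by simp)) (fun z hz => by
          rw [Fml.binders_replace] at hz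
          exact hb z (by simp [Fml.binders, hz]))
      -- The names `zz t` lie in `Z`, which avoids the binders and free variables of `Gd`; so the
      -- renaming is legitimate and leaves the instance unchanged.
      refine ⟨_, B, variant_rename (gammaQ p) hzb hzf, ?_, fun val => ?_⟩
      · have := AStep.gamma (δ := δ) p (zz t) (Hd.replace x' (.var (Sum.inl (zz t))))
        rw [replace_replace hzb hzf] at this
        exact hB.step this
      · have : (E'.replace x t).subst (envSubst env) =
            E'.subst (envSubst (Function.update env (.inl x) (some t))) := by
          rw [Fml.replace, hE'.qf.subst_subst]
          congr 1
          funext v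
          by_cases hvx : v = Sum.inl x
          · subst hvx
            simp only [Function.update_self, envSubst, Option.getD_some]
            -- The variables of `t` belong to `W`, where nothing is assigned.
            exact tmSubst_eq_self fun w hw => by rw [envSubst, hW w (hTW t ht hw)]; rfl
          · simp [Function.update_of_ne hvx, Term.subst, envSubst]
        rw [this]
        exact hval val
  cases p with
  | true =>
    cases hE with
    | @ex _ _ E' h t l hnd ht =>
      obtain ⟨B, hB, h'⟩ := exists_red_of_list hB₀ _ (t :: l) fun t' ht' =>
        main h t' ((ht t').1 ht')
      refine ⟨B, hB, .inl hTne, fun val => ?_⟩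
      rw [Fml.bigOr_subst, Fml.eval_bigOr]
      rintro ⟨C, hC, hh⟩
      have : ∃ u ∈ t :: l, C = (E'.replace x u).subst (envSubst env) := by
        simpa [eq_comm] using hC
      obtain ⟨u, hu, rfl⟩ := this
      obtain ⟨B', hB', h''⟩ := h' u hu
      exact h'' _ val (hB' val hh)
  | false =>
    cases hE with
    | @all _ _ E' h t l hnd ht =>
      obtain ⟨B, hB, h'⟩ := exists_red_of_list hB₀ _ (t :: l) fun t' ht' =>
        main h t' ((ht t').1 ht')
      refine ⟨B, hB, .inl hTne, fun val hh => ?_⟩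
      rw [Fml.bigAnd_subst, Fml.eval_bigAnd]
      intro C hC
      have : ∃ u ∈ t :: l, C = (E'.replace x u).subst (envSubst env) := by
        simpa [eq_comm] using hC
      obtain ⟨u, hu, rfl⟩ := this
      obtain ⟨B', hB', h''⟩ := h' u hu
      exact hB' val (h'' _ val hh)

/-- `Gd` is only a variant of the formula to which the translated Skolem symbol belongs. Therefore
it is duplicated with the canonical variant, the δ-rule is applied to that copy, and the original is
reduced arbitrarily. -/
theorem Simulates.delta {M : Interp L Sk} (hM : ∀ s, Shallow zz s (M s)) {p : Bool} {xs : List ℕ}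
    {y : ℕ} {H : Fml L Sk} {l : List (Fml L Sk × List Variable)} (hMl : Translates zz δ Z M l)
    (hl : (Fml.quant (deltaQ p) y H, skArgs xs H) ∈ l)
    (hG : Stage xs (.quant (deltaQ p) y H))
    (hbZ : ∀ x ∈ (Fml.quant (deltaQ p) y H).binders, x ∉ Z)
    (ih : Simulates zz δ Z W T t₀ M p xs
      (H.replace y (deltaTerm δ (.quant (deltaQ p) y H) (skArgs xs H)))) :
    Simulates zz δ Z W T t₀ M p xs (.quant (deltaQ p) y H) := by
  intro env E Gd hxs hn hW hT hE hv hb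
  rw [skolemize_delta] at hE
  set C := Fml.quant (deltaQ p) y H with hC
  set ys := skArgs xs H with hys
  have hP : ∀ v, (∃ x ∈ xs, v = Sum.inl x) → (env v).isSome := by
    rintro v ⟨x, hx, rfl⟩
    obtain ⟨t, -, ht⟩ := hxs x hx
    rw [ht]; rfl
  have hyxs : y ∉ xs := hG.notMem y (by simp [hC, Fml.binders])
  obtain ⟨hKv, hKb⟩ := canonical_spec (Z := Z) (G := tr zz M env C)
    (by rw [binders_tr]; exact hbZ)
  -- The arguments `ys` include every free variable of `C` that `env` assigns, so the assignment
  -- recovered from the argument values translates `C` as `env` does.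
  have hu : trTm zz M env (deltaTerm δ C ys) = deltaTerm δ (canonical Z (tr zz M env C))
      ((gammas (canonical Z (tr zz M env C))).map Sum.inr) := by
    have h1 : (List.ofFn fun i => (Term.var (ys.get i) : Tm L Sk).subst (envSubst env)) =
        ys.map (envSubst env) := by
      apply List.ext_getElem <;> simp [Term.subst]
    have h2 : tr zz M (envOf ys (ys.map (envSubst env))) C = tr zz M env C := by
      refine tr_congr (fun _ _ => rfl) fun v hv => ?_
      by_cases hvx : ∃ x ∈ xs, v = Sum.inl x
      · have hvy : v ∈ ys := mem_skArgs.2 ⟨hvx, by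
          simp only [hC, Fml.freeVars, Finset.mem_erase] at hv; exact hv.2⟩
        obtain ⟨t, ht⟩ := Option.isSome_iff_exists.1 (hP v hvx)
        rw [envOf_map _ hvy, envSubst, ht]; rfl
      · rw [hn v hvx, envOf_of_notMem (List.length_map _) fun h => hvx (mem_skArgs.1 h).1]
    have h3 := hMl _ hl (ys.map (envSubst env)) (by simp)
    simp only [h2] at h3
    rw [← h3, ← h1]
    rfl
  -- The canonical variant is abstracted, so that its form can be inferred from the variance alone.
  revert hKv hKb hu
  generalize canonical Z (tr zz M env C) = K
  intro hKv hKb hu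
  have hGK : Variant Gd K := hv.symm.trans hKv
  obtain ⟨B₀, hB₀, hB₀'⟩ := exists_red δ p Gd
  cases hKv with
  | @quant _ _ _ y' _ Hd hKv =>
    set K := Fml.quant (deltaQ p) y' Hd with hK
    set u := deltaTerm δ K ((gammas K).map Sum.inr) with hu'
    have htr : tr zz M env (H.replace y (deltaTerm δ C ys)) =
        (tr zz M (Function.update env (.inl y) none) H).replace y u := by
      refine tr_subst hM H hG.flat.1 (fun z => by rw [Function.update_of_ne (by simp)])
        (fun v hv => ?_) (fun v _ => ?_) fun v _ => ?_
      · have hvy : v ≠ Sum.inl y := by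
          rintro rfl
          obtain ⟨z, hz, h⟩ := hv
          cases h; exact hyxs hz
        simp only [Function.update_of_ne hvy, true_and]
        exact hP v hv
      · by_cases hvy : v = Sum.inl y
        · subst hvy
          rw [Function.update_self]
          refine .inr fun x hx h => ?_
          rw [mem_varFinset_deltaTerm, mem_skArgs] at h
          obtain ⟨⟨z, hz, h⟩, -⟩ := h
          cases h
          exact hG.notMem x (by simp [hC, Fml.binders, hx]) hz
        · rw [Function.update_of_ne hvy]; exact .inl rfl
      · by_cases hvy : v = Sum.inl y
        · subst hvy; simp [trTm, Term.subst, hu]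
        · simp only [trTm, Function.update_of_ne hvy]
          cases env v with
          | none => simp [Term.subst, Function.update_of_ne hvy]
          | some t => simp [Term.subst]
    have hng : T.Nonempty ∨ (NoGamma p (H.replace y (deltaTerm δ C ys)) ∧
        ∀ x, Sum.inr x ∉ (Hd.replace y' u).freeVars) := by
      refine hT.imp_right fun ⟨h1, h2⟩ => ⟨(noGamma_subst H p _).2 h1.2, fun x hx => h2 x ?_⟩
      rw [hGK.mem_freeVars]
      rcases Fml.of_mem_freeVars_replace hx with h | ⟨h, -⟩
      · simp [hK, Fml.freeVars, h.1]
      · rw [hu', mem_varFinset_deltaTerm] at h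
        obtain ⟨z, hz, h⟩ := List.mem_map.1 h
        cases h; exact mem_gammas.1 hz
    obtain ⟨B, hB, hBg, hval⟩ := ih env E (Hd.replace y' u) hxs hn hW hng hE (by
      rw [htr]
      refine hKv.replace fun v hv => ?_
      rw [hu', mem_varFinset_deltaTerm] at hv
      obtain ⟨z, -, rfl⟩ := List.mem_map.1 hv
      rfl) (fun x hx => by
      rw [Fml.binders_replace] at hx
      exact hKb x (by simp [hK, Fml.binders, hx]))
    -- The γ-variables demanded by the δ-rule are those of the canonical variant, which is why
    -- `Translates` lists exactly these as arguments.
    refine ⟨_, hB₀.dup hGK (hB.step (.delta p y' Hd _ (nodup_gammas _) fun _ => mem_gammas)), ?_,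
      fun val => (hval val).trans ?_⟩
    · rcases hT with hT | ⟨h1, h2⟩
      · exact .inl hT
      · refine hBg.imp_right fun hBg x hx => ?_
        have hx' : Sum.inr x ∈ B₀.freeVars ∨ Sum.inr x ∈ B.freeVars := by
          cases p <;> simpa [alphaOp, Fml.freeVars] using hx
        rcases hx' with hx' | hx'
        · exact h2 x (hB₀' ((hv.noGamma p).1 ((noGamma_tr M C p env).2 h1)) x hx')
        · exact hBg x hx'
    · cases p
      · exact And.right
      · exact Or.inr

/-- Every stage of Skolemization can be simulated in the calculus. -/
theorem exists_simulates (hz : T.InjOn zz) (hzZ : ∀ t ∈ T, zz t ∈ Z)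
    (hTW : ∀ t ∈ T, t.varFinset ⊆ W) (p : Bool) (xs : List ℕ) (G : Fml L Sk) :
    ∀ l₀, Stage xs G → xs.Nodup → (∀ x ∈ G.binders, x ∉ Z) → (∀ z ∈ Z, Sum.inl z ∉ G.freeVars) →
    (∀ z ∈ Z, z ∉ xs) →
    (∀ x ∈ G.binders, Sum.inl x ∉ W) → Layered δ (IsSkolemArg Z) l₀ →
    (∀ s, skSym L s ∈ G.syms → ∃ e ∈ l₀, s = δ.sym e.1 e.2) →
    ∃ l, Layered δ (IsSkolemArg Z) l ∧ l₀ ⊆ l ∧ ∀ M : Interp L Sk,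
      (∀ s, Shallow zz s (M s)) → Translates zz δ Z M l → Simulates zz δ Z W T t₀ M p xs G := by
  induction p, xs, G using skolemize_induction δ with
  | rel p xs k R ts =>
    exact fun l₀ hG _ _ _ _ _ hl _ => ⟨l₀, hl, fun _ h => h, fun M hM _ => .rel hM hz hG⟩
  | neg p xs A ih =>
    intro l₀ hG hxs hb hf hZx hW hl hs
    obtain ⟨l, h1, h2, h3⟩ := ih l₀ hG.neg hxs hb hf hZx hW hl hs
    exact ⟨l, h1, h2, fun M hM hMl => (h3 M hM hMl).neg⟩
  | or p xs A B ihA ihB =>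
    intro l₀ hG hxs hb hf hZx hW hl hs
    simp only [Fml.freeVars, Finset.mem_union, Fml.binders, List.mem_append, not_or] at hb hf hW
    obtain ⟨l, h1, h2, h3⟩ := ihA l₀ hG.or_left hxs (fun x hx => hb x (.inl hx))
      (fun z hz => (hf z hz).1) hZx (fun x hx => hW x (.inl hx)) hl fun s h => hs s (.inl h)
    obtain ⟨l', h1', h2', h3'⟩ := ihB l hG.or_right hxs (fun x hx => hb x (.inr hx))
      (fun z hz => (hf z hz).2) hZx (fun x hx => hW x (.inr hx)) h1 fun s h => by
        obtain ⟨e, he, h⟩ := hs s (.inr h)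
        exact ⟨e, h2 he, h⟩
    exact ⟨l', h1', fun _ h => h2' (h2 h), fun M hM hMl =>
      (h3 M hM fun e he => hMl e (h2' he)).or (h3' M hM hMl)⟩
  | and p xs A B ihA ihB =>
    intro l₀ hG hxs hb hf hZx hW hl hs
    simp only [Fml.freeVars, Finset.mem_union, Fml.binders, List.mem_append, not_or] at hb hf hW
    obtain ⟨l, h1, h2, h3⟩ := ihA l₀ hG.and_left hxs (fun x hx => hb x (.inl hx))
      (fun z hz => (hf z hz).1) hZx (fun x hx => hW x (.inl hx)) hl fun s h => hs s (.inl h)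
    obtain ⟨l', h1', h2', h3'⟩ := ihB l hG.and_right hxs (fun x hx => hb x (.inr hx))
      (fun z hz => (hf z hz).2) hZx (fun x hx => hW x (.inr hx)) h1 fun s h => by
        obtain ⟨e, he, h⟩ := hs s (.inr h)
        exact ⟨e, h2 he, h⟩
    exact ⟨l', h1', fun _ h => h2' (h2 h), fun M hM hMl =>
      (h3 M hM fun e he => hMl e (h2' he)).and (h3' M hM hMl)⟩
  | gamma p xs x H ih =>
    intro l₀ hG hxs hb hf hZx hW hl hs
    have hxxs : x ∉ xs := hG.notMem x (by simp [Fml.binders])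
    obtain ⟨l, h1, h2, h3⟩ := ih l₀ hG.gamma (by
      rw [List.nodup_append]
      refine ⟨hxs, by simp, fun a ha b hb' h => ?_⟩
      rw [List.mem_singleton] at hb'
      subst hb' h; exact hxxs ha) (fun z hz => hb z (by simp [Fml.binders, hz]))
      (fun z hz h => by
        by_cases hzx : z = x
        · subst hzx; exact hb z (by simp [Fml.binders]) hz
        · exact hf z hz (by simp [Fml.freeVars, h, hzx]))
      (fun z hz h => by
        rcases List.mem_append.1 h with h | h
        · exact hZx z hz h
        · rw [List.mem_singleton] at h
          subst h; exact hb z (by simp [Fml.binders]) hz)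
      (fun z hz => hW z (by simp [Fml.binders, hz])) hl hs
    exact ⟨l, h1, h2, fun M hM hMl =>
      .gamma hM hzZ hTW hG hf (hW x (by simp [Fml.binders])) (h3 M hM hMl)⟩
  | delta p xs y H ih =>
    intro l₀ hG hxs hb hf hZx hW hl hs
    have hyxs : y ∉ xs := hG.notMem y (by simp [Fml.binders])
    have harg : IsSkolemArg Z (.quant (deltaQ p) y H) (skArgs xs H) := by
      refine ⟨hG.flat.mono (fun v hv h => mem_skArgs.2 ⟨h, ?_⟩) fun x hx h => ?_, hb, hG.noGammaVar⟩
      · simp only [Fml.freeVars, Finset.mem_erase] at hv; exact hv.2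
      · obtain ⟨⟨z, hz, h⟩, -⟩ := mem_skArgs.1 h
        cases h; exact hG.notMem x hx hz
    -- The entry is recorded before proceeding to the instance, whose only additional Skolem symbol
    -- is the one of this entry.
    obtain ⟨l, h1, h2, h3⟩ := ih ((.quant (deltaQ p) y H, skArgs xs H) :: l₀) (hG.delta δ _) hxs
      (fun x hx => by
        rw [Fml.binders_replace] at hx
        exact hb x (by simp [Fml.binders, hx]))
      (fun z hz h => by
        rcases Fml.of_mem_freeVars_replace h with h | ⟨h, -⟩
        · exact hf z hz (by simp only [Fml.freeVars, Finset.mem_erase]; exact ⟨h.2, h.1⟩)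
        · rw [mem_varFinset_deltaTerm, mem_skArgs] at h
          obtain ⟨⟨z', hz', h⟩, -⟩ := h
          cases h; exact hZx z hz hz') hZx
      (fun x hx => by
        rw [Fml.binders_replace] at hx
        exact hW x (by simp [Fml.binders, hx]))
      ⟨⟨harg, (hxs.map Sum.inl_injective).filter _, fun v hv => by
        obtain ⟨⟨z, hz, rfl⟩, hv⟩ := mem_skArgs.1 hv
        simp only [Fml.freeVars, Finset.mem_erase]
        exact ⟨fun h => hyxs (by cases h; exact hz), hv⟩⟩, hs, hl⟩
      (fun s h => by
        rcases Fml.of_mem_syms_replace h with h | h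
        · obtain ⟨e, he, h⟩ := hs s h
          exact ⟨e, .tail _ he, h⟩
        · rw [tmSyms_deltaTerm, Set.mem_singleton_iff] at h
          exact ⟨_, .head _, skSym_injective h⟩)
    exact ⟨l, h1, fun e he => h2 (.tail _ he), fun M hM hMl =>
      .delta hM hMl (h2 (.head _)) hG hb (h3 M hM hMl)⟩

end Construction

/-! ### From Property C* to derivations -/

theorem TermOver.varFinset_subset {F t : _} (h : TermOver (L := L) (Sk := Sk) F t) :
    t.varFinset ⊆ F.freeVars := by
  intro v hv
  induction t with
  | var w => rw [mem_varFinset_var] at hv; subst hv; exact h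
  | func f ts ih =>
    obtain ⟨i, hi⟩ := mem_varFinset_func.1 hv
    exact ih i (h.2 i) hi

theorem trTm_none {zz : Tm L Sk → ℕ} {M : Interp L Sk} {t : Tm L Sk}
    (h : ∀ s, skSym L s ∉ tmSyms t) : trTm zz M (fun _ => none) t = t := by
  induction t with
  | var v => rfl
  | @func m f ts ih =>
    simp only [trTm]
    cases hf : FunSym.sk? f with
    | none => simp only [ih _ fun s hs => h s (.inr (Set.mem_iUnion.2 ⟨_, hs⟩))]
    | some s => exact absurd (.inl (sk?_eq_some.1 hf).symm) (h s)

theorem tr_none {zz : Tm L Sk → ℕ} {M : Interp L Sk} {A : Fml L Sk}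
    (h : ∀ s, skSym L s ∉ A.syms) : tr zz M (fun _ => none) A = A := by
  induction A with
  | rel R ts =>
    simp only [tr, fun i => trTm_none (zz := zz) (M := M) (t := ts i) fun s hs =>
      h s (Set.mem_iUnion.2 ⟨i, hs⟩)]
  | neg A ih => simp only [tr, ih h]
  | or A B ihA ihB =>
    simp only [tr, ihA fun s hs => h s (.inl hs), ihB fun s hs => h s (.inr hs)]
  | and A B ihA ihB =>
    simp only [tr, ihA fun s hs => h s (.inl hs), ihB fun s hs => h s (.inr hs)]
  | quant q x A ih =>
    have : Function.update (fun _ : Variable => (none : Option (Tm L Sk))) (Sum.inl x) none =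
        fun _ => none := Function.update_eq_self (Sum.inl x) _
    simp only [tr, this, ih h]

/-- Property C* yields a derivation without inferences in the scope of quantifiers. -/
theorem exists_derivation {δ : DeltaFn L Sk} (hδ : δ.Admissible) {A : Fml L Sk} {n : ℕ}
    (hA : A.Original) (hr : A.Rectified) (h : PropertyCstar δ n A) :
    ∃ (B : Fml L Sk) (σ : ℕ → Tm L Sk), B.QF ∧
      (∀ x, Sum.inr x ∈ B.freeVars → height (σ x) < n) ∧ (B.instGamma σ).Tautology ∧
      Relation.ReflTransGen (AStep δ true) B A := by
  obtain ⟨E, hE, hEt⟩ := h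
  set F := skolemForm δ A with hF
  set T := champFini n F with hT
  have hfin : T.Finite := finite_champFini n F
  -- All variables of `A` lie below `N`, so the numbers from `N` on are free to serve as names of
  -- elements of the champ fini.
  obtain ⟨N, hN⟩ : ∃ N : ℕ, (∀ x ∈ A.binders, x < N) ∧ ∀ x, Sum.inl x ∈ A.freeVars → x < N := by
    obtain ⟨N, hN⟩ := (A.binders.toFinset ∪ A.freeVars.toLeft).exists_nat_subset_range
    simp only [Finset.subset_iff, Finset.mem_union, List.mem_toFinset, Finset.mem_toLeft,
      Finset.mem_range] at hN
    exact ⟨N, fun x hx => hN (.inl hx), fun x hx => hN (.inr hx)⟩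
  obtain ⟨g, hg⟩ := Set.countable_iff_exists_injOn.1 hfin.countable
  -- A default for γ-variables that name no element of the champ fini; taken from it where possible,
  -- it keeps the height bound valid for every γ-variable.
  obtain ⟨t₀, ht₀⟩ : ∃ t₀ : Tm L Sk, T.Nonempty → t₀ ∈ T := by
    by_cases h : T.Nonempty
    · exact ⟨h.choose, fun _ => h.choose_spec⟩
    · exact ⟨.var (Sum.inl 0), fun h' => absurd h' h⟩
  have hS := Stage.of_rectified hA hr
  have hFA : F.freeVars ⊆ A.freeVars := skolemize_freeVars_subset δ true [] A hS
  set zz : Tm L Sk → ℕ := fun t => N + g t with hzz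
  have hz : T.InjOn zz := fun s hs t ht h => hg hs ht (by simpa [hzz] using h)
  obtain ⟨l, hl, -, hsim⟩ := exists_simulates (zz := zz) (δ := δ) (Z := {z | N ≤ z})
    (W := F.freeVars) (T := T) (t₀ := t₀) hz (fun t _ => by simp [hzz])
    (fun t ht => TermOver.varFinset_subset ht.1) true [] A [] hS (by simp)
    (fun x hx h => absurd (hN.1 x hx) (not_lt.2 h)) (fun z h hz => absurd (hN.2 z hz) (not_lt.2 h))
    (by simp) (fun x hx h => hS.notFree x hx (hFA h)) trivial
    (fun s hs => absurd hs (hA.skSym_notMem s))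
  obtain ⟨M, hM, hMl⟩ := exists_translates hδ hl
  have htr : tr zz M (fun _ => none) A = A := tr_none hA.skSym_notMem
  obtain ⟨B, hB, hBg, hval⟩ := hsim M hM hMl (fun _ => none) E A (by simp) (by simp) (by simp)
    (by
      by_cases h : T.Nonempty
      · exact .inl h
      · exact .inr ⟨noGamma_of_isExpansion δ h true [] A hE, hS.noGammaVar⟩) hE
    (by rw [htr]; exact .refl A) (fun x hx h => absurd (hN.1 x hx) (not_lt.2 h))
  refine ⟨B, gammaSubst zz M T t₀, hB.1, fun x hx => ?_, ⟨Fml.qf_subst.2 hB.1, fun val => ?_⟩, hB.2⟩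
  · have hne : T.Nonempty := hBg.resolve_right fun h => h x hx
    rw [gammaSubst]
    split
    · next h => exact (height_trClosed hM _).trans_lt h.choose_spec.1.2
    · exact (height_trClosed hM _).trans_lt (ht₀ hne).2
  · have : envSubst (fun _ => none) = (Term.var : Variable → Tm L Sk) := by
      funext v; rfl
    have h := hval val
    rw [this, Fml.subst_var] at h
    -- The expansion is true under the given valuation pulled back along `trClosed`; the simulation
    -- carries this over to the instance of `B`.
    exact h (hEt.2 _)


/-! ## Enumerable systems of rules -/

/-- A rule maps parameters to a list of premises and a conclusion. -/
abbrev Rule := List ℕ → Option (List (List ℕ) × List ℕ)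

/-- The facts that can be derived with a list of rules. -/
inductive Derivable (rs : List Rule) : List ℕ → Prop
  | intro {r : Rule} (hr : r ∈ rs) (env : List ℕ) {ps : List (List ℕ)} {c : List ℕ}
      (h : r env = some (ps, c)) (hp : ∀ q ∈ ps, Derivable rs q) : Derivable rs c

namespace Rule

/-- Application of the rule number `i`. -/
def apply (rs : List Rule) (i : ℕ × List ℕ) : Option (List (List ℕ) × List ℕ) :=
  (rs[i.1]?).bind fun r => r i.2

theorem computable_apply {rs : List Rule} (h : ∀ r ∈ rs, Computable r) : Computable (apply rs) := by
  induction rs with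
  | nil => exact (Computable.const none).of_eq fun i => by simp [apply]
  | cons r rs ih =>
    have h1 := (h r (.head _)).comp (Computable.snd (α := ℕ) (β := List ℕ))
    have h2 : Computable₂ fun (i : ℕ × List ℕ) (n : ℕ) => apply rs (n, i.2) :=
      (ih fun r hr => h r (.tail _ hr)).comp
        (Computable.pair Computable.snd (Computable.snd.comp Computable.fst))
    refine (Computable.nat_casesOn Computable.fst h1 h2).of_eq fun i => ?_
    obtain ⟨_ | n, env⟩ := i
    · simp [apply]
    · simp [apply]

/-- All premises are among the facts derived so far. -/
def ready (ps st : List (List ℕ)) : Prop := ∀ q ∈ ps, ∃ s ∈ st, s = q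

theorem primrecRel_ready : PrimrecRel ready :=
  PrimrecRel.forall_mem_list ((PrimrecRel.exists_mem_list Primrec.eq).comp₂
    Primrec₂.right Primrec₂.left)

open Classical in
/-- The effect of one instruction on the list of derived facts. -/
noncomputable def exec (rs : List Rule) (st : List (List ℕ)) (i : ℕ × List ℕ) : List (List ℕ) :=
  ((apply rs i).bind fun x => if ready x.1 st then some (x.2 :: st) else none).getD st

theorem computable_exec {rs : List Rule} (h : ∀ r ∈ rs, Computable r) : Computable₂ (exec rs) := by
  classical
  refine Computable.option_getD (Computable.option_bind ((computable_apply h).comp .snd) ?_) .fst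
  have hr : PrimrecPred fun y : (List (List ℕ) × (ℕ × List ℕ)) × (List (List ℕ) × List ℕ) =>
      ready y.2.1 y.1.1 :=
    primrecRel_ready.comp (Primrec.fst.comp Primrec.snd) (Primrec.fst.comp Primrec.fst)
  exact (Primrec.ite hr (Primrec.option_some.comp (Primrec.list_cons.comp
    (Primrec.snd.comp Primrec.snd) (Primrec.fst.comp Primrec.fst))) (Primrec.const none)).to_comp.to₂

/-- The facts derived by the first `n` instructions of a list. -/
noncomputable def run (rs : List Rule) (is : List (ℕ × List ℕ)) (n : ℕ) : List (List ℕ) :=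
  n.rec [] fun k st => ((is[k]?).map (exec rs st)).getD st

theorem computable_run {rs : List Rule} (h : ∀ r ∈ rs, Computable r) : Computable₂ (run rs) := by
  have hstep : Computable₂ fun (a : List (ℕ × List ℕ) × ℕ) (y : ℕ × List (List ℕ)) =>
      ((a.1[y.1]?).map (exec rs y.2)).getD y.2 := by
    refine Computable.option_getD (Computable.option_map (Computable.list_getElem?.comp
      (Computable.fst.comp .fst) (Computable.fst.comp .snd)) ?_) (Computable.snd.comp .snd)
    exact (computable_exec h).comp (Computable.snd.comp (Computable.snd.comp .fst)) .snd
  exact (Computable.nat_rec (f := fun a : List (ℕ × List ℕ) × ℕ => a.2) (g := fun _ => [])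
    .snd (.const []) hstep).to₂

theorem derivable_of_mem_run {rs : List Rule} {is : List (ℕ × List ℕ)} {n : ℕ} {c : List ℕ}
    (h : c ∈ run rs is n) : Derivable rs c := by
  induction n generalizing c with
  | zero => simp [run] at h
  | succ n ih =>
    change c ∈ ((is[n]?).map (exec rs (run rs is n))).getD (run rs is n) at h
    cases hi : is[n]? with
    | none => rw [hi] at h; exact ih h
    | some i =>
      rw [hi] at h
      simp only [Option.map_some, Option.getD_some, exec] at h
      cases ha : apply rs i with
      | none => rw [ha] at h; exact ih h
      | some x =>
        rw [ha] at h
        simp only [Option.bind_some] at h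
        split at h
        · next hr =>
          rcases List.mem_cons.1 h with rfl | h
          · obtain ⟨r, hr', hx⟩ := Option.bind_eq_some_iff.1 ha
            refine .intro (List.mem_of_getElem? hr') i.2 hx fun q hq => ?_
            obtain ⟨s, hs, rfl⟩ := hr q hq
            exact ih hs
          · exact ih h
        · exact ih h

/-- Instructions further down the list have no effect on earlier states, so programs can be
concatenated. -/
theorem run_append {rs : List Rule} (is js : List (ℕ × List ℕ)) (n : ℕ) :
    run rs (is ++ js) (is.length + n) =
      n.rec (run rs is is.length) fun k st => ((js[k]?).map (exec rs st)).getD st := by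
  induction n with
  | zero =>
    have : ∀ m ≤ is.length, run rs (is ++ js) m = run rs is m := by
      intro m hm
      induction m with
      | zero => rfl
      | succ m ih =>
        have h := ih (by omega)
        unfold run at h ⊢
        simp only [h, List.getElem?_append_left (show m < is.length by omega)]
    exact this _ le_rfl
  | succ n ih =>
    have h : run rs (is ++ js) (is.length + n + 1) =
        (((is ++ js)[is.length + n]?).map (exec rs (run rs (is ++ js) (is.length + n)))).getD
          (run rs (is ++ js) (is.length + n)) := rfl
    rw [← Nat.add_assoc, h, ih, List.getElem?_append_right (by omega)]
    simp

theorem subset_exec {rs : List Rule} (st : List (List ℕ)) (i : ℕ × List ℕ) : st ⊆ exec rs st i := by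
  unfold exec
  cases apply rs i with
  | none => exact fun _ h => h
  | some x =>
    simp only [Option.bind_some]
    split
    · exact List.subset_cons_self _ _
    · exact fun _ h => h

theorem subset_run_append {rs : List Rule} (is js : List (ℕ × List ℕ)) :
    run rs is is.length ⊆ run rs (is ++ js) (is ++ js).length := by
  rw [List.length_append, run_append]
  generalize js.length = n
  induction n with
  | zero => exact fun _ h => h
  | succ n ih =>
    refine fun c hc => ?_
    have h := ih hc
    simp only
    cases js[n]? with
    | none => exact h
    | some i => exact subset_exec _ _ h

end Rule

-- Programs for the premises are run one after the other; quantifying over the instructions already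
-- executed permits this, and later instructions never discard facts.
open Rule in
theorem Derivable.exists_run {rs : List Rule} {c : List ℕ} (h : Derivable rs c) :
    ∀ is, ∃ js, c ∈ run rs (is ++ js) (is ++ js).length := by
  induction h with
  | @intro r hr env ps c h hp ih =>
    intro is
    have hps : ∃ js, ∀ q ∈ ps, q ∈ run rs (is ++ js) (is ++ js).length := by
      clear h hp
      induction ps with
      | nil => exact ⟨[], by simp⟩
      | cons q ps ihp =>
        obtain ⟨js, hjs⟩ := ihp fun q hq => ih q (.tail _ hq)
        obtain ⟨ks, hks⟩ := ih q (.head _) (is ++ js)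
        refine ⟨js ++ ks, fun q' hq' => ?_⟩
        rw [← List.append_assoc]
        rcases List.mem_cons.1 hq' with rfl | hq'
        · exact hks
        · exact subset_run_append _ _ (hjs q' hq')
    obtain ⟨js, hjs⟩ := hps
    obtain ⟨i, hi, rfl⟩ := List.mem_iff_getElem.1 hr
    refine ⟨js ++ [(i, env)], ?_⟩
    rw [← List.append_assoc, List.length_append, run_append]
    have ha : apply rs (i, env) = some (ps, c) := by
      rw [apply, List.getElem?_eq_getElem hi]; exact h
    have hready : ready ps (run rs (is ++ js) (is ++ js).length) :=
      fun q hq => ⟨q, hjs q hq, rfl⟩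
    change c ∈ exec rs (run rs (is ++ js) (is ++ js).length) (i, env)
    simp only [exec, ha, Option.bind_some, if_pos hready]
    exact .head _

open Classical in
/-- The fourth entry of a fact `[k, a, n, w]`, if the fact is in the list. -/
noncomputable def Rule.select (k : ℕ) (z : List (List ℕ) × (ℕ × ℕ) × ℕ) : Option ℕ :=
  if ∃ s ∈ z.1, s = [k, z.2.1.1, z.2.1.2, z.2.2] then some z.2.2 else none

theorem Rule.primrec_select (k : ℕ) : Primrec (Rule.select k) := by
  classical
  have hmem : PrimrecRel fun (st : List (List ℕ)) (c : List ℕ) => ∃ s ∈ st, s = c :=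
    PrimrecRel.exists_mem_list Primrec.eq
  refine Primrec.ite (hmem.comp .fst ?_) (Primrec.option_some.comp (Primrec.snd.comp .snd))
    (.const none)
  exact Primrec.list_cons.comp (.const k) (Primrec.list_cons.comp
    (Primrec.fst.comp (Primrec.fst.comp .snd)) (Primrec.list_cons.comp
    (Primrec.snd.comp (Primrec.fst.comp .snd)) (Primrec.list_cons.comp
    (Primrec.snd.comp .snd) (.const []))))

/-- Selection of a derivable fact `[k, a, n, w]` by a number for a list of instructions and `w`. -/
noncomputable def Rule.search (rs : List Rule) (k : ℕ) (an : ℕ × ℕ) (m : ℕ) : Option ℕ :=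
  (Encodable.decode (α := List (ℕ × List ℕ) × ℕ) m).bind fun y =>
    Rule.select k (Rule.run rs y.1 y.1.length, an, y.2)

theorem Rule.computable_search {rs : List Rule} (h : ∀ r ∈ rs, Computable r) (k : ℕ) :
    Computable₂ (Rule.search rs k) := by
  refine Computable.option_bind (Computable.decode.comp .snd) ?_
  have h1 : Computable fun z : ((ℕ × ℕ) × ℕ) × (List (ℕ × List ℕ) × ℕ) =>
      (Rule.run rs z.2.1 z.2.1.length, z.1.1, z.2.2) :=
    Computable.pair ((Rule.computable_run h).comp (Computable.fst.comp .snd)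
      (Computable.list_length.comp (Computable.fst.comp .snd)))
      (Computable.pair (Computable.fst.comp .fst) (Computable.snd.comp .snd))
  exact ((Rule.primrec_select k).to_comp.comp h1).to₂

/-- Selection of a derivable fact `[k, a, n, w]` for given `a` and `n`. -/
theorem exists_partrec_derivable {rs : List Rule} (h : ∀ r ∈ rs, Computable r) (k : ℕ) :
    ∃ g : ℕ → ℕ →. ℕ, Partrec₂ g ∧ ∀ a n,
      (∀ w ∈ g a n, Derivable rs [k, a, n, w]) ∧
      ((∃ w, Derivable rs [k, a, n, w]) → (g a n).Dom) := by
  refine ⟨fun a n => Nat.rfindOpt (Rule.search rs k (a, n)),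
    (Partrec.rfindOpt (Rule.computable_search h k)).to₂, fun a n =>
    ⟨fun w hw => ?_, fun ⟨w, hw⟩ => ?_⟩⟩
  · obtain ⟨m, hm⟩ := Nat.rfindOpt_spec hw
    obtain ⟨y, -, hy⟩ := Option.bind_eq_some_iff.1 (Option.mem_def.1 hm)
    rw [Rule.select] at hy
    split at hy
    · next hs =>
      obtain ⟨s, hs, rfl⟩ := hs
      cases hy
      exact Rule.derivable_of_mem_run hs
    · cases hy
  · obtain ⟨js, hjs⟩ := hw.exists_run []
    rw [List.nil_append] at hjs
    -- A search index encodes a program together with the entry `w`, so a program that derives the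
    -- fact is itself a successful index.
    have hw' : Rule.search rs k (a, n) (Encodable.encode (js, w)) = some w := by
      rw [Rule.search, Encodable.encodek, Option.bind_some, Rule.select]
      exact if_pos ⟨_, hjs, rfl⟩
    have hd : ∃ m b, b ∈ Rule.search rs k (a, n) m := ⟨Encodable.encode (js, w), w, Option.mem_def.2 hw'⟩
    exact Nat.rfindOpt_dom.2 hd

/-! ## Clauses -/

/-- Patterns for numbers that contain codes of pairs. -/
inductive Pat
  | x (i : ℕ)
  | const (k : ℕ)
  | pair (a b : Pat)
  | succ (a : Pat)
  | dbl (a : Pat)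

/-- The instance of a pattern. -/
def Pat.eval (ρ : ℕ → ℕ) : Pat → ℕ
  | x i => ρ i
  | const k => k
  | pair a b => Nat.pair (a.eval ρ) (b.eval ρ)
  | succ a => a.eval ρ + 1
  | dbl a => 2 * a.eval ρ

instance (k : ℕ) : OfNat Pat k := ⟨.const k⟩

theorem Pat.primrec_eval (q : Pat) : Primrec fun env : List ℕ => q.eval (env.getD · 0) := by
  induction q with
  | x i => exact (Primrec.list_getD 0).comp .id (.const i)
  | const k => exact .const k
  | pair a b iha ihb => exact Primrec₂.natPair.comp iha ihb
  | succ a ih => exact Primrec.succ.comp ih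
  | dbl a ih => exact Primrec.nat_mul.comp (.const 2) ih

theorem Pat.primrec_map_eval (q : List Pat) :
    Primrec fun env : List ℕ => q.map fun a => a.eval (env.getD · 0) := by
  induction q with
  | nil => exact .const []
  | cons a q ih => exact Primrec.list_cons.comp a.primrec_eval ih

/-- A clause consists of patterns for the premises and a pattern for the conclusion. -/
abbrev Clause := List (List Pat) × List Pat

/-- The rule given by a clause. -/
def Clause.rule (c : Clause) : Rule := fun env =>
  some (c.1.map fun q => q.map fun a => a.eval (env.getD · 0), c.2.map fun a => a.eval (env.getD · 0))

theorem Clause.computable_rule (c : Clause) : Computable c.rule := by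
  have h : ∀ qs : List (List Pat), Primrec fun env : List ℕ =>
      qs.map fun q => q.map fun a => a.eval (env.getD · 0) := by
    intro qs
    induction qs with
    | nil => exact .const []
    | cons q qs ih => exact Primrec.list_cons.comp (Pat.primrec_map_eval q) ih
  exact (Primrec.option_some.comp (Primrec.pair (h c.1) (Pat.primrec_map_eval c.2))).to_comp

/-- The clauses preserve the property `S`. -/
def Preserves (S : List ℕ → Prop) (cs : List Clause) : Prop :=
  ∀ c ∈ cs, ∀ ρ : ℕ → ℕ, (∀ q ∈ c.1, S (q.map (Pat.eval ρ))) → S (c.2.map (Pat.eval ρ))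

theorem preserves_nil (S : List ℕ → Prop) : Preserves S [] := by simp [Preserves]

theorem Preserves.cons {S : List ℕ → Prop} {c : Clause} {cs : List Clause}
    (h : ∀ ρ : ℕ → ℕ, (∀ q ∈ c.1, S (q.map (Pat.eval ρ))) → S (c.2.map (Pat.eval ρ)))
    (h' : Preserves S cs) : Preserves S (c :: cs) := by
  intro d hd
  rcases List.mem_cons.1 hd with rfl | hd
  · exact h
  · exact h' d hd


/-! ## Substitutions and renamings as finite lists -/

/-- Association of a variable with a term. If the second component of an entry is `true`, then the
entry is also binding for the term. -/
def Assoc (b : Bool) : List (Variable × Tm L Sk × Bool) → Variable → Tm L Sk → Prop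
  | [], v, t => t = .var v ∧ (b = true ∨ v.isLeft)
  | e :: l, v, t => (v = e.1 ∧ t = e.2.1) ∨ (v ≠ e.1 ∧ (e.2.2 = true → t ≠ e.2.1) ∧ Assoc b l v t)

/-- Terms that agree up to the association. -/
inductive TmRw (b : Bool) (l : List (Variable × Tm L Sk × Bool)) : Tm L Sk → Tm L Sk → Prop
  | var {v : Variable} {t : Tm L Sk} (h : Assoc b l v t) : TmRw b l (.var v) t
  | func {m : ℕ} (f : (extLang L Sk).Functions m) {ts us : Fin m → Tm L Sk}
      (h : ∀ i, TmRw b l (ts i) (us i)) : TmRw b l (.func f ts) (.func f us)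

/-- Formulas that agree up to the association: substitution (`false`) or renaming including bound
variables (`true`). -/
inductive FmlRw : Bool → Bool → List (Variable × Tm L Sk × Bool) → Fml L Sk → Fml L Sk → Prop
  | rel {m b : Bool} {l : List (Variable × Tm L Sk × Bool)} {k : ℕ} (R : L.Relations k)
      {ts us : Fin k → Tm L Sk} (h : ∀ i, TmRw b l (ts i) (us i)) :
      FmlRw m b l (.rel R ts) (.rel R us)
  | neg {m b : Bool} {l : List (Variable × Tm L Sk × Bool)} {A A' : Fml L Sk}
      (h : FmlRw m b l A A') : FmlRw m b l (.neg A) (.neg A')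
  | bin (c : Bool) {m b : Bool} {l : List (Variable × Tm L Sk × Bool)} {A A' B B' : Fml L Sk}
      (h : FmlRw m b l A A') (h' : FmlRw m b l B B') : FmlRw m b l (alphaOp c A B) (alphaOp c A' B')
  | sub (q : Quantifier) (x : ℕ) {b : Bool} {l : List (Variable × Tm L Sk × Bool)} {A A' : Fml L Sk}
      (h : FmlRw false b ((.inl x, .var (.inl x), false) :: l) A A') :
      FmlRw false b l (.quant q x A) (.quant q x A')
  | ren (q : Quantifier) (x y : ℕ) {b : Bool} {l : List (Variable × Tm L Sk × Bool)}
      {A A' : Fml L Sk} (h : FmlRw true b ((.inl x, .var (.inl y), true) :: l) A A') :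
      FmlRw true b l (.quant q x A) (.quant q y A')

theorem TmRw.eq_subst {b : Bool} {l : List (Variable × Tm L Sk × Bool)} {t u : Tm L Sk}
    (h : TmRw b l t u) {s : Variable → Tm L Sk} (hs : ∀ v t, Assoc b l v t → t = s v) :
    u = t.subst s := by
  induction h with
  | var h => exact hs _ _ h
  | func f h ih => rw [Term.subst, funext ih]

theorem TmRw.exists_assoc {b : Bool} {l : List (Variable × Tm L Sk × Bool)} {t u : Tm L Sk}
    (h : TmRw b l t u) {v : Variable} (hv : v ∈ t.varFinset) : ∃ t, Assoc b l v t := by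
  induction h with
  | var h => rw [mem_varFinset_var] at hv; subst hv; exact ⟨_, h⟩
  | func f h ih => obtain ⟨i, hi⟩ := mem_varFinset_func.1 hv; exact ih i hi

theorem tmRw_subst {b : Bool} {l : List (Variable × Tm L Sk × Bool)} {t : Tm L Sk}
    {s : Variable → Tm L Sk} (h : ∀ v ∈ t.varFinset, Assoc b l v (s v)) :
    TmRw b l t (t.subst s) := by
  induction t with
  | var v => exact .var (h v (mem_varFinset_var.2 rfl))
  | func f ts ih => exact .func f fun i => ih i fun v hv => h v (mem_varFinset_func.2 ⟨i, hv⟩)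

theorem FmlRw.eq_subst {b : Bool} {l : List (Variable × Tm L Sk × Bool)} {A A' : Fml L Sk}
    (h : FmlRw false b l A A') {s : Variable → Tm L Sk} (hs : ∀ v t, Assoc b l v t → t = s v) :
    A' = A.subst s := by
  generalize hm : false = m at h
  induction h generalizing s with
  | rel R h => rw [Fml.subst, funext fun i => (h i).eq_subst hs]
  | neg h ih => rw [Fml.subst, ih hs hm]
  | bin c h h' ih ih' => cases c <;> rw [alphaOp, alphaOp, Fml.subst, ih hs hm, ih' hs hm]
  | sub q x h ih =>
    rw [Fml.subst, ih (fun v t hv => ?_) hm]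
    rcases hv with ⟨rfl, rfl⟩ | ⟨h1, -, h2⟩
    · simp
    · rw [Function.update_of_ne h1]; exact hs v t h2
  | ren q x y h ih => cases hm

theorem FmlRw.exists_assoc {b : Bool} {l : List (Variable × Tm L Sk × Bool)} {A A' : Fml L Sk}
    (h : FmlRw false b l A A') {v : Variable} (hv : v ∈ A.freeVars) : ∃ t, Assoc b l v t := by
  generalize hm : false = m at h
  induction h with
  | rel R h => obtain ⟨i, hi⟩ := Fml.mem_freeVars_rel.1 hv; exact (h i).exists_assoc hi
  | neg h ih => exact ih hv hm
  | @bin c m b l A A' B B' h h' ih ih' =>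
    have : v ∈ A.freeVars ∨ v ∈ B.freeVars := by cases c <;> simpa [alphaOp, Fml.freeVars] using hv
    exact this.elim (ih · hm) (ih' · hm)
  | sub q x h ih =>
    simp only [Fml.freeVars, Finset.mem_erase] at hv
    obtain ⟨t, ⟨h1, -⟩ | ⟨-, -, h2⟩⟩ := ih hv.2 hm
    · exact absurd h1 hv.1
    · exact ⟨t, h2⟩
  | ren q x y h ih => cases hm

theorem fmlRw_subst (A : Fml L Sk) : ∀ {b : Bool} {l : List (Variable × Tm L Sk × Bool)}
    {s : Variable → Tm L Sk}, (∀ v ∈ A.freeVars, Assoc b l v (s v)) →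
    FmlRw false b l A (A.subst s) := by
  induction A with
  | rel R ts =>
    exact fun h => .rel R fun i => tmRw_subst fun v hv => h v (Fml.mem_freeVars_rel.2 ⟨i, hv⟩)
  | neg A ih => exact fun h => .neg (ih h)
  | or A B ihA ihB =>
    exact fun h => .bin true (ihA fun v hv => h v (by simp [Fml.freeVars, hv]))
      (ihB fun v hv => h v (by simp [Fml.freeVars, hv]))
  | and A B ihA ihB =>
    exact fun h => .bin false (ihA fun v hv => h v (by simp [Fml.freeVars, hv]))
      (ihB fun v hv => h v (by simp [Fml.freeVars, hv]))
  | quant q x A ih =>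
    refine fun h => .sub q x (ih fun v hv => ?_)
    by_cases hvx : v = Sum.inl x
    · subst hvx; exact .inl ⟨rfl, by simp⟩
    · rw [Function.update_of_ne hvx]
      exact .inr ⟨hvx, by simp, h v (by simp [Fml.freeVars, hv, hvx])⟩

theorem TmRw.tmRen {b : Bool} {l : List (Variable × Tm L Sk × Bool)} {t u : Tm L Sk}
    (h : TmRw b l t u) {r : Variable → Variable → Prop}
    (hr : ∀ v t, Assoc b l v t → ∃ w, t = .var w ∧ r v w) : TmRen r t u := by
  induction h with
  | var h => obtain ⟨w, rfl, hw⟩ := hr _ _ h; exact .var hw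
  | func f h ih => exact .func f ih

theorem TmRen.tmRw {r : Variable → Variable → Prop} {t u : Tm L Sk} (h : TmRen r t u) {b : Bool}
    {l : List (Variable × Tm L Sk × Bool)} (hr : ∀ v w, r v w → Assoc b l v (.var w)) :
    TmRw b l t u := by
  induction h with
  | var h => exact .var (hr _ _ h)
  | func f h ih => exact .func f ih

/-- The flag `true` of the entries for bound variables excludes the new name on the right-hand side,
just as `bindRel` does. -/
theorem FmlRw.ren_of_assoc {b : Bool} {l : List (Variable × Tm L Sk × Bool)} {A A' : Fml L Sk}
    (h : FmlRw true b l A A') {r : Variable → Variable → Prop}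
    (hr : ∀ v t, Assoc b l v t → ∃ w, t = .var w ∧ r v w) : Ren r A A' := by
  generalize hm : true = m at h
  induction h generalizing r with
  | rel R h => exact .rel R fun i => (h i).tmRen hr
  | neg h ih => exact .neg (ih hr hm)
  | bin c h h' ih ih' =>
    cases c
    · exact .and (ih hr hm) (ih' hr hm)
    · exact .or (ih hr hm) (ih' hr hm)
  | sub q x h ih => cases hm
  | ren q x y h ih =>
    refine .quant q x y (ih (fun v t hv => ?_) hm)
    rcases hv with ⟨rfl, rfl⟩ | ⟨h1, h2, h3⟩
    · exact ⟨_, rfl, .inl ⟨rfl, rfl⟩⟩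
    · obtain ⟨w, rfl, hw⟩ := hr v t h3
      exact ⟨w, rfl, .inr ⟨h1, fun h => h2 rfl (by rw [h]), hw⟩⟩

theorem Ren.fmlRw {r : Variable → Variable → Prop} {A A' : Fml L Sk} (h : Ren r A A') :
    ∀ {b : Bool} {l : List (Variable × Tm L Sk × Bool)},
    (∀ v w, r v w → Assoc b l v (.var w)) → FmlRw true b l A A' := by
  induction h with
  | rel R h => exact fun hr => .rel R fun i => (h i).tmRw hr
  | neg h ih => exact fun hr => .neg (ih hr)
  | or h h' ih ih' => exact fun hr => .bin true (ih hr) (ih' hr)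
  | and h h' ih ih' => exact fun hr => .bin false (ih hr) (ih' hr)
  | quant q x y h ih =>
    refine fun hr => .ren q x y (ih fun v w hv => ?_)
    rcases hv with ⟨rfl, rfl⟩ | ⟨h1, h2, h3⟩
    · exact .inl ⟨rfl, rfl⟩
    · refine .inr ⟨h1, fun _ h => h2 ?_, hr v w h3⟩
      cases h; rfl

/-- For the empty list with default `true` the association is the identity, so only bound variables
may be renamed. -/
theorem fmlRw_variant {A A' : Fml L Sk} : FmlRw true true [] A A' ↔ Variant A A' :=
  ⟨fun h => h.ren_of_assoc fun v _ h => ⟨v, h.1, rfl⟩,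
    fun h => h.fmlRw fun _ _ h => ⟨by rw [h], .inl rfl⟩⟩

theorem fmlRw_replace {v : Variable} {t : Tm L Sk} {A A' : Fml L Sk} :
    FmlRw false true [(v, t, false)] A A' ↔ A' = A.subst (Function.update Term.var v t) := by
  refine ⟨fun h => h.eq_subst fun w u h => ?_, ?_⟩
  · rcases h with ⟨rfl, rfl⟩ | ⟨h1, -, h2, -⟩
    · simp
    · rw [Function.update_of_ne h1]; exact h2
  · rintro rfl
    refine fmlRw_subst A fun w _ => ?_
    by_cases hw : w = v
    · subst hw; exact .inl ⟨rfl, by simp⟩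
    · exact .inr ⟨hw, by simp, by rw [Function.update_of_ne hw], .inl rfl⟩

/-! ## Gödel numbers -/

section Coding

variable [Encodable (Σ m, L.Functions m)] [Encodable (Σ m, Sk m)]

theorem symCode_injective {m m' : ℕ} {f : FunSym L Sk m} {g : FunSym L Sk m'}
    (h : symCode f = symCode g) : (⟨m, f⟩ : Σ m, FunSym L Sk m) = ⟨m', g⟩ := by
  cases f <;> cases g <;> simp only [symCode, Nat.pair_eq_pair] at h <;>
    first
    | rfl
    | exact absurd h.1 (by decide)
    | (have h' := Encodable.encode_injective h.2; cases h'; rfl)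

theorem tmCode_injective : Function.Injective (tmCode : Tm L Sk → ℕ) := by
  intro t
  induction t with
  | var v =>
    intro u h
    cases u with
    | var w =>
      simp only [tmCode, Nat.pair_eq_pair] at h
      rw [Encodable.encode_injective h.2]
    | func g us => simp only [tmCode, Nat.pair_eq_pair] at h; exact absurd h.1 (by decide)
  | @func m f ts ih =>
    intro u h
    cases u with
    | var w => simp only [tmCode, Nat.pair_eq_pair] at h; exact absurd h.1 (by decide)
    | func g us =>
      simp only [tmCode, Nat.pair_eq_pair] at h
      have h1 := symCode_injective h.2.1
      have h2 := Encodable.encode_injective h.2.2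
      cases h1
      rw [List.ofFn_inj] at h2
      congr 1
      funext i
      exact ih i (congrFun h2 i)

theorem quantCode_injective : Function.Injective quantCode := by
  intro q q' h
  cases q <;> cases q' <;> first | rfl | exact absurd h (by decide)

variable [Encodable (Σ k, L.Relations k)]

theorem fmlCode_injective : Function.Injective (fmlCode : Fml L Sk → ℕ) := by
  intro A
  induction A with
  | rel R ts =>
    intro B h
    cases B <;> simp only [fmlCode, Nat.pair_eq_pair] at h
    · have h1 := Encodable.encode_injective h.2.1
      have h2 := Encodable.encode_injective h.2.2
      cases h1
      rw [List.ofFn_inj] at h2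
      congr 1
      funext i
      exact tmCode_injective (congrFun h2 i)
    all_goals exact absurd h.1 (by decide)
  | neg A ih =>
    intro B h
    cases B <;> simp only [fmlCode, Nat.pair_eq_pair] at h
    case neg B => rw [ih h.2]
    all_goals exact absurd h.1 (by decide)
  | or A A' ih ih' =>
    intro B h
    cases B <;> simp only [fmlCode, Nat.pair_eq_pair] at h
    case or B B' => rw [ih h.2.1, ih' h.2.2]
    all_goals exact absurd h.1 (by decide)
  | and A A' ih ih' =>
    intro B h
    cases B <;> simp only [fmlCode, Nat.pair_eq_pair] at h
    case and B B' => rw [ih h.2.1, ih' h.2.2]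
    all_goals exact absurd h.1 (by decide)
  | quant q x A ih =>
    intro B h
    cases B <;> simp only [fmlCode, Nat.pair_eq_pair] at h
    case quant q' x' B => rw [quantCode_injective h.2.1, h.2.2.1, ih h.2.2.2]
    all_goals exact absurd h.1 (by decide)

end Coding


/-! ## A system of rules that finds derivations -/

/-- Number of a truth value. -/
def boolCode : Bool → ℕ
  | true => 0
  | false => 1

theorem boolCode_injective : Function.Injective boolCode := by decide

theorem quantCode_gammaQ (p : Bool) : quantCode (gammaQ p) = boolCode p := by cases p <;> rfl

theorem quantCode_deltaQ (p : Bool) : quantCode (deltaQ p) = boolCode (!p) := by cases p <;> rfl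

section Coding

variable [Encodable (Σ m, L.Functions m)] [Encodable (Σ m, Sk m)]

/-- Gödel number of an association. -/
def entryCode (e : Variable × Tm L Sk × Bool) : ℕ :=
  Nat.pair (Nat.pair (Encodable.encode e.1) (tmCode e.2.1)) (boolCode e.2.2)

/-- Gödel number of a list of associations. -/
def assocCode (b : Bool) (l : List (Variable × Tm L Sk × Bool)) : ℕ :=
  Nat.pair (boolCode b) (Encodable.encode (l.map entryCode))

variable [Encodable (Σ k, L.Relations k)]

theorem fmlCode_alphaOp (p : Bool) (A B : Fml L Sk) :
    fmlCode (alphaOp p A B) = Nat.pair (boolCode p + 2) (Nat.pair (fmlCode A) (fmlCode B)) := by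
  cases p <;> rfl

/-- Gödel number of a list of signed formulas. -/
def signedCode (l : List (Bool × Fml L Sk)) : ℕ :=
  Encodable.encode (l.map fun e => Nat.pair (boolCode e.1) (fmlCode e.2))

/-- The meaning of the facts. -/
def Meaning (δ : DeltaFn L Sk) : List ℕ → Prop
  | [0, a, b] => a ≠ b
  | [1, f, k] => ∃ g : FunSym L Sk k, f = symCode g
  | [2, r, k] => ∃ R : L.Relations k, r = Encodable.encode (⟨k, R⟩ : Σ k, L.Relations k)
  -- Here and in several facts below, some entries are only assumed to be codes. Thus the clauses
  -- need not check that their parameters code anything.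
  | [3, c, vs, d] => ∀ (C : Fml L Sk) (X : List Variable), c = fmlCode C → vs = Encodable.encode X →
      d = Encodable.encode (⟨X.length, δ C X⟩ : Σ m, Sk m)
  | [4, p, q] => ∃ b, p = boolCode b ∧ q = boolCode (!b)
  | [5, s, v, t] => ∀ b l, s = assocCode (L := L) (Sk := Sk) b l →
      ∃ V T, v = Encodable.encode V ∧ t = tmCode T ∧ Assoc b l V T
  | [6, s, t, u] => ∀ b l, s = assocCode (L := L) (Sk := Sk) b l →
      ∃ T U, t = tmCode T ∧ u = tmCode U ∧ TmRw b l T U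
  | [7, s, ts, us, k] => ∀ b l, s = assocCode (L := L) (Sk := Sk) b l →
      ∃ Ts Us, ts = Encodable.encode (Ts.map tmCode) ∧ us = Encodable.encode (Us.map tmCode) ∧
        Ts.length = k ∧ List.Forall₂ (TmRw b l) Ts Us
  | [8, m, s, a, a'] => ∀ c b l, m = boolCode c → s = assocCode (L := L) (Sk := Sk) b l →
      ∃ A A', a = fmlCode A ∧ a' = fmlCode A' ∧ FmlRw c b l A A'
  | [9, t, k] => ∃ T : Tm L Sk, t = tmCode T ∧ height T ≤ k
  | [10, ts, m, k] => ∃ Ts : List (Tm L Sk), ts = Encodable.encode (Ts.map tmCode) ∧ Ts.length = m ∧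
      ∀ T ∈ Ts, height T ≤ k
  | [11, a, l] => ∀ l' : List ℕ, l = Encodable.encode l' → a ∈ l'
  | [12, a, l] => ∀ l' : List ℕ, l = Encodable.encode l' → a ∉ l'
  | [13, c, vs, s, ts] => ∀ C : Fml L Sk, c = fmlCode C → ∃ xs : List ℕ, xs.Nodup ∧
      (∀ x ∈ xs, Sum.inr x ∈ C.freeVars) ∧
      vs = Encodable.encode (xs.map Sum.inr : List Variable) ∧
      s = Encodable.encode (xs.map fun x =>
        entryCode (L := L) (Sk := Sk) (Sum.inr x, .var (Sum.inr x), false)) ∧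
      ts = Encodable.encode (xs.map fun x => tmCode (.var (Sum.inr x) : Tm L Sk))
  | [14, p, b, a] => ∃ c B A, p = boolCode c ∧ b = fmlCode B ∧ a = fmlCode A ∧ AStep δ c B A
  | [15, b, a, d] => ∃ B A D, b = fmlCode B ∧ a = fmlCode A ∧ d = Encodable.encode (D.map fmlCode) ∧
      IsDerivation δ B A D
  | [16, l, s, k] => ∃ S : List (ℕ × Tm L Sk),
      l = Encodable.encode (S.map fun e => (e.1, tmCode e.2)) ∧
      s = Encodable.encode (S.map fun e => entryCode (Sum.inr e.1, e.2, false)) ∧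
      ∀ e ∈ S, height e.2 ≤ k
  | [17, a, b] => ∀ l l' : List (Bool × Fml L Sk), a = signedCode l → b = signedCode l' →
      (∀ e ∈ l', e.2.QF) ∧ ∀ val : ∀ k : ℕ, L.Relations k → (Fin k → Tm L Sk) → Prop,
        ∃ e ∈ l ++ l', e.2.eval val ↔ e.1 = true
  | [18, a, n, w] => ∃ A B l D, a = fmlCode A ∧ w = witnessCode B l D ∧
      IsWitness δ n A B (listSubst l) D
  | _ => True

end Coding

namespace Pat

/-- The code of a non-empty list. -/
def cons (a l : Pat) : Pat := succ (pair a l)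

/-- The code of a term that is a variable. -/
def tvar (v : Pat) : Pat := pair 0 v

/-- The code of an association. -/
def entry (v t b : Pat) : Pat := pair (pair v t) b

/-- The code of the γ-variable with a given number. -/
def gam (v : Pat) : Pat := succ (dbl v)

end Pat

open Pat

/-- Clauses for substitution and renaming. -/
def rewriteClauses : List Clause :=
  [([], [4, 0, 1]),
   ([], [4, 1, 0]),
   ([], [1, pair 2 0, 0]),
   -- The default is coded by 0 for `true` and 1 for `false`. In the second case only ordinary
   -- variables, whose codes are even, are associated with themselves.
   ([], [5, pair 0 0, x 0, tvar (x 0)]),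
   ([], [5, pair 1 0, dbl (x 0), tvar (dbl (x 0))]),
   ([], [5, pair (x 0) (cons (entry (x 1) (x 2) (x 3)) (x 4)), x 1, x 2]),
   -- An entry is passed over if the variable differs; if its flag is 0, that is `true`, the term
   -- must differ too.
   ([[0, x 1, x 5], [5, pair (x 0) (x 4), x 5, x 6]],
    [5, pair (x 0) (cons (entry (x 1) (x 2) 1) (x 4)), x 5, x 6]),
   ([[0, x 1, x 5], [0, x 2, x 6], [5, pair (x 0) (x 4), x 5, x 6]],
    [5, pair (x 0) (cons (entry (x 1) (x 2) 0) (x 4)), x 5, x 6]),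
   ([[5, x 0, x 1, x 2]], [6, x 0, tvar (x 1), x 2]),
   ([[1, x 1, x 4], [7, x 0, x 2, x 3, x 4]],
    [6, x 0, pair 1 (pair (x 1) (x 2)), pair 1 (pair (x 1) (x 3))]),
   ([], [7, x 0, 0, 0, 0]),
   ([[6, x 0, x 1, x 2], [7, x 0, x 3, x 4, x 5]],
    [7, x 0, cons (x 1) (x 3), cons (x 2) (x 4), succ (x 5)]),
   ([[2, x 2, x 5], [7, x 1, x 3, x 4, x 5]],
    [8, x 0, x 1, pair 0 (pair (x 2) (x 3)), pair 0 (pair (x 2) (x 4))]),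
   ([[8, x 0, x 1, x 2, x 3]], [8, x 0, x 1, pair 1 (x 2), pair 1 (x 3)]),
   ([[4, x 6, x 7], [8, x 0, x 1, x 2, x 3], [8, x 0, x 1, x 4, x 5]],
    [8, x 0, x 1, pair (succ (succ (x 6))) (pair (x 2) (x 4)),
      pair (succ (succ (x 6))) (pair (x 3) (x 5))]),
   -- Mode 1 is substitution, where a bound variable shields itself; mode 0 is renaming, where the
   -- two bound variables are paired.
   ([[4, x 0, x 1], [8, 1, pair (x 2) (cons (entry (dbl (x 3)) (tvar (dbl (x 3))) 1) (x 4)), x 5, x 6]],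
    [8, 1, pair (x 2) (x 4), pair 4 (pair (x 0) (pair (x 3) (x 5))),
      pair 4 (pair (x 0) (pair (x 3) (x 6)))]),
   ([[4, x 0, x 1], [8, 0, pair (x 2) (cons (entry (dbl (x 3)) (tvar (dbl (x 7))) 0) (x 4)), x 5, x 6]],
    [8, 0, pair (x 2) (x 4), pair 4 (pair (x 0) (pair (x 3) (x 5))),
      pair 4 (pair (x 0) (pair (x 7) (x 6)))])]

/-- Clauses for the height of terms. -/
def heightClauses : List Clause :=
  [([], [9, tvar (x 0), succ (x 1)]),
   ([[1, x 0, x 1], [10, x 2, x 1, x 3]], [9, pair 1 (pair (x 0) (x 2)), succ (x 3)]),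
   ([], [10, 0, 0, x 0]),
   ([[9, x 0, x 3], [10, x 1, x 2, x 3]], [10, cons (x 0) (x 1), succ (x 2), x 3])]

/-- Clauses for the inferences of the calculus. -/
def stepClauses : List Clause :=
  [([], [12, x 0, 0]),
   ([[0, x 0, x 1], [12, x 0, x 2]], [12, x 0, cons (x 1) (x 2)]),
   ([], [13, x 0, 0, 0, 0]),
   -- That a γ-variable occurs in the formula is certified positively: replacing it by the next
   -- γ-variable yields a different code.
   ([[13, x 0, x 1, x 2, x 3], [12, gam (x 4), x 1],
     [8, 1, pair 0 (cons (entry (gam (x 4)) (tvar (gam (succ (x 4)))) 1) 0), x 0, x 5],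
     [0, x 0, x 5]],
    [13, x 0, cons (gam (x 4)) (x 1), cons (entry (gam (x 4)) (tvar (gam (x 4))) 1) (x 2),
      cons (tvar (gam (x 4))) (x 3)]),
   ([[4, x 0, x 1], [8, 0, pair 0 0, x 2, x 3]],
    [14, x 0, pair (succ (succ (x 0))) (pair (x 2) (x 3)), x 2]),
   ([[4, x 0, x 1], [8, 1, pair 0 (cons (entry (dbl (x 2)) (tvar (gam (x 2))) 1) 0), x 3, x 4]],
    [14, x 0, x 4, pair 4 (pair (x 0) (pair (x 2) (x 3)))]),
   -- The premise on `x 3` merely states that it codes a formula. The premise with `pair 1 (x 5)`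
   -- rewrites the quantified formula by an identity that is defined only on listed γ-variables; so
   -- the list is complete.
   ([[4, x 0, x 1], [8, 0, pair 0 0, x 3, x 3], [13, pair 4 (pair (x 1) (pair (x 2) (x 3))), x 4, x 5, x 6],
     [8, 1, pair 1 (x 5), pair 4 (pair (x 1) (pair (x 2) (x 3))), x 7],
     [3, pair 4 (pair (x 1) (pair (x 2) (x 3))), x 4, x 8],
     [8, 1, pair 0 (cons (entry (dbl (x 2)) (pair 1 (pair (pair 1 (x 8)) (x 6))) 1) 0), x 3, x 9]],
    [14, x 0, x 9, pair 4 (pair (x 1) (pair (x 2) (x 3)))]),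
   ([[4, x 0, x 1], [14, x 1, x 2, x 3]], [14, x 0, pair 1 (x 2), pair 1 (x 3)]),
   ([[4, x 4, x 5], [14, x 0, x 1, x 2], [8, 0, pair 0 0, x 3, x 3]],
    [14, x 0, pair (succ (succ (x 4))) (pair (x 1) (x 3)),
      pair (succ (succ (x 4))) (pair (x 2) (x 3))]),
   ([[4, x 4, x 5], [14, x 0, x 1, x 2], [8, 0, pair 0 0, x 3, x 3]],
    [14, x 0, pair (succ (succ (x 4))) (pair (x 3) (x 1)),
      pair (succ (succ (x 4))) (pair (x 3) (x 2))]),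
   ([[8, 0, pair 0 0, x 0, x 0]], [15, x 0, x 0, cons (x 0) 0]),
   ([[14, 0, x 0, x 1], [15, x 1, x 2, x 3]], [15, x 0, x 2, cons (x 0) (x 3)])]

/-- Clauses for sentential tautologies. -/
def tautologyClauses : List Clause :=
  [([], [11, x 0, cons (x 0) (x 1)]),
   ([[11, x 0, x 2]], [11, x 0, cons (x 1) (x 2)]),
   ([[17, x 0, cons (pair (x 1) (x 2)) (cons (pair (x 1) (x 3)) (x 4))]],
    [17, x 0, cons (pair (x 1) (pair (succ (succ (x 1))) (pair (x 2) (x 3)))) (x 4)]),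
   -- The codes 2 and 3 of ∨ and ∧ are those of the signs plus 2. Equal codes mean that one member
   -- suffices, opposite codes that both are required.
   ([[4, x 1, x 5], [17, x 0, cons (pair (x 1) (x 2)) (x 4)],
     [17, x 0, cons (pair (x 1) (x 3)) (x 4)]],
    [17, x 0, cons (pair (x 1) (pair (succ (succ (x 5))) (pair (x 2) (x 3)))) (x 4)]),
   ([[4, x 1, x 2], [17, x 0, cons (pair (x 2) (x 3)) (x 4)]],
    [17, x 0, cons (pair (x 1) (pair 1 (x 3))) (x 4)]),
   ([[17, cons (pair (x 1) (pair 0 (x 2))) (x 0), x 3]],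
    [17, x 0, cons (pair (x 1) (pair 0 (x 2))) (x 3)]),
   ([[11, pair 0 (x 0), x 1], [11, pair 1 (x 0), x 1]], [17, x 1, 0])]

/-- Clauses for witnesses. -/
def witnessClauses : List Clause :=
  [([], [16, 0, 0, x 0]),
   ([[9, x 1, x 4], [16, x 2, x 3, x 4]],
    [16, cons (pair (x 0) (x 1)) (x 2), cons (entry (gam (x 0)) (x 1) 1) (x 3), x 4]),
   -- The heights are at most `x 5`, hence below its successor, which is the order. Default `false`
   -- forces the list to cover all γ-variables of the premise.
   ([[15, x 0, x 1, x 2], [16, x 3, x 4, x 5], [8, 1, pair 1 (x 4), x 0, x 6],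
     [17, 0, cons (pair 0 (x 6)) 0]],
    [18, x 1, succ (x 5), pair (x 0) (pair (x 3) (x 2))])]

/-! ### Inversion of codes -/

theorem encode_eq_zero {l : List ℕ} : 0 = Encodable.encode l ↔ l = [] := by
  cases l <;> simp

theorem encode_eq_cons {a b : ℕ} {l : List ℕ} :
    Nat.pair a b + 1 = Encodable.encode l ↔ ∃ l', l = a :: l' ∧ b = Encodable.encode l' := by
  cases l with
  | nil => simp
  | cons c l =>
    simp only [Encodable.encode_list_cons, Encodable.encode_nat, Nat.succ_eq_add_one,
      Nat.add_right_cancel_iff, Nat.pair_eq_pair, List.cons.injEq]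
    constructor
    · rintro ⟨rfl, rfl⟩; exact ⟨l, ⟨rfl, rfl⟩, rfl⟩
    · rintro ⟨l', ⟨rfl, rfl⟩, rfl⟩; exact ⟨rfl, rfl⟩


theorem height_func {m : ℕ} (f : FunSym L Sk m) (ts : Fin m → Tm L Sk) :
    height (Term.func (L := extLang L Sk) f ts) = 1 + Finset.univ.sup fun i => height (ts i) := rfl

theorem exists_encode_eq (n : ℕ) : ∃ v : Variable, n = Encodable.encode v := by
  rcases Nat.even_or_odd' n with ⟨k, rfl | rfl⟩
  · exact ⟨.inl k, by simp [Encodable.encode_inl]⟩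
  · exact ⟨.inr k, by simp [Encodable.encode_inr]⟩

theorem encode_map_encode (X : List Variable) :
    Encodable.encode (X.map Encodable.encode) = Encodable.encode X := by
  induction X with
  | nil => rfl
  | cons a X ih => simp only [List.map_cons, Encodable.encode_list_cons, ih, Encodable.encode_nat]

section Inversion

variable [Encodable (Σ m, L.Functions m)] [Encodable (Σ m, Sk m)]

theorem pair_zero_eq_assocCode {a : ℕ} {b : Bool} {l : List (Variable × Tm L Sk × Bool)} :
    Nat.pair a 0 = assocCode b l ↔ a = boolCode b ∧ l = [] := by
  rw [assocCode, Nat.pair_eq_pair, encode_eq_zero, List.map_eq_nil_iff]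

theorem pair_cons_eq_assocCode {a e r : ℕ} {b : Bool} {l : List (Variable × Tm L Sk × Bool)} :
    Nat.pair a (Nat.pair e r + 1) = assocCode b l ↔
      ∃ e' l', l = e' :: l' ∧ e = entryCode e' ∧ Nat.pair a r = assocCode b l' := by
  rw [assocCode, Nat.pair_eq_pair, encode_eq_cons]
  constructor
  · rintro ⟨rfl, l', hl, rfl⟩
    obtain ⟨e', l', rfl, rfl, rfl⟩ := List.map_eq_cons_iff.1 hl
    exact ⟨e', l', rfl, rfl, rfl⟩
  · rintro ⟨e', l', rfl, rfl, h⟩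
    rw [assocCode, Nat.pair_eq_pair] at h
    exact ⟨h.1, _, List.map_cons, h.2⟩

theorem map_tmCode_eq_ofFn {Ts : List (Tm L Sk)} {k : ℕ} (h : Ts.length = k) :
    Ts.map tmCode = List.ofFn fun i : Fin k => tmCode (Ts.get (i.cast h.symm)) := by
  subst h
  apply List.ext_getElem <;> simp

theorem tmCode_func {m : ℕ} (f : FunSym L Sk m) (ts : Fin m → Tm L Sk) :
    tmCode (Term.func (L := extLang L Sk) f ts) =
      Nat.pair 1 (Nat.pair (symCode f) (Encodable.encode (List.ofFn fun i => tmCode (ts i)))) := rfl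

theorem tmCode_deltaTerm (δ : DeltaFn L Sk) (C : Fml L Sk) (X : List Variable) :
    tmCode (deltaTerm δ C X) =
      Nat.pair 1 (Nat.pair (Nat.pair 1 (Encodable.encode (⟨X.length, δ C X⟩ : Σ m, Sk m)))
        (Encodable.encode (X.map fun v => tmCode (.var v : Tm L Sk)))) := by
  rw [deltaTerm, tmCode_func, symCode]
  congr 3
  apply List.ext_getElem <;> simp

variable [Encodable (Σ k, L.Relations k)]

theorem cons_eq_signedCode {p a r : ℕ} {l : List (Bool × Fml L Sk)}
    (h : Nat.pair (Nat.pair p a) r + 1 = signedCode l) :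
    ∃ c A l', l = (c, A) :: l' ∧ p = boolCode c ∧ a = fmlCode A ∧ r = signedCode l' := by
  obtain ⟨l', hl, rfl⟩ := encode_eq_cons.1 h
  obtain ⟨e, l', rfl, he, rfl⟩ := List.map_eq_cons_iff.1 hl
  rw [Nat.pair_eq_pair] at he
  exact ⟨e.1, e.2, l', rfl, he.1.symm, he.2.symm, rfl⟩

theorem eq_alphaOp_of_code {c : Bool} {a b : ℕ} {A : Fml L Sk}
    (h : Nat.pair (boolCode c + 1 + 1) (Nat.pair a b) = fmlCode A) :
    ∃ B C, A = alphaOp c B C ∧ a = fmlCode B ∧ b = fmlCode C := by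
  cases A <;> cases c <;> simp [fmlCode, boolCode, alphaOp, Nat.pair_eq_pair] at h ⊢ <;> exact h

theorem eq_neg_of_code {a : ℕ} {A : Fml L Sk} (h : Nat.pair 1 a = fmlCode A) :
    ∃ B, A = .neg B ∧ a = fmlCode B := by
  cases A <;> simp [fmlCode, Nat.pair_eq_pair] at h ⊢
  exact h

theorem eq_rel_of_code {a : ℕ} {A : Fml L Sk} (h : Nat.pair 0 a = fmlCode A) :
    ∃ (k : ℕ) (R : L.Relations k) (ts : Fin k → Tm L Sk), A = .rel R ts := by
  cases A <;> simp [fmlCode, Nat.pair_eq_pair] at h ⊢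

end Inversion

/-! ### Soundness of the clauses -/

theorem eval_alphaOp_iff {val : ∀ k : ℕ, L.Relations k → (Fin k → Tm L Sk) → Prop} {c : Bool}
    {A B : Fml L Sk} : ((alphaOp c A B).eval val ↔ c = true) ↔
      (A.eval val ↔ c = true) ∨ (B.eval val ↔ c = true) := by
  cases c
  · simp [alphaOp, Fml.eval, imp_iff_not_or]
  · simp [alphaOp, Fml.eval]

theorem eval_alphaOp_not_iff {val : ∀ k : ℕ, L.Relations k → (Fin k → Tm L Sk) → Prop} {c : Bool}
    {A B : Fml L Sk} : ((alphaOp (!c) A B).eval val ↔ c = true) ↔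
      (A.eval val ↔ c = true) ∧ (B.eval val ↔ c = true) := by
  cases c <;> simp [alphaOp, Fml.eval]

theorem qf_alphaOp {c : Bool} {A B : Fml L Sk} : (alphaOp c A B).QF ↔ A.QF ∧ B.QF := by
  cases c <;> rfl

/-- In both readings of the list the first entry for a variable counts. With default `false` a
γ-variable must have an entry, which transfers the height bound of the list to the substitution. -/
theorem assoc_listSubst {S : List (ℕ × Tm L Sk)} {v : Variable} {t : Tm L Sk} :
    Assoc false (S.map fun e => (Sum.inr e.1, e.2, false)) v t ↔
      t = Sum.elim (fun x => .var (Sum.inl x)) (listSubst S) v ∧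
        (v.isLeft ∨ ∃ e ∈ S, v = Sum.inr e.1 ∧ t = e.2) := by
  induction S with
  | nil => cases v <;> simp [Assoc]
  | cons e S ih =>
    rw [List.map_cons, Assoc, ih]
    obtain ⟨y, u⟩ := e
    cases v with
    | inl x => simp
    | inr x =>
      by_cases hx : x = y
      · subst hx
        simp [listSubst, List.lookup]
        tauto
      · have : (x == y) = false := by simpa using hx
        simp [listSubst, List.lookup, this, hx]

/-- With default `false`, having an association at all proves that a γ-variable is listed. -/
theorem mem_of_assoc {xs : List ℕ} {x : ℕ} {t : Tm L Sk}
    (h : Assoc false (xs.map fun x => (Sum.inr x, .var (Sum.inr x), false)) (.inr x) t) : x ∈ xs := by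
  induction xs with
  | nil => simp [Assoc] at h
  | cons y xs ih =>
    rcases h with ⟨h, -⟩ | ⟨-, -, h⟩
    · cases h; exact .head _
    · exact .tail _ (ih h)

section Soundness

variable [Encodable (Σ m, L.Functions m)] [Encodable (Σ m, Sk m)] [Encodable (Σ k, L.Relations k)]

theorem preserves_rewriteClauses (δ : DeltaFn L Sk) : Preserves (Meaning δ) rewriteClauses := by
  refine .cons ?_ <| .cons ?_ <| .cons ?_ <| .cons ?_ <| .cons ?_ <| .cons ?_ <| .cons ?_ <|
    .cons ?_ <| .cons ?_ <| .cons ?_ <| .cons ?_ <| .cons ?_ <| .cons ?_ <| .cons ?_ <|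
    .cons ?_ <| .cons ?_ <| .cons ?_ <| preserves_nil _
  all_goals
    intro ρ h
    simp only [List.map_cons, List.map_nil, List.forall_mem_cons, Pat.eval,
      Pat.cons, Pat.tvar, Pat.entry, Meaning] at h ⊢
  · exact ⟨true, rfl, rfl⟩
  · exact ⟨false, rfl, rfl⟩
  · exact ⟨.bullet, rfl⟩
  · intro b l hs
    obtain ⟨hb, rfl⟩ := pair_zero_eq_assocCode.1 hs
    obtain ⟨V, hV⟩ := exists_encode_eq (ρ 0)
    exact ⟨V, .var V, hV, by rw [hV, tmCode], rfl, .inl (boolCode_injective hb.symm)⟩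
  · intro b l hs
    obtain ⟨hb, rfl⟩ := pair_zero_eq_assocCode.1 hs
    exact ⟨.inl (ρ 0), .var (.inl (ρ 0)), by simp [Encodable.encode_inl],
      by simp [tmCode, Encodable.encode_inl], rfl, .inr rfl⟩
  · intro b l hs
    obtain ⟨e, l, rfl, he, -⟩ := pair_cons_eq_assocCode.1 hs
    simp only [entryCode, Nat.pair_eq_pair] at he
    exact ⟨e.1, e.2.1, he.1.1, he.1.2, .inl ⟨rfl, rfl⟩⟩
  · intro b l hs
    obtain ⟨h1, h2, -⟩ := h
    obtain ⟨e, l, rfl, he, hl⟩ := pair_cons_eq_assocCode.1 hs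
    simp only [entryCode, Nat.pair_eq_pair] at he
    obtain ⟨V, T, hV, hT, hA⟩ := h2 b l hl
    have h3 : e.2.2 = false := boolCode_injective he.2.symm
    exact ⟨V, T, hV, hT, .inr ⟨fun h => h1 (by rw [he.1.1, hV, h]), by simp [h3], hA⟩⟩
  · intro b l hs
    obtain ⟨h1, h1', h2, -⟩ := h
    obtain ⟨e, l, rfl, he, hl⟩ := pair_cons_eq_assocCode.1 hs
    simp only [entryCode, Nat.pair_eq_pair] at he
    obtain ⟨V, T, hV, hT, hA⟩ := h2 b l hl
    exact ⟨V, T, hV, hT, .inr ⟨fun h => h1 (by rw [he.1.1, hV, h]),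
      fun _ h => h1' (by rw [he.1.2, hT, h]), hA⟩⟩
  · intro b l hs
    obtain ⟨V, T, hV, hT, hA⟩ := h.1 b l hs
    exact ⟨.var V, T, by rw [hV, tmCode], hT, .var hA⟩
  · intro b l hs
    obtain ⟨⟨g, hg⟩, h2, -⟩ := h
    obtain ⟨Ts, Us, hT, hU, hk, h3⟩ := h2 b l hs
    have hk' : Us.length = ρ 4 := h3.length_eq.symm.trans hk
    refine ⟨.func g fun i => Ts.get (i.cast hk.symm), .func g fun i => Us.get (i.cast hk'.symm),
      ?_, ?_, .func _ fun i => h3.get _ _⟩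
    · rw [tmCode_func, ← hg, hT, map_tmCode_eq_ofFn hk]
    · rw [tmCode_func, ← hg, hU, map_tmCode_eq_ofFn hk']
  · exact fun b l hs => ⟨[], [], rfl, rfl, rfl, .nil⟩
  · intro b l hs
    obtain ⟨h1, h2, -⟩ := h
    obtain ⟨T, U, hT, hU, h3⟩ := h1 b l hs
    obtain ⟨Ts, Us, hTs, hUs, hk, h4⟩ := h2 b l hs
    exact ⟨T :: Ts, U :: Us, by rw [hT, hTs]; rfl, by rw [hU, hUs]; rfl, by simp [hk], .cons h3 h4⟩
  · intro c b l _ hs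
    obtain ⟨⟨R, hR⟩, h2, -⟩ := h
    obtain ⟨Ts, Us, hT, hU, hk, h3⟩ := h2 b l hs
    have hk' : Us.length = ρ 5 := h3.length_eq.symm.trans hk
    refine ⟨.rel R fun i => Ts.get (i.cast hk.symm), .rel R fun i => Us.get (i.cast hk'.symm),
      ?_, ?_, .rel _ fun i => h3.get _ _⟩
    · rw [fmlCode, ← hR, hT, map_tmCode_eq_ofFn hk]
    · rw [fmlCode, ← hR, hU, map_tmCode_eq_ofFn hk']
  · intro c b l hc hs
    obtain ⟨A, A', hA, hA', h1⟩ := h.1 c b l hc hs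
    exact ⟨.neg A, .neg A', by rw [hA, fmlCode], by rw [hA', fmlCode], .neg h1⟩
  · intro c b l hc hs
    obtain ⟨⟨q, hq, -⟩, h1, h2, -⟩ := h
    obtain ⟨A, A', hA, hA', h1⟩ := h1 c b l hc hs
    obtain ⟨B, B', hB, hB', h2⟩ := h2 c b l hc hs
    exact ⟨alphaOp q A B, alphaOp q A' B', by rw [hA, hB, hq, fmlCode_alphaOp],
      by rw [hA', hB', hq, fmlCode_alphaOp], .bin q h1 h2⟩
  · intro c b l hc hs
    obtain ⟨⟨q, hq, -⟩, h1, -⟩ := h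
    cases c with
    | true => exact absurd hc (by decide)
    | false =>
      obtain ⟨A, A', hA, hA', h1⟩ := h1 false b ((.inl (ρ 3), .var (.inl (ρ 3)), false) :: l) rfl
        (pair_cons_eq_assocCode.2 ⟨_, _, rfl, by
          simp [entryCode, tmCode, Encodable.encode_inl, boolCode], hs⟩)
      rw [← quantCode_gammaQ] at hq
      exact ⟨_, _, by rw [hA, hq, fmlCode], by rw [hA', hq, fmlCode], .sub (gammaQ q) (ρ 3) h1⟩
  · intro c b l hc hs
    obtain ⟨⟨q, hq, -⟩, h1, -⟩ := h
    cases c with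
    | false => exact absurd hc (by decide)
    | true =>
      obtain ⟨A, A', hA, hA', h1⟩ := h1 true b ((.inl (ρ 3), .var (.inl (ρ 7)), true) :: l) rfl
        (pair_cons_eq_assocCode.2 ⟨_, _, rfl, by
          simp [entryCode, tmCode, Encodable.encode_inl, boolCode], hs⟩)
      rw [← quantCode_gammaQ] at hq
      exact ⟨_, _, by rw [hA, hq, fmlCode], by rw [hA', hq, fmlCode],
        .ren (gammaQ q) (ρ 3) (ρ 7) h1⟩

theorem preserves_heightClauses (δ : DeltaFn L Sk) : Preserves (Meaning δ) heightClauses := by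
  refine .cons ?_ <| .cons ?_ <| .cons ?_ <| .cons ?_ <| preserves_nil _
  all_goals
    intro ρ h
    simp only [List.map_cons, List.map_nil, List.forall_mem_cons, Pat.eval,
      Pat.cons, Pat.tvar, Meaning] at h ⊢
  · obtain ⟨V, hV⟩ := exists_encode_eq (ρ 0)
    exact ⟨.var V, by rw [hV, tmCode], by simp [height]⟩
  · obtain ⟨⟨g, hg⟩, ⟨Ts, hT, hk, h⟩, -⟩ := h
    refine ⟨.func g fun i => Ts.get (i.cast hk.symm), ?_, ?_⟩
    · rw [tmCode_func, ← hg, hT, map_tmCode_eq_ofFn hk]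
    · rw [height_func, add_comm]
      exact Nat.add_le_add_right (Finset.sup_le fun i _ => h _ (List.get_mem _ _)) 1
  · exact ⟨[], rfl, rfl, by simp⟩
  · obtain ⟨⟨T, hT, h1⟩, ⟨Ts, hTs, hk, h2⟩, -⟩ := h
    exact ⟨T :: Ts, by rw [hT, hTs]; rfl, by simp [hk], List.forall_mem_cons.2 ⟨h1, h2⟩⟩

end Soundness


section Soundness

variable [Encodable (Σ m, L.Functions m)] [Encodable (Σ m, Sk m)] [Encodable (Σ k, L.Relations k)]

theorem preserves_tautologyClauses (δ : DeltaFn L Sk) : Preserves (Meaning δ) tautologyClauses := by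
  refine .cons ?_ <| .cons ?_ <| .cons ?_ <| .cons ?_ <| .cons ?_ <| .cons ?_ <| .cons ?_ <|
    preserves_nil _
  all_goals
    intro ρ h
    simp only [List.map_cons, List.map_nil, List.forall_mem_cons, Pat.eval,
      Pat.cons, Meaning] at h ⊢
  · intro l hl
    obtain ⟨l', rfl, -⟩ := encode_eq_cons.1 hl
    exact .head _
  · intro l hl
    obtain ⟨l', rfl, hl'⟩ := encode_eq_cons.1 hl
    exact .tail _ (h.1 l' hl')
  · intro l l' hl hl'
    obtain ⟨c, A, l', rfl, hc, hA, hl₂⟩ := cons_eq_signedCode hl'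
    rw [hc] at hA
    obtain ⟨B, C, rfl, hB, hC⟩ := eq_alphaOp_of_code hA
    obtain ⟨h1, h2⟩ := h.1 l ((c, B) :: (c, C) :: l') hl (by rw [hc, hB, hC, hl₂]; rfl)
    simp only [List.forall_mem_cons] at h1 ⊢
    simp only [List.mem_append, List.mem_cons, exists_or,
      or_and_right, exists_eq_left, qf_alphaOp, eval_alphaOp_iff] at h1 h2 ⊢
    refine ⟨⟨⟨h1.1, h1.2.1⟩, h1.2.2⟩, fun val => ?_⟩
    rcases h2 val with h | h | h | h
    · exact .inl h
    · exact .inr (.inl (.inl h))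
    · exact .inr (.inl (.inr h))
    · exact .inr (.inr h)
  · obtain ⟨⟨q, hq, hq'⟩, h1, h2, -⟩ := h
    intro l l' hl hl'
    obtain ⟨c, A, l', rfl, hc, hA, hl₂⟩ := cons_eq_signedCode hl'
    rw [hc] at hq
    obtain rfl := boolCode_injective hq
    rw [hq'] at hA
    obtain ⟨B, C, rfl, hB, hC⟩ := eq_alphaOp_of_code hA
    obtain ⟨h1, h2⟩ := And.intro (h1 l ((c, B) :: l') hl (by rw [hc, hB, hl₂]; rfl))
      (h2 l ((c, C) :: l') hl (by rw [hc, hC, hl₂]; rfl))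
    simp only [List.forall_mem_cons] at h1 h2 ⊢
    simp only [List.mem_append, List.mem_cons, exists_or,
      or_and_right, exists_eq_left, qf_alphaOp, eval_alphaOp_not_iff] at h1 h2 ⊢
    refine ⟨⟨⟨h1.1.1, h2.1.1⟩, h1.1.2⟩, fun val => ?_⟩
    rcases h1.2 val with h | h | h
    · exact .inl h
    · rcases h2.2 val with h' | h' | h'
      · exact .inl h'
      · exact .inr (.inl ⟨h, h'⟩)
      · exact .inr (.inr h')
    · exact .inr (.inr h)
  · obtain ⟨⟨q, hq, hq'⟩, h1, -⟩ := h
    intro l l' hl hl'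
    obtain ⟨c, A, l', rfl, hc, hA, hl₂⟩ := cons_eq_signedCode hl'
    rw [hc] at hq
    obtain rfl := boolCode_injective hq
    obtain ⟨B, rfl, hB⟩ := eq_neg_of_code hA
    have h1 := h1 l ((!c, B) :: l') hl (by rw [hq', hB, hl₂]; rfl)
    have hneg : ∀ val : ∀ k : ℕ, L.Relations k → (Fin k → Tm L Sk) → Prop,
        (B.neg.eval val ↔ c = true) ↔ (B.eval val ↔ (!c) = true) := fun val => by
      cases c <;> simp [Fml.eval]
    simp only [List.forall_mem_cons] at h1 ⊢
    simp only [List.mem_append, List.mem_cons, exists_or,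
      or_and_right, exists_eq_left, hneg] at h1 ⊢
    exact h1
  · intro l l' hl hl'
    obtain ⟨c, A, l', rfl, hc, hA, hl₂⟩ := cons_eq_signedCode hl'
    obtain ⟨k, R, ts, rfl⟩ := eq_rel_of_code hA
    have h1 := h.1 ((c, .rel R ts) :: l) l' (by rw [hc, hA, hl]; rfl) hl₂
    refine ⟨List.forall_mem_cons.2 ⟨trivial, h1.1⟩, fun val => ?_⟩
    obtain ⟨e, he, h2⟩ := h1.2 val
    refine ⟨e, ?_, h2⟩
    simp only [List.cons_append, List.mem_cons, List.mem_append] at he ⊢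
    tauto
  · obtain ⟨h1, h2, -⟩ := h
    intro l l' hl hl'
    obtain rfl : l' = [] := List.map_eq_nil_iff.1 (encode_eq_zero.1 hl')
    obtain ⟨⟨c, A⟩, he, h1⟩ := List.mem_map.1 (h1 _ hl)
    obtain ⟨⟨c', A'⟩, he', h2⟩ := List.mem_map.1 (h2 _ hl)
    rw [Nat.pair_eq_pair] at h1 h2
    obtain rfl : c = true := boolCode_injective h1.1
    obtain rfl : c' = false := boolCode_injective h2.1
    obtain rfl : A' = A := fmlCode_injective (h2.2.trans h1.2.symm)
    refine ⟨by simp, fun val => ?_⟩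
    rw [List.append_nil]
    by_cases hA : A'.eval val
    · exact ⟨_, he, by simp [hA]⟩
    · exact ⟨_, he', by simp [hA]⟩

theorem preserves_witnessClauses (δ : DeltaFn L Sk) : Preserves (Meaning δ) witnessClauses := by
  refine .cons ?_ <| .cons ?_ <| .cons ?_ <| preserves_nil _
  all_goals
    intro ρ h
    simp only [List.map_cons, List.map_nil, List.forall_mem_cons, Pat.eval,
      Pat.cons, Pat.entry, Pat.gam, Meaning] at h ⊢
  · exact ⟨[], rfl, rfl, by simp⟩
  · obtain ⟨⟨T, hT, h1⟩, ⟨S, hl, hs, h2⟩, -⟩ := h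
    refine ⟨(ρ 0, T) :: S, ?_, ?_, List.forall_mem_cons.2 ⟨h1, h2⟩⟩
    · rw [hT, hl]; rfl
    · rw [hT, hs]
      simp [entryCode, Encodable.encode_inr, boolCode]
  · obtain ⟨⟨B, A, D, hB, hA, hD, hder⟩, ⟨S, hl, hs, hS⟩, h1, h2, -⟩ := h
    obtain ⟨B', E, hB', hE, h1⟩ := h1 false false (S.map fun e => (Sum.inr e.1, e.2, false)) rfl
      (by rw [hs, assocCode, List.map_map]; rfl)
    obtain rfl : B' = B := fmlCode_injective (hB'.symm.trans hB)
    obtain ⟨hqf, hval⟩ := h2 [] [(true, E)] rfl (by rw [hE]; rfl)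
    have hEB : E = B'.instGamma (listSubst S) :=
      h1.eq_subst fun v t h => (assoc_listSubst.1 h).1
    simp only [List.nil_append, List.mem_singleton, forall_eq, exists_eq_left, iff_true] at hqf hval
    rw [hEB] at hqf hval
    refine ⟨A, B', S, D, hA, by rw [hB, hl, hD]; rfl, Fml.qf_subst.1 hqf, fun x hx => ?_,
      ⟨hqf, hval⟩, hder⟩
    obtain ⟨t, ht⟩ := h1.exists_assoc hx
    obtain ⟨h3, h4 | ⟨e, he, -, h4⟩⟩ := assoc_listSubst.1 ht
    · simp at h4
    · rw [Sum.elim_inr] at h3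
      rw [← h3, h4]
      exact Nat.lt_succ_of_le (hS e he)

end Soundness


/-- Substituting for a variable that does not occur free changes nothing; a change is thus a
certificate of occurrence. -/
theorem mem_freeVars_of_subst_ne {A : Fml L Sk} {v : Variable} {t : Tm L Sk}
    (h : A.subst (Function.update Term.var v t) ≠ A) : v ∈ A.freeVars := by
  by_contra hv
  refine h ((Fml.subst_congr fun w hw => ?_).trans A.subst_var)
  rw [Function.update_of_ne]
  rintro rfl
  exact hv hw

theorem AStep.alphaOp_left {δ : DeltaFn L Sk} {p : Bool} {A A' : Fml L Sk} (h : AStep δ p A A')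
    (c : Bool) (B : Fml L Sk) : AStep δ p (alphaOp c A B) (alphaOp c A' B) := by
  cases c
  · exact .andL h B
  · exact .orL h B

theorem AStep.alphaOp_right {δ : DeltaFn L Sk} {p : Bool} {A A' : Fml L Sk} (h : AStep δ p A A')
    (c : Bool) (B : Fml L Sk) : AStep δ p (alphaOp c B A) (alphaOp c B A') := by
  cases c
  · exact .andR B h
  · exact .orR B h

section Soundness

variable [Encodable (Σ m, L.Functions m)] [Encodable (Σ m, Sk m)]

theorem singleton_eq_assocCode (v : Variable) (t : Tm L Sk) :
    Nat.pair 0 (Nat.pair (Nat.pair (Nat.pair (Encodable.encode v) (tmCode t)) 1) 0 + 1) =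
      assocCode true [(v, t, false)] := rfl

variable [Encodable (Σ k, L.Relations k)]

theorem preserves_stepClauses (δ : DeltaFn L Sk) : Preserves (Meaning δ) stepClauses := by
  refine .cons ?_ <| .cons ?_ <| .cons ?_ <| .cons ?_ <| .cons ?_ <| .cons ?_ <| .cons ?_ <|
    .cons ?_ <| .cons ?_ <| .cons ?_ <| .cons ?_ <| .cons ?_ <| preserves_nil _
  all_goals
    intro ρ h
    simp only [List.map_cons, List.map_nil, List.forall_mem_cons, Pat.eval,
      Pat.cons, Pat.tvar, Pat.entry, Pat.gam, Meaning] at h ⊢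
  · intro l hl
    simp [encode_eq_zero.1 hl]
  · intro l hl
    obtain ⟨l', rfl, hl'⟩ := encode_eq_cons.1 hl
    exact List.not_mem_cons_of_ne_of_not_mem h.1 (h.2.1 l' hl')
  · exact fun C _ => ⟨[], by simp, by simp, rfl, rfl, rfl⟩
  · obtain ⟨h1, h2, h3, h4, -⟩ := h
    intro C hC
    obtain ⟨xs, hnd, hxs, hv, hs, ht⟩ := h1 C hC
    obtain ⟨A, A', hA, hA', h3⟩ := h3 false true [(.inr (ρ 4), .var (.inr (ρ 4 + 1)), false)] rfl
      (by rw [← singleton_eq_assocCode]; simp [tmCode, Encodable.encode_inr])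
    obtain rfl : A = C := fmlCode_injective (hA.symm.trans hC)
    rw [fmlRw_replace] at h3
    have hne : A' ≠ A := fun h => h4 (by rw [hA, hA', h])
    refine ⟨ρ 4 :: xs, List.nodup_cons.2 ⟨fun hx => ?_, hnd⟩,
      List.forall_mem_cons.2 ⟨mem_freeVars_of_subst_ne (h3 ▸ hne), hxs⟩, ?_, ?_, ?_⟩
    · refine h2 _ (by rw [hv, encode_map_encode]) ?_
      rw [List.mem_map]
      exact ⟨_, List.mem_map_of_mem hx, by simp [Encodable.encode_inr]⟩
    · rw [hv]; simp [Encodable.encode_inr]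
    · rw [hs]; simp [Encodable.encode_inr, entryCode, tmCode, boolCode]
    · rw [ht]; simp [Encodable.encode_inr, tmCode]
  · obtain ⟨⟨c, hc, -⟩, h1, -⟩ := h
    obtain ⟨A, A', hA, hA', h1⟩ := h1 true true [] rfl rfl
    exact ⟨c, _, _, hc, by rw [hA, hA', hc, fmlCode_alphaOp], hA,
      .simplification c A A' (fmlRw_variant.1 h1)⟩
  · obtain ⟨⟨c, hc, -⟩, h1, -⟩ := h
    obtain ⟨A, A', hA, hA', h1⟩ := h1 false true [(.inl (ρ 2), .var (.inr (ρ 2)), false)] rfl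
      (by rw [← singleton_eq_assocCode]; simp [tmCode, Encodable.encode_inr, Encodable.encode_inl])
    rw [fmlRw_replace] at h1
    rw [← quantCode_gammaQ] at hc
    exact ⟨c, A.replace (ρ 2) (.var (.inr (ρ 2))), _, by rw [hc, quantCode_gammaQ], by rw [hA', h1]; rfl,
      by rw [hA, hc, fmlCode], .gamma c (ρ 2) A⟩
  · obtain ⟨⟨c, hc, hc'⟩, h0, h1, h2, h3, h4, -⟩ := h
    obtain ⟨H, -, hH, -⟩ := h0 true true [] rfl rfl
    rw [← quantCode_deltaQ] at hc'
    have hC : Nat.pair 4 (Nat.pair (ρ 1) (Nat.pair (ρ 2) (ρ 3))) =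
        fmlCode (.quant (deltaQ c) (ρ 2) H) := by rw [fmlCode, hc', hH]
    rw [hC] at h1 h2 h3 ⊢
    obtain ⟨xs, hnd, hxs, hv, hs, ht⟩ := h1 _ rfl
    obtain ⟨A, A', hA, -, h2⟩ := h2 false false
      (xs.map fun x => (Sum.inr x, .var (Sum.inr x), false)) rfl
      (by rw [hs, assocCode, List.map_map]; rfl)
    obtain rfl := fmlCode_injective hA
    have h3 := h3 _ _ rfl hv
    obtain ⟨B, B', hB, hB', h4⟩ := h4 false true
      [(.inl (ρ 2), deltaTerm δ (.quant (deltaQ c) (ρ 2) H) (xs.map Sum.inr), false)] rfl (by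
        rw [← singleton_eq_assocCode, tmCode_deltaTerm, ← h3, ht, List.map_map]
        simp [Encodable.encode_inl, Function.comp_def])
    obtain rfl : B = H := fmlCode_injective (hB.symm.trans hH)
    rw [fmlRw_replace] at h4
    refine ⟨c, _, _, hc, ?_, rfl, .delta c (ρ 2) B xs hnd fun x => ⟨hxs x, fun hx => ?_⟩⟩
    · rw [hB', h4]; rfl
    -- The identity rewriting of the formula associates each free γ-variable with something, which
    -- gives the missing inclusion.
    · obtain ⟨t, ht⟩ := h2.exists_assoc hx
      exact mem_of_assoc ht
  · obtain ⟨⟨c, hc, hc'⟩, ⟨c', B, A, h1, hB, hA, h2⟩, -⟩ := h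
    rw [hc'] at h1
    obtain rfl := boolCode_injective h1
    exact ⟨c, _, _, hc, by rw [hB, fmlCode], by rw [hA, fmlCode], .neg h2⟩
  · obtain ⟨⟨q, hq, -⟩, ⟨c, B, A, hc, hB, hA, h1⟩, h2, -⟩ := h
    obtain ⟨H, -, hH, -⟩ := h2 true true [] rfl rfl
    exact ⟨c, _, _, hc, by rw [hq, hB, hH, fmlCode_alphaOp], by rw [hq, hA, hH, fmlCode_alphaOp],
      h1.alphaOp_left q H⟩
  · obtain ⟨⟨q, hq, -⟩, ⟨c, B, A, hc, hB, hA, h1⟩, h2, -⟩ := h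
    obtain ⟨H, -, hH, -⟩ := h2 true true [] rfl rfl
    exact ⟨c, _, _, hc, by rw [hq, hB, hH, fmlCode_alphaOp], by rw [hq, hA, hH, fmlCode_alphaOp],
      h1.alphaOp_right q H⟩
  · obtain ⟨H, -, hH, -⟩ := h.1 true true [] rfl rfl
    exact ⟨H, H, [H], hH, hH, by rw [hH]; rfl, by simp [IsDerivation]⟩
  · obtain ⟨⟨c, B, A, hc, hB, hA, h1⟩, ⟨A', E, D, hA', hE, hD, h2⟩, -⟩ := h
    obtain rfl : true = c := boolCode_injective hc
    obtain rfl : A' = A := fmlCode_injective (hA'.symm.trans hA)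
    refine ⟨B, E, B :: D, hB, hE, by rw [hB, hD]; rfl, ?_⟩
    obtain ⟨h2, h3, h4⟩ := h2
    obtain ⟨A'', D, rfl⟩ := List.exists_cons_of_ne_nil (fun h : D = [] => by simp [h] at h3)
    cases h3
    exact ⟨List.isChain_cons_cons.2 ⟨h1.step, h2⟩, rfl, by rw [List.getLast?_cons_cons]; exact h4⟩

end Soundness

/-! ### The rules for symbols -/

section Oracles

variable [Primcodable (Σ m, L.Functions m)] [Primcodable (Σ k, L.Relations k)]
  [Primcodable (Σ m, Sk m)]

/-- Different numbers. -/
def neRule : Rule := fun env =>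
  if env.getD 0 0 = env.getD 1 0 then none else some ([], [0, env.getD 0 0, env.getD 1 0])

variable (L Sk) in
/-- Arities of the function symbols of the signature. -/
def functionRule : Rule := fun env =>
  (Encodable.decode (α := Σ m, L.Functions m) (env.getD 0 0)).map fun s =>
    ([], [1, Nat.pair 0 (Encodable.encode s), s.1])

variable (Sk) in
/-- Arities of the Skolem symbols. -/
def skolemRule : Rule := fun env =>
  (Encodable.decode (α := Σ m, Sk m) (env.getD 0 0)).map fun s =>
    ([], [1, Nat.pair 1 (Encodable.encode s), s.1])

variable (L) in
/-- Arities of the relation symbols. -/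
def relationRule : Rule := fun env =>
  (Encodable.decode (α := Σ k, L.Relations k) (env.getD 0 0)).map fun s =>
    ([], [2, Encodable.encode s, s.1])

/-- Values of the function δ. -/
def deltaRule (d : ℕ → ℕ) : Rule := fun env =>
  some ([], [3, env.getD 0 0, env.getD 1 0, d (Nat.pair (env.getD 0 0) (env.getD 1 0))])

theorem computable_getD_zero (i : ℕ) : Computable fun env : List ℕ => env.getD i 0 :=
  ((Primrec.list_getD 0).comp .id (.const i)).to_comp

theorem computable_neRule : Computable neRule := by
  have h (i : ℕ) : Primrec fun env : List ℕ => env.getD i 0 :=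
    (Primrec.list_getD 0).comp .id (.const i)
  refine (Primrec.ite (Primrec.eq.comp (h 0) (h 1)) (.const none) (Primrec.option_some.comp
    (Primrec.pair (.const []) ?_))).to_comp
  exact Primrec.list_cons.comp (.const 0) (Primrec.list_cons.comp (h 0)
    (Primrec.list_cons.comp (h 1) (.const [])))

theorem computable_symbolRule {α : Type*} [Primcodable α] {a : α → ℕ} (ha : Computable a) (k : ℕ)
    {f : ℕ → ℕ} (hf : Computable f) : Computable fun env : List ℕ =>
      (Encodable.decode (α := α) (env.getD 0 0)).map fun s =>
        (([] : List (List ℕ)), [k, f (Encodable.encode s), a s]) := by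
  refine Computable.option_map (Computable.decode.comp (computable_getD_zero 0))
    (Computable.pair (.const []) ?_)
  exact Computable.list_cons.comp (.const k) (Computable.list_cons.comp
    (hf.comp (Computable.encode.comp .snd)) (Computable.list_cons.comp (ha.comp .snd) (.const [])))

theorem computable_deltaRule {d : ℕ → ℕ} (hd : Computable d) : Computable (deltaRule d) := by
  have h := computable_getD_zero
  refine Computable.option_some.comp (Computable.pair (.const []) ?_)
  exact Computable.list_cons.comp (.const 3) (Computable.list_cons.comp (h 0)
    (Computable.list_cons.comp (h 1) (Computable.list_cons.comp
      (hd.comp ((Primrec₂.natPair.to_comp).comp (h 0) (h 1))) (.const []))))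

/-- All clauses. -/
def clauses : List Clause :=
  rewriteClauses ++ (heightClauses ++ (stepClauses ++ (tautologyClauses ++ witnessClauses)))

variable (L Sk) in
/-- All rules. -/
def rules (d : ℕ → ℕ) : List Rule :=
  neRule :: functionRule L :: skolemRule Sk :: relationRule L :: deltaRule d ::
    clauses.map Clause.rule

theorem computable_rules (hf : Computable (Sigma.fst : (Σ m, L.Functions m) → ℕ))
    (hr : Computable (Sigma.fst : (Σ k, L.Relations k) → ℕ))
    (hs : Computable (Sigma.fst : (Σ m, Sk m) → ℕ)) {d : ℕ → ℕ} (hd : Computable d) :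
    ∀ r ∈ rules L Sk d, Computable r := by
  refine List.forall_mem_cons.2 ⟨computable_neRule, List.forall_mem_cons.2 ⟨?_,
    List.forall_mem_cons.2 ⟨?_, List.forall_mem_cons.2 ⟨?_, List.forall_mem_cons.2
      ⟨computable_deltaRule hd, ?_⟩⟩⟩⟩⟩
  · exact computable_symbolRule hf 1 ((Primrec₂.natPair.to_comp).comp (.const 0) .id)
  · exact computable_symbolRule hs 1 ((Primrec₂.natPair.to_comp).comp (.const 1) .id)
  · exact computable_symbolRule hr 2 .id
  · intro r hr
    obtain ⟨c, -, rfl⟩ := List.mem_map.1 hr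
    exact c.computable_rule

theorem Preserves.append {S : List ℕ → Prop} {cs ds : List Clause} (h : Preserves S cs)
    (h' : Preserves S ds) : Preserves S (cs ++ ds) :=
  fun c hc => (List.mem_append.1 hc).elim (h c) (h' c)

theorem preserves_clauses (δ : DeltaFn L Sk) : Preserves (Meaning δ) clauses :=
  (preserves_rewriteClauses δ).append <| (preserves_heightClauses δ).append <|
    (preserves_stepClauses δ).append <| (preserves_tautologyClauses δ).append
      (preserves_witnessClauses δ)

/-- Induction on derivability: the rules for symbols are correct by decoding, the rule for `δ` by
the assumption on `d`, and the others because clauses preserve meaning. -/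
theorem Derivable.meaning {δ : DeltaFn L Sk} {d : ℕ → ℕ}
    (hd : ∀ (B : Fml L Sk) (xs : List Variable), d (Nat.pair (fmlCode B) (Encodable.encode xs)) =
      Encodable.encode (⟨xs.length, δ B xs⟩ : Σ m, Sk m)) {c : List ℕ}
    (h : Derivable (rules L Sk d) c) : Meaning δ c := by
  induction h with
  | @intro r hr env ps c h hp ih =>
    simp only [rules, List.mem_cons, List.mem_map] at hr
    rcases hr with rfl | rfl | rfl | rfl | rfl | ⟨cl, hcl, rfl⟩
    · rw [neRule] at h
      split at h
      · cases h
      · next hne => cases h; exact hne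
    · obtain ⟨s, -, hs⟩ := Option.map_eq_some_iff.1 h
      cases hs
      exact ⟨.orig s.2, rfl⟩
    · obtain ⟨s, -, hs⟩ := Option.map_eq_some_iff.1 h
      cases hs
      exact ⟨.skolem s.2, rfl⟩
    · obtain ⟨s, -, hs⟩ := Option.map_eq_some_iff.1 h
      cases hs
      exact ⟨s.2, rfl⟩
    · cases h
      intro C X hC hX
      rw [hC, hX, hd]
    · cases h
      exact preserves_clauses δ cl hcl _ fun q hq => ih _ (List.mem_map_of_mem hq)

end Oracles


/-! ### Completeness of the rules -/

theorem subset_clauses : rewriteClauses ⊆ clauses ∧ heightClauses ⊆ clauses ∧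
    stepClauses ⊆ clauses ∧ tautologyClauses ⊆ clauses ∧ witnessClauses ⊆ clauses := by
  simp only [clauses, List.subset_def, List.mem_append]
  tauto

theorem assoc_self {b : Bool} {xs : List ℕ} {v : Variable} (h : b = true ∨ v.isLeft ∨ ∃ x ∈ xs, v = .inr x) :
    Assoc (L := L) (Sk := Sk) b (xs.map fun x => (.inr x, .var (.inr x), false)) v (.var v) := by
  induction xs with
  | nil => exact ⟨rfl, by simpa using h⟩
  | cons y xs ih =>
    by_cases hv : v = .inr y
    · exact .inl ⟨hv, by rw [hv]⟩
    · refine .inr ⟨hv, by simp, ih ?_⟩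
      rcases h with h | h | ⟨x, hx, rfl⟩
      · exact .inl h
      · exact .inr (.inl h)
      · rcases List.mem_cons.1 hx with rfl | hx
        · exact absurd rfl hv
        · exact .inr (.inr ⟨x, hx, rfl⟩)

theorem lookup_map_self {α : Type*} {σ : ℕ → α} {xs : List ℕ} {x : ℕ} (h : x ∈ xs) :
    (xs.map fun x => (x, σ x)).lookup x = some (σ x) := by
  induction xs with
  | nil => simp at h
  | cons y xs ih =>
    by_cases hx : x = y
    · subst hx; simp
    · have : (x == y) = false := by simpa using hx
      rw [List.map_cons, List.lookup, this]
      exact ih ((List.mem_cons.1 h).resolve_left hx)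

section Completeness

variable [Primcodable (Σ m, L.Functions m)] [Primcodable (Σ k, L.Relations k)]
  [Primcodable (Σ m, Sk m)] {d : ℕ → ℕ}

namespace Derivable

/-- The list `env` gives the values of the pattern variables. Premises are collected with
`List.Forall`, which computes to a conjunction, so they can be supplied by `And.intro` or `trivial`.
-/
theorem of_clause {cs : List Clause} (hcs : cs ⊆ clauses) (i : ℕ) (hi : i < cs.length)
    (env : List ℕ)
    (h : (cs[i].1.map (List.map (Pat.eval (env.getD · 0)))).Forall (Derivable (rules L Sk d))) :
    Derivable (rules L Sk d) (cs[i].2.map (Pat.eval (env.getD · 0))) :=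
  .intro (by
    simp only [rules, List.mem_cons, List.mem_map]
    exact .inr (.inr (.inr (.inr (.inr ⟨_, hcs (List.getElem_mem hi), rfl⟩))))) env rfl
    (List.forall_iff_forall_mem.1 h)

theorem ne {a b : ℕ} (h : a ≠ b) : Derivable (rules L Sk d) [0, a, b] :=
  .intro (.head _) [a, b] (if_neg h) (by simp)

theorem symbol {k : ℕ} (f : FunSym L Sk k) : Derivable (rules L Sk d) [1, symCode f, k] := by
  cases f with
  | orig f =>
    refine .intro (.tail _ (.head _)) [Encodable.encode (⟨k, f⟩ : Σ m, L.Functions m)] (ps := []) ?_ (by simp)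
    simp [functionRule, symCode]
  | skolem s =>
    refine .intro (.tail _ (.tail _ (.head _))) [Encodable.encode (⟨k, s⟩ : Σ m, Sk m)] (ps := []) ?_ (by simp)
    simp [skolemRule, symCode]
  | bullet => exact of_clause subset_clauses.1 2 (by decide) [] trivial

theorem relation {k : ℕ} (R : L.Relations k) : Derivable (rules L Sk d)
    [2, Encodable.encode (⟨k, R⟩ : Σ k, L.Relations k), k] := by
  refine .intro (.tail _ (.tail _ (.tail _ (.head _))))
    [Encodable.encode (⟨k, R⟩ : Σ k, L.Relations k)] (ps := []) ?_ (by simp)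
  simp [relationRule]

theorem delta (a b : ℕ) : Derivable (rules L Sk d) [3, a, b, d (Nat.pair a b)] :=
  .intro (.tail _ (.tail _ (.tail _ (.tail _ (.head _))))) [a, b] rfl (by simp)

theorem flip (b : Bool) : Derivable (rules L Sk d) [4, boolCode b, boolCode (!b)] := by
  cases b
  · exact of_clause subset_clauses.1 1 (by decide) [] trivial
  · exact of_clause subset_clauses.1 0 (by decide) [] trivial

theorem assoc {b : Bool} {v : Variable} {t : Tm L Sk} : ∀ {l : List (Variable × Tm L Sk × Bool)},
    Assoc b l v t → Derivable (rules L Sk d) [5, assocCode b l, Encodable.encode v, tmCode t]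
  | [], ⟨h, h'⟩ => by
    subst h
    cases b with
    | true => exact of_clause subset_clauses.1 3 (by decide) [Encodable.encode v] trivial
    | false =>
      obtain ⟨x, rfl⟩ := Sum.isLeft_iff.1 (h'.resolve_left (by simp))
      have := of_clause (L := L) (Sk := Sk) (d := d) subset_clauses.1 4 (by decide) [x] trivial
      rw [tmCode, Encodable.encode_inl]
      exact this
  | (w, u, c) :: l, h => by
    rcases h with ⟨rfl, rfl⟩ | ⟨h1, h2, h3⟩
    · exact of_clause subset_clauses.1 5 (by decide)
        [boolCode b, Encodable.encode v, tmCode t, boolCode c, Encodable.encode (l.map entryCode)]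
        trivial
    · have h4 : Encodable.encode w ≠ Encodable.encode v :=
        fun h => h1 (Encodable.encode_injective h).symm
      cases c with
      | false =>
        exact of_clause subset_clauses.1 6 (by decide) [boolCode b, Encodable.encode w, tmCode u, 0,
          Encodable.encode (l.map entryCode), Encodable.encode v, tmCode t]
          (And.intro (ne h4) (assoc h3))
      | true =>
        exact of_clause subset_clauses.1 7 (by decide) [boolCode b, Encodable.encode w, tmCode u, 0,
          Encodable.encode (l.map entryCode), Encodable.encode v, tmCode t]
          (And.intro (ne h4) (And.intro (ne fun h => h2 rfl (tmCode_injective h).symm) (assoc h3)))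

theorem rwList {s : ℕ} : ∀ {m : ℕ} {f g : Fin m → ℕ},
    (∀ i, Derivable (rules L Sk d) [6, s, f i, g i]) →
    Derivable (rules L Sk d) [7, s, Encodable.encode (List.ofFn f), Encodable.encode (List.ofFn g), m]
  | 0, _, _, _ => of_clause subset_clauses.1 10 (by decide) [s] trivial
  | m + 1, f, g, h => by
    rw [List.ofFn_succ, List.ofFn_succ]
    exact of_clause subset_clauses.1 11 (by decide) [s, f 0, g 0, _, _, m]
      (And.intro (h 0) (rwList fun i => h i.succ))

theorem tmRw {b : Bool} {l : List (Variable × Tm L Sk × Bool)} {t u : Tm L Sk} (h : TmRw b l t u) :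
    Derivable (rules L Sk d) [6, assocCode b l, tmCode t, tmCode u] := by
  induction h with
  | var h => exact of_clause subset_clauses.1 8 (by decide) [_, _, _] (assoc h)
  | func f h ih =>
    exact of_clause subset_clauses.1 9 (by decide) [_, _, _, _, _]
      (And.intro (symbol (L := L) (Sk := Sk) f) (rwList ih))

theorem fmlRw {c b : Bool} {l : List (Variable × Tm L Sk × Bool)} {A A' : Fml L Sk}
    (h : FmlRw c b l A A') :
    Derivable (rules L Sk d) [8, boolCode c, assocCode b l, fmlCode A, fmlCode A'] := by
  induction h with
  | rel R h =>
    exact of_clause subset_clauses.1 12 (by decide) [_, _, _, _, _, _]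
      (And.intro (relation R) (rwList fun i => tmRw (h i)))
  | neg h ih => exact of_clause subset_clauses.1 13 (by decide) [_, _, _, _] ih
  | bin c h h' ih ih' =>
    rw [fmlCode_alphaOp, fmlCode_alphaOp]
    exact of_clause subset_clauses.1 14 (by decide) [_, _, _, _, _, _, _, _]
      (And.intro (flip c) (And.intro ih ih'))
  | @sub q x b l A A' h ih =>
    obtain ⟨c, rfl⟩ : ∃ c, q = gammaQ c := by cases q; exacts [⟨true, rfl⟩, ⟨false, rfl⟩]
    rw [fmlCode, fmlCode, quantCode_gammaQ]
    exact of_clause subset_clauses.1 15 (by decide) [_, _, boolCode b, x,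
      Encodable.encode (l.map entryCode), _, _] (And.intro (flip c) ih)
  | @ren q x y b l A A' h ih =>
    obtain ⟨c, rfl⟩ : ∃ c, q = gammaQ c := by cases q; exacts [⟨true, rfl⟩, ⟨false, rfl⟩]
    rw [fmlCode, fmlCode, quantCode_gammaQ]
    exact of_clause subset_clauses.1 16 (by decide) [_, _, boolCode b, x,
      Encodable.encode (l.map entryCode), _, _, y] (And.intro (flip c) ih)

theorem variant {A A' : Fml L Sk} (h : Variant A A') :
    Derivable (rules L Sk d) [8, 0, Nat.pair 0 0, fmlCode A, fmlCode A'] :=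
  fmlRw (fmlRw_variant.2 h)

theorem replace (A : Fml L Sk) (x : ℕ) (t : Tm L Sk) : Derivable (rules L Sk d)
    [8, 1, Nat.pair 0 (Nat.pair (Nat.pair (Nat.pair (2 * x) (tmCode t)) 1) 0 + 1), fmlCode A,
      fmlCode (A.replace x t)] := by
  have h := fmlRw (d := d) (fmlRw_replace.2 (rfl : A.replace x t = _))
  rw [← singleton_eq_assocCode, Encodable.encode_inl] at h
  exact h

theorem heightList {k : ℕ} : ∀ {m : ℕ} {f : Fin m → ℕ},
    (∀ i, Derivable (rules L Sk d) [9, f i, k]) →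
    Derivable (rules L Sk d) [10, Encodable.encode (List.ofFn f), m, k]
  | 0, _, _ => of_clause subset_clauses.2.1 2 (by decide) [k] trivial
  | m + 1, f, h => by
    rw [List.ofFn_succ]
    exact of_clause subset_clauses.2.1 3 (by decide) [_, _, _, _]
      (And.intro (h 0) (heightList fun i => h i.succ))

theorem height {t : Tm L Sk} : ∀ {k : ℕ}, HerbrandWirth.height t ≤ k →
    Derivable (rules L Sk d) [9, tmCode t, k] := by
  induction t with
  | var v =>
    rintro (_ | k) h
    · simp [HerbrandWirth.height] at h
    · exact of_clause subset_clauses.2.1 0 (by decide) [_, _] trivial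
  | func f ts ih =>
    rintro (_ | k) h
    · exact absurd h (by simp [height_func (L := L) (Sk := Sk) f ts])
    · rw [height_func (L := L) (Sk := Sk) f ts, add_comm, Nat.add_le_add_iff_right] at h
      exact of_clause subset_clauses.2.1 1 (by decide) [_, _, _, _] (And.intro (symbol (L := L) (Sk := Sk) f)
        (heightList fun i => ih i ((Finset.le_sup (f := fun i => HerbrandWirth.height (ts i))
          (Finset.mem_univ i)).trans h)))

theorem mem {a : ℕ} {l : List ℕ} (h : a ∈ l) :
    Derivable (rules L Sk d) [11, a, Encodable.encode l] := by
  induction h with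
  | head l => exact of_clause subset_clauses.2.2.2.1 0 (by decide) [_, _] trivial
  | tail b h ih => exact of_clause subset_clauses.2.2.2.1 1 (by decide) [_, _, _] ih

theorem not_mem {a : ℕ} {l : List ℕ} (h : a ∉ l) :
    Derivable (rules L Sk d) [12, a, Encodable.encode l] := by
  induction l with
  | nil => exact of_clause subset_clauses.2.2.1 0 (by decide) [_] trivial
  | cons b l ih =>
    rw [List.mem_cons, not_or] at h
    exact of_clause subset_clauses.2.2.1 1 (by decide) [_, _, _] (And.intro (ne h.1) (ih h.2))

theorem gammaVars {C : Fml L Sk} {xs : List ℕ} (hnd : xs.Nodup)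
    (h : ∀ x ∈ xs, Sum.inr x ∈ C.freeVars) : Derivable (rules L Sk d)
      [13, fmlCode C, Encodable.encode (xs.map Sum.inr : List Variable),
        Encodable.encode (xs.map fun x =>
          entryCode (L := L) (Sk := Sk) (Sum.inr x, .var (Sum.inr x), false)),
        Encodable.encode (xs.map fun x => tmCode (.var (Sum.inr x) : Tm L Sk))] := by
  induction xs with
  | nil => exact of_clause subset_clauses.2.2.1 2 (by decide) [_] trivial
  | cons x xs ih =>
    rw [List.nodup_cons] at hnd
    rw [List.forall_mem_cons] at h
    have h1 := not_mem (L := L) (Sk := Sk) (d := d) (a := Encodable.encode (Sum.inr x : Variable))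
      (l := (xs.map Sum.inr).map Encodable.encode) (by
        rw [List.mem_map_of_injective Encodable.encode_injective,
          List.mem_map_of_injective Sum.inr_injective]
        exact hnd.1)
    rw [encode_map_encode] at h1
    have h2 := fmlRw (d := d) (fmlRw_replace (v := .inr x) (t := .var (.inr (x + 1))).2
      (rfl : _ = C.subst _))
    -- The number of the variable is changed to its successor, so the variable no longer occurs in
    -- the result.
    have h3 : C ≠ C.subst (Function.update Term.var (.inr x) (.var (.inr (x + 1)))) := by
      intro hC
      have h4 := h.1
      rw [hC] at h4
      obtain ⟨v, -, hv⟩ := Fml.exists_of_mem_freeVars_subst C h4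
      by_cases hvx : v = .inr x
      · subst hvx; simp at hv
      · rw [Function.update_of_ne hvx] at hv
        simp at hv
        exact hvx hv.symm
    have h4 := ne (L := L) (Sk := Sk) (d := d) fun h => h3 (fmlCode_injective h)
    exact of_clause subset_clauses.2.2.1 3 (by decide) [_, _, _, _, x, _]
      (And.intro (ih hnd.2 h.2) (And.intro h1 (And.intro h2 h4)))

end Derivable

end Completeness


section Completeness

variable [Primcodable (Σ m, L.Functions m)] [Primcodable (Σ k, L.Relations k)]
  [Primcodable (Σ m, Sk m)] {d : ℕ → ℕ}

namespace Derivable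

/-- If the list contains all γ-variables of the formula, the identity is among its partial
substitutions even with default `false`. -/
theorem gammaCover {C : Fml L Sk} {xs : List ℕ} (h : ∀ x, Sum.inr x ∈ C.freeVars → x ∈ xs) :
    Derivable (rules L Sk d) [8, 1, Nat.pair 1 (Encodable.encode (xs.map fun x =>
      entryCode (L := L) (Sk := Sk) (Sum.inr x, .var (Sum.inr x), false))), fmlCode C,
      fmlCode C] := by
  have h1 := fmlRw (d := d) (fmlRw_subst (b := false)
    (l := xs.map fun x => (.inr x, .var (.inr x), false)) (s := Term.var) C fun v hv =>
      assoc_self (by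
        cases v with
        | inl v => simp
        | inr v => exact .inr (.inr ⟨v, h v hv, rfl⟩)))
  rw [assocCode, List.map_map, Fml.subst_var] at h1
  exact h1

theorem aStep {δ : DeltaFn L Sk}
    (hd : ∀ (B : Fml L Sk) (xs : List Variable), d (Nat.pair (fmlCode B) (Encodable.encode xs)) =
      Encodable.encode (⟨xs.length, δ B xs⟩ : Σ m, Sk m))
    {p : Bool} {B A : Fml L Sk} (h : AStep δ p B A) :
    Derivable (rules L Sk d) [14, boolCode p, fmlCode B, fmlCode A] := by
  have hs := (subset_clauses.2.2.1 : stepClauses ⊆ clauses)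
  have hctx (c : Bool) {p : Bool} {B A : Fml L Sk} (H : Fml L Sk)
      (ih : Derivable (rules L Sk d) [14, boolCode p, fmlCode B, fmlCode A]) :
      Derivable (rules L Sk d) [14, boolCode p, fmlCode (alphaOp c B H), fmlCode (alphaOp c A H)] ∧
      Derivable (rules L Sk d) [14, boolCode p, fmlCode (alphaOp c H B), fmlCode (alphaOp c H A)] := by
    simp only [fmlCode_alphaOp]
    exact ⟨of_clause hs 8 (by decide) [_, _, _, _, _, _]
        (And.intro (flip c) (And.intro ih (variant (.refl H)))),
      of_clause hs 9 (by decide) [_, _, _, _, _, _]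
        (And.intro (flip c) (And.intro ih (variant (.refl H))))⟩
  induction h with
  | simplification p H H' h =>
    rw [fmlCode_alphaOp]
    exact of_clause hs 4 (by decide) [_, _, _, _] (And.intro (flip p) (variant h))
  | gamma p x H =>
    rw [fmlCode, quantCode_gammaQ]
    exact of_clause hs 5 (by decide) [_, _, _, _, _] (And.intro (flip p) (replace H x (.var (Sum.inr x))))
  | delta p y H xs hnd hxs =>
    have h1 := replace (d := d) H y (deltaTerm δ (.quant (deltaQ p) y H) (xs.map Sum.inr))
    rw [tmCode_deltaTerm, ← hd, List.map_map] at h1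
    have h2 := delta (L := L) (Sk := Sk) (d := d) (fmlCode (.quant (deltaQ p) y H))
      (Encodable.encode (xs.map Sum.inr : List Variable))
    have h3 := gammaVars (d := d) hnd fun x hx => (hxs x).1 hx
    have h4 := gammaCover (d := d) fun x hx => (hxs x).2 hx
    have hC : fmlCode (.quant (deltaQ p) y H) =
        Nat.pair 4 (Nat.pair (boolCode (!p)) (Nat.pair y (fmlCode H))) := by
      rw [fmlCode, quantCode_deltaQ]
    rw [hC] at h1 h2 h3 h4 ⊢
    exact of_clause hs 6 (by decide) [_, boolCode (!p), y, fmlCode H, _, _, _,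
      Nat.pair 4 (Nat.pair (boolCode (!p)) (Nat.pair y (fmlCode H))), _, _] (And.intro (flip p)
      (And.intro (variant (.refl H)) (And.intro h3 (And.intro h4 (And.intro h2 h1)))))
  | @neg p A A' h ih => exact of_clause hs 7 (by decide) [_, _, _, _] (And.intro (flip p) ih)
  | orL h B ih => exact (hctx true B ih).1
  | orR B h ih => exact (hctx true B ih).2
  | andL h B ih => exact (hctx false B ih).1
  | andR B h ih => exact (hctx false B ih).2

theorem chain {δ : DeltaFn L Sk}
    (hd : ∀ (B : Fml L Sk) (xs : List Variable), d (Nat.pair (fmlCode B) (Encodable.encode xs)) =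
      Encodable.encode (⟨xs.length, δ B xs⟩ : Σ m, Sk m))
    {B A : Fml L Sk} (h : Relation.ReflTransGen (AStep δ true) B A) :
    ∃ D : List (Fml L Sk),
      Derivable (rules L Sk d) [15, fmlCode B, fmlCode A, Encodable.encode (D.map fmlCode)] := by
  have hs := (subset_clauses.2.2.1 : stepClauses ⊆ clauses)
  induction h using Relation.ReflTransGen.head_induction_on with
  | refl => exact ⟨[A], of_clause hs 10 (by decide) [_] (variant (.refl A))⟩
  | head h _ ih =>
    obtain ⟨D, hD⟩ := ih
    exact ⟨_ :: D, of_clause hs 11 (by decide) [_, _, _, _] (And.intro (aStep hd h) hD)⟩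

theorem substList {k : ℕ} {S : List (ℕ × Tm L Sk)} (h : ∀ e ∈ S, HerbrandWirth.height e.2 ≤ k) :
    Derivable (rules L Sk d) [16, Encodable.encode (S.map fun e => (e.1, tmCode e.2)),
      Encodable.encode (S.map fun e => entryCode (Sum.inr e.1, e.2, false)), k] := by
  have hs := (subset_clauses.2.2.2.2 : witnessClauses ⊆ clauses)
  induction S with
  | nil => exact of_clause hs 0 (by decide) [_] trivial
  | cons e S ih =>
    rw [List.forall_mem_cons] at h
    exact of_clause hs 1 (by decide) [e.1, _, _, _, _] (And.intro (height h.1) (ih h.2))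

/-- Completeness of the sequent clauses: the formulas in `l'` are decomposed and atoms are stored in
`l`, until some atom is stored with both signs. All decompositions are invertible, so validity is
never lost. -/
theorem sequent (n : ℕ) : ∀ {l l' : List (Bool × Fml L Sk)},
    -- With this weight, splitting a connective into its two members and moving an atom to the other
    -- list both lower the sum.
    (l'.map fun e => 2 * e.2.size + 1).sum ≤ n →
    (∀ e ∈ l, ∃ (k : ℕ) (R : L.Relations k) (ts : Fin k → Tm L Sk), e.2 = .rel R ts) →
    (∀ e ∈ l', e.2.QF) →
    (∀ val : ∀ k : ℕ, L.Relations k → (Fin k → Tm L Sk) → Prop,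
      ∃ e ∈ l ++ l', e.2.eval val ↔ e.1 = true) →
    Derivable (rules L Sk d) [17, signedCode l, signedCode l'] := by
  have hs := (subset_clauses.2.2.2.1 : tautologyClauses ⊆ clauses)
  have halpha (n : ℕ) (ih : ∀ {l l' : List (Bool × Fml L Sk)},
      (l'.map fun e => 2 * e.2.size + 1).sum ≤ n →
      (∀ e ∈ l, ∃ (k : ℕ) (R : L.Relations k) (ts : Fin k → Tm L Sk), e.2 = .rel R ts) →
      (∀ e ∈ l', e.2.QF) →
      (∀ val : ∀ k : ℕ, L.Relations k → (Fin k → Tm L Sk) → Prop,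
        ∃ e ∈ l ++ l', e.2.eval val ↔ e.1 = true) →
      Derivable (rules L Sk d) [17, signedCode l, signedCode l'])
      (q c : Bool) (A B : Fml L Sk) (l l' : List (Bool × Fml L Sk))
      (hn : 2 * (A.size + B.size + 1) + 1 + (l'.map fun e => 2 * e.2.size + 1).sum ≤ n + 1)
      (hl : ∀ e ∈ l, ∃ (k : ℕ) (R : L.Relations k) (ts : Fin k → Tm L Sk), e.2 = .rel R ts)
      (hA : A.QF) (hB : B.QF) (hl' : ∀ e ∈ l', e.2.QF)
      (hval : ∀ val : ∀ k : ℕ, L.Relations k → (Fin k → Tm L Sk) → Prop,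
        ∃ e ∈ l ++ (c, alphaOp q A B) :: l', e.2.eval val ↔ e.1 = true) :
      Derivable (rules L Sk d) [17, signedCode l, signedCode ((c, alphaOp q A B) :: l')] := by
    have hcode : signedCode ((c, alphaOp q A B) :: l') = Nat.pair (Nat.pair (boolCode c)
        (Nat.pair (boolCode q + 2) (Nat.pair (fmlCode A) (fmlCode B)))) (signedCode l') + 1 := by
      rw [← fmlCode_alphaOp]; rfl
    rw [hcode]
    simp only [List.mem_append, List.mem_cons, or_and_right, exists_or, exists_eq_left] at hval
    by_cases hqc : q = c
    · subst hqc
      refine of_clause hs 2 (by decide) [_, _, _, _, signedCode l'] (ih (l' := (q, A) :: (q, B) :: l')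
        ?_ hl ?_ fun val => ?_)
      · simp only [List.map_cons, List.sum_cons]; omega
      · exact List.forall_mem_cons.2 ⟨hA, List.forall_mem_cons.2 ⟨hB, hl'⟩⟩
      · have h := hval val
        rw [eval_alphaOp_iff] at h
        simpa only [List.mem_append, List.mem_cons, or_and_right, exists_or, exists_eq_left,
          or_assoc] using h
    · obtain rfl : q = !c := Bool.eq_not.2 hqc
      have h (A : Fml L Sk) (hA : A.QF)
          (hn : 2 * A.size + 1 + (l'.map fun e => 2 * e.2.size + 1).sum ≤ n)
          (hval : ∀ val : ∀ k : ℕ, L.Relations k → (Fin k → Tm L Sk) → Prop,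
            (∃ e ∈ l, e.2.eval val ↔ e.1 = true) ∨ (A.eval val ↔ c = true) ∨
              ∃ e ∈ l', e.2.eval val ↔ e.1 = true) :=
        ih (l := l) (l' := (c, A) :: l') hn hl (List.forall_mem_cons.2 ⟨hA, hl'⟩) fun val => by
          simpa only [List.mem_append, List.mem_cons, or_and_right, exists_or, exists_eq_left]
            using hval val
      simp only [eval_alphaOp_not_iff] at hval
      exact of_clause hs 3 (by decide) [_, _, _, _, signedCode l', _] (And.intro (flip c) (And.intro
        (h A hA (by omega) fun val => (hval val).imp_right (Or.imp_left And.left))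
        (h B hB (by omega) fun val => (hval val).imp_right (Or.imp_left And.right))))
  induction n with
  | zero =>
    intro l l' hn hl hl' hval
    cases l' with
    | cons e l' => simp at hn
    | nil =>
      -- The valuation makes true exactly the atoms stored as false. A stored entry that
      -- nevertheless agrees with it must have the sign `true`, and its atom is then also stored as
      -- false.
      obtain ⟨⟨c, A⟩, he, h⟩ := hval fun k R ts => (false, Fml.rel R ts) ∈ l
      rw [List.append_nil] at he
      obtain ⟨k, R, ts, rfl : A = _⟩ := hl _ he
      cases c with
      | false => exact absurd he (by simpa [Fml.eval] using h)
      | true =>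
        have h : (false, Fml.rel R ts) ∈ l := by simpa [Fml.eval] using h
        exact of_clause hs 6 (by decide) [_, _]
          (And.intro (mem (List.mem_map_of_mem he)) (mem (List.mem_map_of_mem h)))
  | succ n ih =>
    intro l l' hn hl hl' hval
    cases l' with
    | nil => exact ih (by simp) hl hl' hval
    | cons e l' =>
      obtain ⟨c, A⟩ := e
      rw [List.forall_mem_cons] at hl'
      rw [List.map_cons, List.sum_cons] at hn
      cases A with
      | quant q x A => exact hl'.1.elim
      | or A B => exact halpha n ih true c A B l l' hn hl hl'.1.1 hl'.1.2 hl'.2 hval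
      | and A B => exact halpha n ih false c A B l l' hn hl hl'.1.1 hl'.1.2 hl'.2 hval
      | neg A =>
        refine of_clause hs 4 (by decide) [_, _, _, _, signedCode l'] (And.intro (flip c)
          (ih (l' := (!c, A) :: l') ?_ hl (List.forall_mem_cons.2 hl') fun val => ?_))
        · simp only [List.map_cons, List.sum_cons, Fml.size] at hn ⊢; omega
        · obtain ⟨e, he, h⟩ := hval val
          simp only [List.mem_append, List.mem_cons] at he
          rcases he with he | rfl | he
          · exact ⟨e, by simp [he], h⟩
          · refine ⟨(!c, A), by simp, ?_⟩
            cases c <;> simpa [Fml.eval] using h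
          · exact ⟨e, by simp [he], h⟩
      | rel R ts =>
        refine of_clause hs 5 (by decide) [_, _, _, signedCode l']
          (ih (l := (c, .rel R ts) :: l) (l' := l') ?_
            (List.forall_mem_cons.2 ⟨⟨_, _, _, rfl⟩, hl⟩) hl'.2 fun val => ?_)
        · omega
        · obtain ⟨e, he, h⟩ := hval val
          refine ⟨e, ?_, h⟩
          simp only [List.cons_append, List.mem_append, List.mem_cons] at he ⊢
          tauto

theorem witness {δ : DeltaFn L Sk}
    (hd : ∀ (B : Fml L Sk) (xs : List Variable), d (Nat.pair (fmlCode B) (Encodable.encode xs)) =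
      Encodable.encode (⟨xs.length, δ B xs⟩ : Σ m, Sk m))
    {A B : Fml L Sk} {n : ℕ} (hn : 0 < n) {σ : ℕ → Tm L Sk}
    (hσ : ∀ x, Sum.inr x ∈ B.freeVars → HerbrandWirth.height (σ x) < n)
    (htaut : (B.instGamma σ).Tautology) (h : Relation.ReflTransGen (AStep δ true) B A) :
    ∃ w, Derivable (rules L Sk d) [18, fmlCode A, n, w] := by
  -- The clause for witnesses bounds heights by the predecessor of the order, so positivity of the
  -- order is needed here.
  obtain ⟨n, rfl⟩ := Nat.exists_eq_succ_of_ne_zero hn.ne'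
  obtain ⟨D, hD⟩ := chain hd h
  set xs := B.freeVars.toRight.toList with hxs
  have h1 := substList (d := d) (k := n) (S := xs.map fun x => (x, σ x)) fun e he => by
    obtain ⟨x, hx, rfl⟩ := List.mem_map.1 he
    exact Nat.le_of_lt_succ (hσ x (by simpa [hxs] using hx))
  have h2 := fmlRw (d := d) (fmlRw_subst (b := false)
    (l := (xs.map fun x => (x, σ x)).map fun e => (Sum.inr e.1, e.2, false))
    (s := Sum.elim (fun x => .var (Sum.inl x)) σ) B fun v hv => by
      rw [assoc_listSubst]
      cases v with
      | inl x => simp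
      | inr x =>
        have hx : x ∈ xs := by simpa [hxs] using hv
        refine ⟨?_, .inr ⟨_, List.mem_map_of_mem hx, rfl, rfl⟩⟩
        rw [Sum.elim_inr, Sum.elim_inr, listSubst, lookup_map_self hx, Option.getD_some])
  have h3 := sequent (d := d) _ (l := []) (l' := [(true, B.instGamma σ)]) le_rfl (by simp)
    (by simpa using htaut.1) (by simpa using htaut.2)
  rw [assocCode, List.map_map] at h2
  exact ⟨_, of_clause subset_clauses.2.2.2.2 2 (by decide) [_, _, _, _, _, n, _]
    (And.intro hD (And.intro h1 (And.intro h2 h3)))⟩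

end Derivable

end Completeness

/-! ### The theorem -/

theorem exists_isDerivation {δ : DeltaFn L Sk} {B A : Fml L Sk}
    (h : Relation.ReflTransGen (AStep δ true) B A) : ∃ D, IsDerivation δ B A D := by
  induction h using Relation.ReflTransGen.head_induction_on with
  | refl => exact ⟨[A], by simp [IsDerivation]⟩
  | head h _ ih =>
    obtain ⟨D, h1, h2, h3⟩ := ih
    obtain ⟨C, D, rfl⟩ := List.exists_cons_of_ne_nil (fun h : D = [] => by simp [h] at h2)
    cases h2
    exact ⟨_, List.isChain_cons_cons.2 ⟨h.step, h1⟩, rfl, by rw [List.getLast?_cons_cons]; exact h3⟩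

end HerbrandWirth

theorem mainTheorem2 {L : FirstOrder.Language.{u, v}} {Sk : ℕ → Type w}
    (δ : HerbrandWirth.DeltaFn L Sk) (hδ : δ.Admissible) :
    -- the equivalence of the two statements
    (∀ (A : HerbrandWirth.Fml L Sk) (n : ℕ), A.Original → A.Rectified → 0 < n →
      (HerbrandWirth.PropertyCstar δ n A ↔
        ∃ (B : HerbrandWirth.Fml L Sk) (σ : ℕ → HerbrandWirth.Tm L Sk)
          (D : List (HerbrandWirth.Fml L Sk)), HerbrandWirth.IsWitness δ n A B σ D)) ∧
    -- the construction of witnesses: for effectively given symbols and computable δ, an algorithm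
    -- finds witnesses for the second statement from A and n whenever the first statement holds
    (∀ [Primcodable (Σ m, L.Functions m)] [Primcodable (Σ k, L.Relations k)]
        [Primcodable (Σ m, Sk m)],
      Computable (Sigma.fst : (Σ m, L.Functions m) → ℕ) →
      Computable (Sigma.fst : (Σ k, L.Relations k) → ℕ) →
      Computable (Sigma.fst : (Σ m, Sk m) → ℕ) →
      δ.Effective →
      ∃ g : ℕ → ℕ →. ℕ, Partrec₂ g ∧
        ∀ (A : HerbrandWirth.Fml L Sk) (n : ℕ), A.Original → A.Rectified → 0 < n →
          HerbrandWirth.PropertyCstar δ n A →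
          ∃ (B : HerbrandWirth.Fml L Sk) (l : List (ℕ × HerbrandWirth.Tm L Sk))
            (D : List (HerbrandWirth.Fml L Sk)),
            HerbrandWirth.IsWitness δ n A B (HerbrandWirth.listSubst l) D ∧
              HerbrandWirth.witnessCode B l D ∈ g (HerbrandWirth.fmlCode A) n) := by
  open HerbrandWirth in
  refine ⟨fun A n hA hr _ => ⟨fun h => ?_, fun ⟨B, σ, D, hw⟩ =>
    propertyCstar_of_isWitness hδ hA hr hw⟩, ?_⟩
  · obtain ⟨B, σ, hqf, hσ, ht, hAB⟩ := exists_derivation hδ hA hr h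
    obtain ⟨D, hD⟩ := exists_isDerivation hAB
    exact ⟨B, σ, D, hqf, hσ, ht, hD⟩
  · intro _ _ _ hf hr hs ⟨d, hd, hdδ⟩
    -- The tag 18 marks the facts that state witnesses.
    obtain ⟨g, hg, h⟩ := exists_partrec_derivable (computable_rules hf hr hs hd) 18
    refine ⟨g, hg, fun A n hA hrect hn hC => ?_⟩
    obtain ⟨B, σ, -, hσ, ht, hAB⟩ := exists_derivation hδ hA hrect hC
    -- Completeness makes the search terminate; what it finds need not be the witness constructed
    -- above, but by soundness of the rules it is a witness for the formula with this code.
    have hdom := (h (fmlCode A) n).2 (Derivable.witness hdδ hn hσ ht hAB)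
    obtain ⟨A', B', l, D, hA', hw, hwit⟩ := ((h _ n).1 _ (Part.get_mem hdom)).meaning hdδ
    obtain rfl := fmlCode_injective hA'
    exact ⟨B', l, D, hwit, hw ▸ Part.get_mem hdom⟩
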